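/- **Setting.** Let $K$ be a field of characteristic zero, $n\ge 1$, $1\le i\le n$, $d\ge 0$. A permutation is a bijection of $\mathbb N=\{1,2,\dots\}$ fixing all but finitely many points; $\ell(w)=\#\{a<b: w(a)>w(b)\}$; $t_{pq}$ is the transposition of $p<q$; write $w\lessdot wt_{pq}$ if $\ell(wt_{pq})=\ell(w)+1$. Let $S^{(n)}$ be the set of permutations $w$ with $w(n+1)<w(n+2)<\cdots$. Let $\mathfrak b$ be the Lie algebra of upper triangular $n\times n$ matrices over $K$, with matrix units $e_{pq}$ ($p\le q\le n$). Let $K^i$ have basis $u_1,\dots,u_i$ and $\mathfrak b$-action $e_{pq}u_j=\delta_{qj}u_p$. Let $U$ have basis $u_{ab}$ ($1\le a\le n$, $b\in\mathbb N$) and action $e_{pq}u_{ab}=\delta_{qa}u_{pb}$, and let $T=\bigoplus_k\bigwedge^k U$, on which $\mathfrak b$ acts by derivations. For $w\in S^{(n)}$ put $u_w=\bigwedge_{a<b,\;w(a)>w(b)}u_{ab}\in T$ (factors in lexicographic order), and let the KP module $\mathcal S_w$ be the $\mathfrak b$-submodule of $T$ generated by $u_w$. A KP filtration of a $\mathfrak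 b$-module $M$ is a chain of submodules $0=M_0\subseteq\cdots\subseteq M_r=M$ such that each $M_j/M_{j-1}$ is isomorphic to $\mathcal S_z$ for some $z\in S^{(n)}$. Regard $S^d(K^i)$ and $\bigwedge^d(K^i)$ as the submodules of symmetric and antisymmetric tensors in $\bigotimes^d K^i$, with $\prod_j u_{p_j}=\sum_{\sigma\in S_d} u_{p_{\sigma(1)}}\otimes\cdots\otimes u_{p_{\sigma(d)}}$ and $\bigwedge_j u_{p_j}=\sum_{\sigma\in S_d}\operatorname{sgn}(\sigma)\,u_{p_{\sigma(1)}}\otimes\cdots\otimes u_{p_{\sigma(d)}}$. For $w\in S^{(n)}$ let $X_{i,d}(w)$ (resp. $Y_{i,d}(w)$) be the set of permutations $\zeta=t_{p_1q_1}\cdots t_{p_dq_d}$ with $p_j\le i<q_j$, $w_1\lessdot w_2\lessdot\cdots\lessdot w_{d+1}$ and $w_1(p_1)<w_2(p_2)<\cdots<w_d(p_d)$ (resp. $w_1(q_1)>w_2(q_2)>\cdots>w_d(q_d)$), where $w_j=wt_{p_1q_1}\cdots t_{p_{j-1}q_{j-1}}$. For a permutation $z$ and $p<q$ let $m_{pq}(z)=\#\{r>q: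 z(p)<z(r)<z(q)\}$ and $m'_{qp}(z)=\#\{r<p: z(p)<z(r)<z(q)\}$. For each $\zeta\in X_{i,d}(w)$ (resp. $Y_{i,d}(w)$) take any decomposition as above and put $$v_\zeta=\Big(\prod_j e_{p_jq_j}^{\,m_{p_jq_j}(w_j)}u_w\Big)\otimes\prod_j u_{p_j}\quad\Big(\text{resp. } \Big(\prod_j e_{p_jq_j}^{\,m_{p_jq_j}(w_j)}u_w\Big)\otimes\bigwedge_j u_{p_j}\Big),$$ where a factor with $q_j>n$ has exponent $0$ and is the identity. Let $e'_{qp}$ be the derivation of $T$ with $e'_{qp}u_{ab}=\delta_{pb}u_{aq}$, let $\mu_q\colon T\otimes\bigotimes^{a}K^i\to T\otimes\bigotimes^{a-1}K^i$ (for $a\ge1$) be the map $t\otimes(u_p\otimes x)\mapsto(u_{pq}\wedge t)\otimes x$, and define $$\phi_\zeta=\mu_{q_d}\cdots\mu_{q_1}\cdot\prod_j(e'_{q_jp_j})^{m'_{q_jp_j}(w_j)}\colon\; T\otimes\textstyle\bigotimes^d K^i\to T,$$ the operators $e'$ acting on the factor $T$. For permutations $u,v$, say $u<v$ in the lexicographic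 (resp. reverse lexicographic) order if for some $k$ we have $u(k)<v(k)$ and $u(j)=v(j)$ for all $j<k$ (resp. $j>k$). **Theorem.** Let $w\in S^{(n)}$ and $M=\mathcal S_w\otimes S^d(K^i)$ (resp. $M=\mathcal S_w\otimes\bigwedge^d(K^i)$). The set $X_{i,d}(w)$ (resp. $Y_{i,d}(w)$) is finite; list its elements as $\zeta_1,\dots,\zeta_r$ so that the permutations $(w\zeta_j)^{-1}$ increase strictly in the lexicographic (resp. reverse lexicographic) order. Then: 1. $M$ is generated as a $\mathfrak b$-module by $v_{\zeta_1},\dots,v_{\zeta_r}$. 2. With $\langle\cdots\rangle$ denoting the generated $\mathfrak b$-submodule, the chain $$0\subseteq\langle v_{\zeta_1}\rangle\subseteq\langle v_{\zeta_1},v_{\zeta_2}\rangle\subseteq\cdots\subseteq\langle v_{\zeta_1},\dots,v_{\zeta_r}\rangle$$ is a KP filtration of $M$. 3. For each $j$ we have $w\zeta_j\in S^{(n)}$, and $\phi_{\zeta_j}$ restricted to $\langle v_{\zeta_1},\dots,v_{\zeta_j}\rangle$ induces an isomorphism of $\mathfrak b$-modules $$\langle v_{\zeta_1},\dots,v_{\zeta_j}\rangle/\langle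 v_{\zeta_1},\dots,v_{\zeta_{j-1}}\rangle\;\cong\;\mathcal S_{w\zeta_j}.$$ -/

import Mathlib

open scoped TensorProduct

attribute [local instance 100] LieRing.ofAssociativeRing

noncomputable section

namespace KP

/-! Conventions.  All positive integers are shifted down by one: the letter `k` of the usual
one-based notation is the natural number `k - 1`.  So permutations are permutations of `ℕ`,
rows are indexed by `Fin n`, and `p ≤ i < q` becomes `p < i ∧ i ≤ q`. -/

/-! ### Permutations -/

section Permutations

/-- The permutations of `ℕ` with finite support that are increasing from position `n` on
(in one-based notation, `w (n+1) < w (n+2) < ...`). -/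
def permSet (n : ℕ) : Set (Equiv.Perm ℕ) :=
  {w | {k | w k ≠ k}.Finite ∧ StrictMonoOn w (Set.Ici n)}

/-- The number of inversions of a permutation (of finite support). -/
def length (w : Equiv.Perm ℕ) : ℕ :=
  Set.ncard {x : ℕ × ℕ | x.1 < x.2 ∧ w x.2 < w x.1}

/-- The transposition `t_{pq}` attached to a pair `(p, q)`. -/
def transp (x : ℕ × ℕ) : Equiv.Perm ℕ := Equiv.swap x.1 x.2

/-- For a sequence `c` of pairs `(p_j, q_j)`, the product `t_{p_1 q_1} ⋯ t_{p_d q_d}`. -/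
def chainProd {d : ℕ} (c : Fin d → ℕ × ℕ) : Equiv.Perm ℕ :=
  (List.ofFn fun k => transp (c k)).prod

/-- The permutation `w t_{p_1 q_1} ⋯ t_{p_j q_j}`, the product of `w` and of the first `j`
transpositions of the sequence `c`. -/
def chainPerm {d : ℕ} (w : Equiv.Perm ℕ) (c : Fin d → ℕ × ℕ) (j : ℕ) : Equiv.Perm ℕ :=
  w * ((List.ofFn fun k => transp (c k)).take j).prod

/-- The conditions common to both Pieri rules: `p_j` is one of the first `i` positions, `q_j` is
not, and each transposition raises the length by exactly one. -/
def IsPieriChain (w : Equiv.Perm ℕ) (i : ℕ) {d : ℕ} (c : Fin d → ℕ × ℕ) : Prop :=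
  ∀ j : Fin d, (c j).1 < i ∧ i ≤ (c j).2 ∧
    length (chainPerm w c (j + 1)) = length (chainPerm w c j) + 1

/-- The decompositions allowed in the set `X_{i,d}(w)`: `w_1(p_1) < w_2(p_2) < ⋯`. -/
def IsXChain (w : Equiv.Perm ℕ) (i : ℕ) {d : ℕ} (c : Fin d → ℕ × ℕ) : Prop :=
  IsPieriChain w i c ∧ StrictMono fun j : Fin d => chainPerm w c j (c j).1

/-- The decompositions allowed in the set `Y_{i,d}(w)`: `w_1(q_1) > w_2(q_2) > ⋯`. -/
def IsYChain (w : Equiv.Perm ℕ) (i : ℕ) {d : ℕ} (c : Fin d → ℕ × ℕ) : Prop :=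
  IsPieriChain w i c ∧ StrictAnti fun j : Fin d => chainPerm w c j (c j).2

/-- The set `X_{i,d}(w)`. -/
def setX (w : Equiv.Perm ℕ) (i d : ℕ) : Set (Equiv.Perm ℕ) :=
  {ζ | ∃ c : Fin d → ℕ × ℕ, IsXChain w i c ∧ chainProd c = ζ}

/-- The set `Y_{i,d}(w)`. -/
def setY (w : Equiv.Perm ℕ) (i d : ℕ) : Set (Equiv.Perm ℕ) :=
  {ζ | ∃ c : Fin d → ℕ × ℕ, IsYChain w i c ∧ chainProd c = ζ}

/-- The lexicographic order on permutations. -/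
def LexLt (u v : Equiv.Perm ℕ) : Prop := ∃ k, (∀ j < k, u j = v j) ∧ u k < v k

/-- The reverse lexicographic order on permutations. -/
def RevLexLt (u v : Equiv.Perm ℕ) : Prop := ∃ k, (∀ j > k, u j = v j) ∧ u k < v k

/-- `m_{pq}(z) = #{r > q : z(p) < z(r) < z(q)}`. -/
def mRight (z : Equiv.Perm ℕ) (p q : ℕ) : ℕ := Set.ncard {r | q < r ∧ z p < z r ∧ z r < z q}

/-- `m'_{qp}(z) = #{r < p : z(p) < z(r) < z(q)}`. -/
def mLeft (z : Equiv.Perm ℕ) (q p : ℕ) : ℕ := Set.ncard {r | r < p ∧ z p < z r ∧ z r < z q}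

end Permutations

/-! ### Exterior algebras and tensor powers as modules over a Lie algebra -/

section Derivation

variable {K V : Type*} [Field K] [AddCommGroup V] [Module K V]

/-- Auxiliary algebra map `v ↦ v + ε f(v)` from the exterior algebra to its dual numbers. -/
def derivAux (f : Module.End K V) :
    ExteriorAlgebra K V →ₐ[K] DualNumber (ExteriorAlgebra K V) :=
  ExteriorAlgebra.lift K
    ⟨(TrivSqZeroExt.inlAlgHom K _ _).toLinearMap ∘ₗ ExteriorAlgebra.ι K +
      (TrivSqZeroExt.inrHom (ExteriorAlgebra K V) (ExteriorAlgebra K V)).restrictScalars K ∘ₗ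
        ExteriorAlgebra.ι K ∘ₗ f, by
      intro m
      ext
      · simp
      · simp [ExteriorAlgebra.ι_add_mul_swap]⟩

/-- The extension of an endomorphism `f` of `V` to a derivation of the exterior algebra:
`v₁ ∧ v₂ ∧ ⋯ ↦ ∑ k, ⋯ ∧ f(v_k) ∧ ⋯`; see `deriv_ι`, `deriv_one` and `deriv_mul`. -/
def deriv (f : Module.End K V) : Module.End K (ExteriorAlgebra K V) :=
  (TrivSqZeroExt.sndHom (ExteriorAlgebra K V) (ExteriorAlgebra K V)).restrictScalars K ∘ₗ
    (derivAux f).toLinearMap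

theorem derivAux_fst (f : Module.End K V) (a : ExteriorAlgebra K V) :
    (derivAux f a).fst = a := by
  induction a using ExteriorAlgebra.induction with
  | algebraMap r => simp [TrivSqZeroExt.algebraMap_eq_inl']
  | ι x => simp [derivAux]
  | mul a b ha hb => simp [ha, hb]
  | add a b ha hb => simp [ha, hb]

theorem deriv_ι (f : Module.End K V) (v : V) :
    deriv f (ExteriorAlgebra.ι K v) = ExteriorAlgebra.ι K (f v) := by
  simp [deriv, derivAux]

theorem deriv_algebraMap (f : Module.End K V) (r : K) :
    deriv f (algebraMap K (ExteriorAlgebra K V) r) = 0 := by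
  simp [deriv, TrivSqZeroExt.algebraMap_eq_inl']

theorem deriv_one (f : Module.End K V) : deriv f (1 : ExteriorAlgebra K V) = 0 := by
  simp [deriv]

theorem deriv_mul (f : Module.End K V) (a b : ExteriorAlgebra K V) :
    deriv f (a * b) = deriv f a * b + a * deriv f b := by
  simp [deriv, derivAux_fst, add_comm]

theorem deriv_add (f g : Module.End K V) : deriv (f + g) = deriv f + deriv g := by
  refine LinearMap.ext fun a => ?_
  induction a using ExteriorAlgebra.induction with
  | algebraMap r => simp [deriv_algebraMap]
  | ι x => simp [deriv_ι]
  | mul a b ha hb =>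
    simp only [LinearMap.add_apply] at ha hb ⊢
    simp only [deriv_mul, ha, hb]
    noncomm_ring
  | add a b ha hb => simp only [map_add, ha, hb]

theorem deriv_smul (r : K) (f : Module.End K V) : deriv (r • f) = r • deriv f := by
  refine LinearMap.ext fun a => ?_
  induction a using ExteriorAlgebra.induction with
  | algebraMap r => simp [deriv_algebraMap]
  | ι x => simp [deriv_ι]
  | mul a b ha hb =>
    simp only [LinearMap.smul_apply] at ha hb ⊢
    simp only [deriv_mul, ha, hb, smul_add, smul_mul_assoc, mul_smul_comm]
  | add a b ha hb => simp only [map_add, ha, hb]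

theorem deriv_lie (f g : Module.End K V) : deriv ⁅f, g⁆ = ⁅deriv f, deriv g⁆ := by
  refine LinearMap.ext fun a => ?_
  induction a using ExteriorAlgebra.induction with
  | algebraMap r => simp [deriv_algebraMap, LieRing.of_associative_ring_bracket]
  | ι x => simp [deriv_ι, LieRing.of_associative_ring_bracket]
  | mul a b ha hb =>
    simp only [LieRing.of_associative_ring_bracket, LinearMap.sub_apply,
      Module.End.mul_apply] at ha hb ⊢
    simp only [deriv_mul, ha, hb, map_add]
    noncomm_ring
  | add a b ha hb => simp only [map_add, ha, hb]

/-- The action of an endomorphism `f` of `V` on the `d`-th tensor power of `V`: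
`v₁ ⊗ v₂ ⊗ ⋯ ↦ ∑ k, ⋯ ⊗ f(v_k) ⊗ ⋯`. -/
def tensorDeriv (d : ℕ) (f : Module.End K V) : Module.End K (⨂[K]^d V) :=
  ∑ k : Fin d, PiTensorProduct.map (Function.update (fun _ => LinearMap.id) k f)

theorem tensorDeriv_tprod (d : ℕ) (f : Module.End K V) (v : Fin d → V) :
    tensorDeriv d f (PiTensorProduct.tprod K v) =
      ∑ k : Fin d, PiTensorProduct.tprod K (Function.update v k (f (v k))) := by
  simp only [tensorDeriv, LinearMap.sum_apply, PiTensorProduct.map_tprod]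
  refine Finset.sum_congr rfl fun k _ => congrArg _ (funext fun l => ?_)
  by_cases h : l = k
  · subst h; simp
  · simp [h]

theorem tensorDeriv_add (d : ℕ) (f g : Module.End K V) :
    tensorDeriv d (f + g) = tensorDeriv d f + tensorDeriv d g := by
  refine PiTensorProduct.ext (MultilinearMap.ext fun v => ?_)
  simp [tensorDeriv_tprod, Finset.sum_add_distrib]

theorem tensorDeriv_smul (d : ℕ) (r : K) (f : Module.End K V) :
    tensorDeriv d (r • f) = r • tensorDeriv d f := by
  refine PiTensorProduct.ext (MultilinearMap.ext fun v => ?_)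
  simp [tensorDeriv_tprod, Finset.smul_sum]

theorem tensorDeriv_lie (d : ℕ) (f g : Module.End K V) :
    tensorDeriv d ⁅f, g⁆ = ⁅tensorDeriv d f, tensorDeriv d g⁆ := by
  refine PiTensorProduct.ext (MultilinearMap.ext fun v => ?_)
  have key : ∀ f g : Module.End K V,
      tensorDeriv d f (tensorDeriv d g (PiTensorProduct.tprod K v)) =
        ∑ k, (PiTensorProduct.tprod K (Function.update v k (f (g (v k)))) +
          ∑ l ∈ Finset.univ.erase k,
            PiTensorProduct.tprod K (Function.update (Function.update v k (g (v k))) l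
              (f (v l)))) := by
    intro f g
    simp only [tensorDeriv_tprod, map_sum]
    refine Finset.sum_congr rfl fun k _ => ?_
    rw [← Finset.add_sum_erase _ _ (Finset.mem_univ k)]
    congr 1
    · simp
    · refine Finset.sum_congr rfl fun l hl => ?_
      rw [Function.update_of_ne (Finset.ne_of_mem_erase hl)]
  have swap : ∀ f g : Module.End K V,
      ∑ k, ∑ l ∈ Finset.univ.erase k, PiTensorProduct.tprod K
        (Function.update (Function.update v k (g (v k))) l (f (v l))) =
      ∑ k, ∑ l ∈ Finset.univ.erase k, PiTensorProduct.tprod K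
        (Function.update (Function.update v k (f (v k))) l (g (v l))) := by
    intro f g
    rw [Finset.sum_comm' (t' := Finset.univ) (s' := fun l => Finset.univ.erase l)]
    · refine Finset.sum_congr rfl fun l _ => Finset.sum_congr rfl fun k hk => ?_
      rw [Function.update_comm (Finset.ne_of_mem_erase hk)]
    · intro x y
      simp [eq_comm]
  simp only [LinearMap.compMultilinearMap_apply, LieRing.of_associative_ring_bracket,
    LinearMap.sub_apply, Module.End.mul_apply, key, Finset.sum_add_distrib, swap f g,
    add_sub_add_right_eq_sub]
  simp [tensorDeriv_tprod, Finset.sum_sub_distrib]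

variable {L : Type*} [LieRing L] [LieAlgebra K L] [LieRingModule L V] [LieModule K L V]

/-- A Lie algebra acts on the exterior algebra of a module by derivations. -/
instance extLieRingModule : LieRingModule L (ExteriorAlgebra K V) where
  bracket x m := deriv (LieModule.toEnd K L V x) m
  add_lie x y m := by simp [deriv_add]
  lie_add x m m' := by simp
  leibniz_lie x y m := by
    simp only [LieHom.map_lie, deriv_lie]
    simp [LieRing.of_associative_ring_bracket]

instance extLieModule : LieModule K L (ExteriorAlgebra K V) where
  smul_lie r x m := by
    change deriv (LieModule.toEnd K L V (r • x)) m = r • deriv (LieModule.toEnd K L V x) m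
    simp [deriv_smul]
  lie_smul r x m := by
    change deriv (LieModule.toEnd K L V x) (r • m) = r • deriv (LieModule.toEnd K L V x) m
    simp

theorem ext_lie_def (x : L) (m : ExteriorAlgebra K V) :
    ⁅x, m⁆ = deriv (LieModule.toEnd K L V x) m := rfl

/-- A Lie algebra acts on the tensor powers of a module. -/
instance tensorLieRingModule (d : ℕ) : LieRingModule L (⨂[K]^d V) where
  bracket x m := tensorDeriv d (LieModule.toEnd K L V x) m
  add_lie x y m := by simp [tensorDeriv_add]
  lie_add x m m' := by simp
  leibniz_lie x y m := by
    simp only [LieHom.map_lie, tensorDeriv_lie]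
    simp [LieRing.of_associative_ring_bracket]

instance tensorLieModule (d : ℕ) : LieModule K L (⨂[K]^d V) where
  smul_lie r x m := by
    change tensorDeriv d (LieModule.toEnd K L V (r • x)) m =
      r • tensorDeriv d (LieModule.toEnd K L V x) m
    simp [tensorDeriv_smul]
  lie_smul r x m := by
    change tensorDeriv d (LieModule.toEnd K L V x) (r • m) =
      r • tensorDeriv d (LieModule.toEnd K L V x) m
    simp

theorem tensor_lie_def {d : ℕ} (x : L) (m : ⨂[K]^d V) :
    ⁅x, m⁆ = tensorDeriv d (LieModule.toEnd K L V x) m := rfl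

/-- The permutation of the tensor factors by `σ`. -/
def permute {d : ℕ} (σ : Equiv.Perm (Fin d)) : (⨂[K]^d V) →ₗ[K] (⨂[K]^d V) :=
  (PiTensorProduct.reindex K (fun _ : Fin d => V) σ).toLinearMap

theorem permute_tprod {d : ℕ} (σ : Equiv.Perm (Fin d)) (v : Fin d → V) :
    permute σ (PiTensorProduct.tprod K v) = PiTensorProduct.tprod K fun k => v (σ.symm k) :=
  PiTensorProduct.reindex_tprod σ v

theorem permute_tensorDeriv {d : ℕ} (σ : Equiv.Perm (Fin d)) (f : Module.End K V)
    (t : ⨂[K]^d V) : permute σ (tensorDeriv d f t) = tensorDeriv d f (permute σ t) := by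
  suffices h : permute σ ∘ₗ tensorDeriv d f = tensorDeriv d f ∘ₗ permute σ from
    LinearMap.congr_fun h t
  refine PiTensorProduct.ext (MultilinearMap.ext fun v => ?_)
  simp only [LinearMap.compMultilinearMap_apply, LinearMap.comp_apply, permute_tprod,
    tensorDeriv_tprod, map_sum]
  refine Fintype.sum_equiv σ _ _ fun k => congrArg _ (funext fun l => ?_)
  by_cases h : l = σ k
  · subst h; simp
  · have h' : σ.symm l ≠ k := fun e => h (by simp [← e])
    simp [h, h']

variable (K L V)

/-- The symmetric power `S^d V`, as the submodule of symmetric tensors of `V ⊗ ⋯ ⊗ V`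
(over a field of characteristic zero). -/
def symPow (d : ℕ) : LieSubmodule K L (⨂[K]^d V) where
  carrier := {t | ∀ σ : Equiv.Perm (Fin d), permute σ t = t}
  add_mem' := by
    intro a b ha hb σ
    rw [map_add, ha σ, hb σ]
  zero_mem' := fun σ => map_zero _
  smul_mem' := by
    intro r a ha σ
    rw [map_smul, ha σ]
  lie_mem := by
    intro x m hm σ
    rw [tensor_lie_def, permute_tensorDeriv, hm σ]

/-- The exterior power `⋀^d V`, as the submodule of antisymmetric tensors of `V ⊗ ⋯ ⊗ V`
(over a field of characteristic zero). -/
def altPow (d : ℕ) : LieSubmodule K L (⨂[K]^d V) where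
  carrier := {t | ∀ σ : Equiv.Perm (Fin d), permute σ t = ((Equiv.Perm.sign σ : ℤ) : K) • t}
  add_mem' := by
    intro a b ha hb σ
    rw [map_add, ha σ, hb σ, smul_add]
  zero_mem' := fun σ => by simp
  smul_mem' := by
    intro r a ha σ
    rw [map_smul, ha σ, smul_comm]
  lie_mem := by
    intro x m hm σ
    rw [tensor_lie_def, permute_tensorDeriv, hm σ, map_smul]

variable {V}

/-- The product `v₁ ⋯ v_d` in `S^d V`: the tensor `∑ σ, v_{σ(1)} ⊗ ⋯ ⊗ v_{σ(d)}`. -/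
def symProd {d : ℕ} (v : Fin d → V) : symPow K V L d :=
  ⟨∑ σ : Equiv.Perm (Fin d), PiTensorProduct.tprod K fun k => v (σ k), by
    intro τ
    simp only [map_sum, permute_tprod]
    exact Fintype.sum_equiv (Equiv.mulRight τ⁻¹) _ _ fun σ => rfl⟩

/-- The product `v₁ ∧ ⋯ ∧ v_d` in `⋀^d V`: the tensor
`∑ σ, sgn(σ) v_{σ(1)} ⊗ ⋯ ⊗ v_{σ(d)}`. -/
def altProd {d : ℕ} (v : Fin d → V) : altPow K V L d :=
  ⟨∑ σ : Equiv.Perm (Fin d),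
      ((Equiv.Perm.sign σ : ℤ) : K) • PiTensorProduct.tprod K fun k => v (σ k), by
    intro τ
    simp only [map_sum, map_smul, permute_tprod, Finset.smul_sum]
    refine Fintype.sum_equiv (Equiv.mulRight τ⁻¹) _ _ fun σ => ?_
    rw [smul_smul]
    congr 1
    rcases Int.units_eq_one_or (Equiv.Perm.sign τ) with h | h <;>
      simp [Equiv.coe_mulRight, map_mul, Equiv.Perm.sign_inv, h]⟩

end Derivation

/-! ### The Lie algebra `𝔟` and its modules `K^i`, `U`, `T` -/

section Modules

variable (K : Type*) [Field K] (n : ℕ)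

/-- The Lie algebra `𝔟` of upper triangular `n × n` matrices. -/
def borel : LieSubalgebra K (Matrix (Fin n) (Fin n) K) where
  carrier := {A | A.BlockTriangular id}
  add_mem' := fun ha hb => ha.add hb
  zero_mem' := Matrix.blockTriangular_zero
  smul_mem' := by
    intro r A hA i j hij
    simp [hA hij]
  lie_mem' := fun ha hb => (ha.mul hb).sub (hb.mul ha)

/-- The matrix unit `e_{pq}` for `p ≤ q < n`; for all other `p, q` this is zero. -/
def matUnit (p q : ℕ) : borel K n :=
  ⟨Matrix.of fun a b => if (a : ℕ) = p ∧ (b : ℕ) = q ∧ p ≤ q then 1 else 0, by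
    intro a b hab
    have h : ¬ ((a : ℕ) = p ∧ (b : ℕ) = q ∧ p ≤ q) := by
      rintro ⟨rfl, rfl, h⟩
      exact absurd hab (not_lt.mpr h)
    simp only [Matrix.of_apply, h, if_false]⟩

/-- The action of `𝔟` on column vectors is the one of matrices, `e_{pq} u_j = δ_{qj} u_p`. -/
theorem col_lie_def (x : borel K n) (v : Fin n → K) : ⁅x, v⁆ = x.1.mulVec v := rfl

/-- The module `K^i = K u_1 ⊕ ⋯ ⊕ K u_i` (for `i ≤ n`). -/
def colMod (i : ℕ) : LieSubmodule K (borel K n) (Fin n → K) where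
  carrier := {v | ∀ k : Fin n, i ≤ k → v k = 0}
  add_mem' := by
    intro a b ha hb k hk
    simp [ha k hk, hb k hk]
  zero_mem' := fun k _ => rfl
  smul_mem' := by
    intro r a ha k hk
    simp [ha k hk]
  lie_mem := by
    intro x v hv k hk
    change ∑ l, x.1 k l * v l = 0
    refine Finset.sum_eq_zero fun l _ => ?_
    by_cases h : l < k
    · rw [x.2 h, zero_mul]
    · rw [hv l (hk.trans (Fin.le_def.mp (not_lt.mp h))), mul_zero]

/-- The basis vector `u_p` of `K^i` for `p < i`. -/
def colVec (i p : ℕ) : colMod K n i :=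
  ⟨fun k => if (k : ℕ) = p ∧ p < i then 1 else 0, by
    intro k hk
    have h : ¬ ((k : ℕ) = p ∧ p < i) := by
      rintro ⟨rfl, h⟩
      exact absurd h (not_lt.mpr hk)
    simp only [h, if_false]⟩

/-- The vector space `U` with basis `u_{ij}`, `i < n`, `j ∈ ℕ`. -/
abbrev U : Type _ := (Fin n × ℕ) →₀ K

variable {n} in
/-- The basis vector `u_{ij}` of `U`. -/
def uBasis (i : Fin n) (j : ℕ) : U K n := Finsupp.single (i, j) 1

/-- The endomorphism of `U` given by a matrix: `A u_{ij} = ∑ p, A_{pi} u_{pj}`, so that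
`e_{pq} u_{ij} = δ_{iq} u_{pj}`. -/
def rowAct (A : Matrix (Fin n) (Fin n) K) : Module.End K (U K n) :=
  Finsupp.linearCombination K fun x : Fin n × ℕ => ∑ p, A p x.1 • uBasis K p x.2

theorem rowAct_uBasis (A : Matrix (Fin n) (Fin n) K) (i : Fin n) (j : ℕ) :
    rowAct K n A (uBasis K i j) = ∑ p, A p i • uBasis K p j := by
  simp [rowAct, uBasis]

theorem rowAct_add (A B : Matrix (Fin n) (Fin n) K) :
    rowAct K n (A + B) = rowAct K n A + rowAct K n B := by
  refine Finsupp.lhom_ext' fun x => LinearMap.ext_ring ?_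
  change rowAct K n (A + B) (uBasis K x.1 x.2) =
    rowAct K n A (uBasis K x.1 x.2) + rowAct K n B (uBasis K x.1 x.2)
  simp [rowAct_uBasis, add_smul, Finset.sum_add_distrib]

theorem rowAct_smul (r : K) (A : Matrix (Fin n) (Fin n) K) :
    rowAct K n (r • A) = r • rowAct K n A := by
  refine Finsupp.lhom_ext' fun x => LinearMap.ext_ring ?_
  change rowAct K n (r • A) (uBasis K x.1 x.2) = r • rowAct K n A (uBasis K x.1 x.2)
  simp [rowAct_uBasis, mul_smul, Finset.smul_sum]

theorem rowAct_mul (A B : Matrix (Fin n) (Fin n) K) :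
    rowAct K n (A * B) = rowAct K n A * rowAct K n B := by
  refine Finsupp.lhom_ext' fun x => LinearMap.ext_ring ?_
  change rowAct K n (A * B) (uBasis K x.1 x.2) =
    rowAct K n A (rowAct K n B (uBasis K x.1 x.2))
  simp only [rowAct_uBasis, map_sum, map_smul, Matrix.mul_apply, Finset.sum_smul,
    Finset.smul_sum, smul_smul]
  rw [Finset.sum_comm]
  exact Finset.sum_congr rfl fun k _ => Finset.sum_congr rfl fun p _ => by rw [mul_comm]

theorem rowAct_sub (A B : Matrix (Fin n) (Fin n) K) :
    rowAct K n (A - B) = rowAct K n A - rowAct K n B := by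
  refine Finsupp.lhom_ext' fun x => LinearMap.ext_ring ?_
  change rowAct K n (A - B) (uBasis K x.1 x.2) =
    rowAct K n A (uBasis K x.1 x.2) - rowAct K n B (uBasis K x.1 x.2)
  simp [rowAct_uBasis, sub_smul, Finset.sum_sub_distrib]

instance uLieRingModule : LieRingModule (borel K n) (U K n) where
  bracket x v := rowAct K n x.1 v
  add_lie x y v := by simp [rowAct_add]
  lie_add x v v' := by simp
  leibniz_lie x y v := by
    simp [LieRing.of_associative_ring_bracket, rowAct_sub, rowAct_mul]

instance uLieModule : LieModule K (borel K n) (U K n) where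
  smul_lie r x v := by
    change rowAct K n (r • x.1) v = r • rowAct K n x.1 v
    simp [rowAct_smul]
  lie_smul r x v := by
    change rowAct K n x.1 (r • v) = r • rowAct K n x.1 v
    simp

/-- The exterior algebra `T` of `U`, a `𝔟`-module. -/
abbrev T : Type _ := ExteriorAlgebra K (U K n)

/-! ### Kraśkiewicz–Pragacz modules -/

/-- The inversions `(i, j)` of `w` with `i` one of the first `n` positions; these are all the
inversions when `w` is increasing from position `n` on. -/
def invSet (w : Equiv.Perm ℕ) : Set (Fin n ×ₗ ℕ) :=
  {x | ((ofLex x).1 : ℕ) < (ofLex x).2 ∧ w (ofLex x).2 < w (ofLex x).1}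

theorem invSet_finite (w : Equiv.Perm ℕ) : (invSet n w).Finite := by
  have h : (⋃ i : Fin n, (fun j : ℕ => toLex (i, w.symm j)) '' Set.Iio (w i)).Finite :=
    Set.finite_iUnion fun i => (Set.finite_Iio _).image _
  refine h.subset fun x hx => Set.mem_iUnion.mpr ⟨(ofLex x).1, w (ofLex x).2, hx.2, ?_⟩
  simp

/-- The vector `u_w = ⋀_{(i,j) ∈ I(w)} u_{ij}`, the product being taken in the lexicographic
order of the inversions (another order changes it by a sign). -/
def uVec (w : Equiv.Perm ℕ) : T K n :=
  (((invSet_finite n w).toFinset.sort (· ≤ ·)).map fun x =>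
    ExteriorAlgebra.ι K (uBasis K (ofLex x).1 (ofLex x).2)).prod

/-- The Kraśkiewicz–Pragacz module `𝒮_w`: the `𝔟`-submodule of `T` generated by `u_w`. -/
def kpMod (w : Equiv.Perm ℕ) : LieSubmodule K (borel K n) (T K n) :=
  LieSubmodule.lieSpan K (borel K n) {uVec K n w}

/-- The generator `u_w` of `𝒮_w`. -/
def kpGen (w : Equiv.Perm ℕ) : kpMod K n w :=
  ⟨uVec K n w, LieSubmodule.subset_lieSpan rfl⟩

variable {K n} in
/-- The quotient `N / N'` of two submodules of a `𝔟`-module (meant for `N' ⊆ N`). -/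
abbrev Subquot {M : Type*} [AddCommGroup M] [Module K M] [LieRingModule (borel K n) M]
    [LieModule K (borel K n) M] (N' N : LieSubmodule K (borel K n) M) : Type _ :=
  N ⧸ (N'.comap N.incl)

variable {K n} in
/-- The map `N / N' → S ⊆ T` induced by `φ : M → T` is well defined and is an isomorphism of
`𝔟`-modules. -/
def InducesIso {M : Type*} [AddCommGroup M] [Module K M] [LieRingModule (borel K n) M]
    [LieModule K (borel K n) M] (φ : M →ₗ[K] T K n) (N' N : LieSubmodule K (borel K n) M)
    (S : LieSubmodule K (borel K n) (T K n)) : Prop :=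
  ∃ e : Subquot N' N ≃ₗ⁅K, borel K n⁆ S,
    ∀ x : N, (e (LieSubmodule.Quotient.mk (N := N'.comap N.incl) x) : T K n) = φ x

/-- A KP filtration `0 = M_0 ⊆ ⋯ ⊆ M_r = M` of a `𝔟`-module `M`: each `M_j / M_{j-1}` is
isomorphic to some KP module. -/
def IsKPFiltration {M : Type*} [AddCommGroup M] [Module K M] [LieRingModule (borel K n) M]
    [LieModule K (borel K n) M] {r : ℕ}
    (F : Fin (r + 1) → LieSubmodule K (borel K n) M) : Prop :=
  F 0 = ⊥ ∧ F (Fin.last r) = ⊤ ∧ Monotone F ∧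
    ∀ j : Fin r, ∃ z ∈ permSet n,
      Nonempty (Subquot (F j.castSucc) (F j.succ) ≃ₗ⁅K, borel K n⁆ kpMod K n z)

/-! ### The operators `e'_{qp}`, `μ_j` and the maps `φ_ζ` -/

/-- The operator `e'_{qp}` on `T`: the derivation with `u_{ab} ↦ δ_{pb} u_{aq}`. -/
def colOp (q p : ℕ) : Module.End K (T K n) :=
  deriv (Finsupp.linearCombination K fun x : Fin n × ℕ =>
    if x.2 = p then uBasis K x.1 q else 0)

/-- The map `ι_j : K^i → U`, `u_p ↦ u_{pj}`. -/
def iotaMap (i j : ℕ) : colMod K n i →ₗ[K] U K n :=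
  Fintype.linearCombination K (fun p : Fin n => uBasis K p j) ∘ₗ
    (colMod K n i).toSubmodule.subtype

/-- The isomorphism `v₁ ⊗ v₂ ⊗ ⋯ ↦ v₁ ⊗ (v₂ ⊗ ⋯)`; see `headTail_tprod`. -/
def headTail (V : Type*) [AddCommGroup V] [Module K V] (a : ℕ) :
    (⨂[K]^(a + 1) V) →ₗ[K] V ⊗[K] (⨂[K]^a V) :=
  PiTensorProduct.lift (LinearMap.uncurryLeft
    { toFun := fun v => (TensorProduct.mk K V (⨂[K]^a V) v).compMultilinearMap
        (PiTensorProduct.tprod K)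
      map_add' := by
        intro v v'
        ext m
        simp
      map_smul' := by
        intro r v
        ext m
        simp [TensorProduct.smul_tmul'] })

theorem headTail_tprod (V : Type*) [AddCommGroup V] [Module K V] (a : ℕ) (v : Fin (a + 1) → V) :
    headTail K V a (PiTensorProduct.tprod K v) =
      v 0 ⊗ₜ[K] PiTensorProduct.tprod K (fun k : Fin a => v k.succ) := by
  simp [headTail, Fin.tail_def]

/-- The map `U ⊗ T → T`, `x ⊗ t ↦ x ∧ t`. -/
def wedgeLeft : U K n ⊗[K] T K n →ₗ[K] T K n :=
  TensorProduct.lift ((LinearMap.mul K (T K n)) ∘ₗ ExteriorAlgebra.ι K)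

/-- The operator `μ_j`: `t ⊗ (v₁ ⊗ v₂ ⊗ ⋯) ↦ (ι_j(v₁) ∧ t) ⊗ (v₂ ⊗ ⋯)`; see `mu_tmul`. -/
def mu (i j a : ℕ) :
    T K n ⊗[K] (⨂[K]^(a + 1) (colMod K n i)) →ₗ[K] T K n ⊗[K] (⨂[K]^a (colMod K n i)) :=
  TensorProduct.map (wedgeLeft K n ∘ₗ TensorProduct.map (iotaMap K n i j) LinearMap.id ∘ₗ
      (TensorProduct.comm K (T K n) (colMod K n i)).toLinearMap) LinearMap.id ∘ₗ
    (TensorProduct.assoc K (T K n) (colMod K n i) (⨂[K]^a (colMod K n i))).symm.toLinearMap ∘ₗ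
    TensorProduct.map LinearMap.id (headTail K (colMod K n i) a)

theorem mu_tmul (i j a : ℕ) (t : T K n) (v : Fin (a + 1) → colMod K n i) :
    mu K n i j a (t ⊗ₜ[K] PiTensorProduct.tprod K v) =
      (ExteriorAlgebra.ι K (iotaMap K n i j (v 0)) * t) ⊗ₜ[K]
        PiTensorProduct.tprod K (fun k : Fin a => v k.succ) := by
  simp [mu, headTail_tprod, wedgeLeft]

/-- The composition `μ_{q_d} ⋯ μ_{q_1}`, followed by the identification `T ⊗ K = T`. -/
def muComp (i : ℕ) : (d : ℕ) → (Fin d → ℕ) → (T K n ⊗[K] (⨂[K]^d (colMod K n i)) →ₗ[K] T K n)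
  | 0, _ => (TensorProduct.rid K (T K n)).toLinearMap ∘ₗ
      TensorProduct.map LinearMap.id (PiTensorProduct.isEmptyEquiv (Fin 0)).toLinearMap
  | d + 1, q => muComp i d (fun k => q k.succ) ∘ₗ mu K n i (q 0) d

/-- The product over `j` of the operators `(e'_{q_j p_j})^{m'_{q_j p_j}(w_j)}` on `T`. -/
def colOpProd (w : Equiv.Perm ℕ) {d : ℕ} (c : Fin d → ℕ × ℕ) : Module.End K (T K n) :=
  (List.ofFn fun j : Fin d =>
    colOp K n (c j).2 (c j).1 ^ mLeft (chainPerm w c j) (c j).2 (c j).1).prod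

/-- The map `φ_ζ : T ⊗ (K^i ⊗ ⋯ ⊗ K^i) → T`, for `ζ` given by its decomposition `c`. -/
def phi (w : Equiv.Perm ℕ) (i : ℕ) {d : ℕ} (c : Fin d → ℕ × ℕ) :
    T K n ⊗[K] (⨂[K]^d (colMod K n i)) →ₗ[K] T K n :=
  muComp K n i d (fun j => (c j).2) ∘ₗ TensorProduct.map (colOpProd K n w c) LinearMap.id

/-! ### The two tensor product modules and the vectors `v_ζ` -/

/-- The vector `(∏ j, e_{p_j q_j}^{m_{p_j q_j}(w_j)}) u_w` of `𝒮_w`. -/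
def rowOpVec (w : Equiv.Perm ℕ) {d : ℕ} (c : Fin d → ℕ × ℕ) : kpMod K n w :=
  (List.ofFn fun j : Fin d =>
    LieModule.toEnd K (borel K n) (kpMod K n w) (matUnit K n (c j).1 (c j).2) ^
      mRight (chainPerm w c j) (c j).1 (c j).2).prod (kpGen K n w)

/-- The `𝔟`-module `𝒮_w ⊗ S^d(K^i)`. -/
abbrev SymMod (w : Equiv.Perm ℕ) (i d : ℕ) : Type _ :=
  kpMod K n w ⊗[K] symPow K (colMod K n i) (borel K n) d

/-- The `𝔟`-module `𝒮_w ⊗ ⋀^d(K^i)`. -/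
abbrev AltMod (w : Equiv.Perm ℕ) (i d : ℕ) : Type _ :=
  kpMod K n w ⊗[K] altPow K (colMod K n i) (borel K n) d

/-- The vector `v_ζ` of `𝒮_w ⊗ S^d(K^i)`, for `ζ` given by its decomposition `c`. -/
def symVec (w : Equiv.Perm ℕ) (i : ℕ) {d : ℕ} (c : Fin d → ℕ × ℕ) : SymMod K n w i d :=
  rowOpVec K n w c ⊗ₜ[K] symProd K (borel K n) fun j => colVec K n i (c j).1

/-- The vector `v_ζ` of `𝒮_w ⊗ ⋀^d(K^i)`, for `ζ` given by its decomposition `c`. -/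
def altVec (w : Equiv.Perm ℕ) (i : ℕ) {d : ℕ} (c : Fin d → ℕ × ℕ) : AltMod K n w i d :=
  rowOpVec K n w c ⊗ₜ[K] altProd K (borel K n) fun j => colVec K n i (c j).1

/-- The restriction of `φ_ζ` to `𝒮_w ⊗ S^d(K^i)`. -/
def symPhi (w : Equiv.Perm ℕ) (i : ℕ) {d : ℕ} (c : Fin d → ℕ × ℕ) :
    SymMod K n w i d →ₗ[K] T K n :=
  phi K n w i c ∘ₗ TensorProduct.map (kpMod K n w).toSubmodule.subtype
    (symPow K (colMod K n i) (borel K n) d).toSubmodule.subtype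

/-- The restriction of `φ_ζ` to `𝒮_w ⊗ ⋀^d(K^i)`. -/
def altPhi (w : Equiv.Perm ℕ) (i : ℕ) {d : ℕ} (c : Fin d → ℕ × ℕ) :
    AltMod K n w i d →ₗ[K] T K n :=
  phi K n w i c ∘ₗ TensorProduct.map (kpMod K n w).toSubmodule.subtype
    (altPow K (colMod K n i) (borel K n) d).toSubmodule.subtype

variable {K n} in
/-- The chain of submodules `0 ⊆ ⟨v_1⟩ ⊆ ⟨v_1, v_2⟩ ⊆ ⋯ ⊆ ⟨v_1, …, v_r⟩`. -/
def spanChain {M : Type*} [AddCommGroup M] [Module K M] [LieRingModule (borel K n) M]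
    [LieModule K (borel K n) M] {r : ℕ} (v : Fin r → M) (j : Fin (r + 1)) :
    LieSubmodule K (borel K n) M :=
  LieSubmodule.lieSpan K (borel K n) (v '' {k | (k : ℕ) < j})

end Modules

end KP

end

/-! The theorem is a triangularity combined with an equality of dimensions. Every `φ_ζ` is
`𝔟`-linear: the operators `e'` permute columns while `𝔟` acts on rows, and the maps `μ_q` are
equivariant. On the generators, `φ_{ζ_j}(v_{ζ_j})` is a nonzero multiple of `u_{wζ_j}`, and
`φ_{ζ_j}(v_{ζ_k}) = 0` for `k < j` (`symValue_eq`, `altValue_eq`). So the `j`-th quotient of the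
chain surjects onto `𝒮_{wζ_j}`, and `dim M ≥ ∑ dim 𝒮_{wζ_j}`. If the opposite inequality holds too,
the chain exhausts `M` and every one of these surjections is an isomorphism (`chain_dimension`).

The triangularity is a computation with monomials. Up to sign, `u_w` is the product of the boxes of
the inversion diagram of `w`. The exponents `m` and `m'` are the numbers of boxes that `e_{pq}` and
`e'_{qp}` can move, so these powers move all of them at once, with a factorial as coefficient
(`IsMove.deriv_pow`). Adding the box `(p, q)` gives the diagram of `w t_{pq}` for a cover, and
adding a box that is already present gives zero. All operators with `p < i ≤ q` commute, so a chain
can be peeled off one transposition at a time.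

For the dimensions, `dim M ≤ C(i+d-1, d) dim 𝒮_w` (resp. `C(i, d) dim 𝒮_w`), so what is missing is a
Pieri rule for `dim 𝒮_w`. It is obtained from the numbers `mac`, which satisfy `ℓ(w) mac(w) = ∑
(k+1) mac(s_k w)` over the left descents `k` of `w`. This is Macdonald's formula for the value of a
Schubert polynomial at `1`; Schubert polynomials themselves are not used.

Pieri rule for `mac` (`sum_mac_upSet`, `sum_mac_downSet`): chains are counted by a product of
factors `1 + X B_a`, one for each label `a`. The commutator of this product with the weighted
descent sum telescopes to an explicit correction term (`upGens_descSum`, `downGens_descSum`).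
Comparing coefficients of `X^{d+1}` gives a recursion which binomial coefficients solve, by
induction on `ℓ(w) + d`.

Equality `dim 𝒮_w = mac(w)` (`finrank_kpMod_eq_mac`): let `r` be the last descent of `w` and `v = w
t_{rs}` as in Lascoux and Schützenberger's transition. Contraction with `u_{rs}` shows `dim 𝒮_w ≥
dim 𝒮_v + ∑_p dim 𝒮_{v t_{pr}}` (`LastDescent.finrank_le`), while `mac` satisfies the same relation
with equality (`LastDescent.mac_eq`). Hence `mac ≤ dim`. Conversely the lower bound `dim M ≥ ∑ dim
𝒮_{vζ}` in the exterior case with `d = 1` bounds a sum of dimensions by the corresponding sum of the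
numbers `mac`, so all the inequalities `mac ≤ dim` occurring in it are equalities. -/

noncomputable section
namespace KP

/-! ### Bruhat covers and finitely supported permutations -/

section Covers

theorem perm_apply_inv {α : Type*} (w : Equiv.Perm α) (a : α) : w (w⁻¹ a) = a :=
  Equiv.apply_symm_apply w a

theorem perm_inv_apply {α : Type*} (w : Equiv.Perm α) (a : α) : w⁻¹ (w a) = a :=
  Equiv.symm_apply_apply w a

/-- `w t_{pq}` covers `w` in the Bruhat order, in terms of the one-line notation of `w`. -/
def Cov {α : Type*} [LinearOrder α] (w : Equiv.Perm α) (p q : α) : Prop :=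
  p < q ∧ w p < w q ∧ ∀ r, p < r → r < q → w p < w r → ¬ w r < w q

/-- The permutations fixing every `k ≥ N`. -/
def Small (N : ℕ) (w : Equiv.Perm ℕ) : Prop := ∀ k, N ≤ k → w k = k

theorem Small.lt {N : ℕ} {w : Equiv.Perm ℕ} (h : Small N w) {a : ℕ} (ha : a < N) : w a < N := by
  by_contra hc
  have := h (w a) (not_lt.mp hc)
  have := w.injective this
  omega

theorem Small.inv {N : ℕ} {w : Equiv.Perm ℕ} (h : Small N w) : Small N w⁻¹ := by
  intro k hk
  rw [Equiv.Perm.inv_eq_iff_eq, h k hk]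

theorem Small.mono {N M : ℕ} {w : Equiv.Perm ℕ} (h : Small N w) (hNM : N ≤ M) : Small M w :=
  fun k hk => h k (hNM.trans hk)

theorem Small.mul {N : ℕ} {w v : Equiv.Perm ℕ} (hw : Small N w) (hv : Small N v) :
    Small N (w * v) := fun k hk => by
  rw [Equiv.Perm.mul_apply, hv k hk, hw k hk]

theorem small_swap {N p q : ℕ} (hp : p < N) (hq : q < N) : Small N (Equiv.swap p q) := fun k hk =>
  Equiv.swap_apply_of_ne_of_ne (by omega) (by omega)

theorem exists_small {w : Equiv.Perm ℕ} (h : {k | w k ≠ k}.Finite) : ∃ N, Small N w := by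
  obtain ⟨N, hN⟩ := h.bddAbove
  refine ⟨N + 1, fun k hk => ?_⟩
  by_contra hc
  have := hN hc
  omega

theorem Small.finite {N : ℕ} {w : Equiv.Perm ℕ} (h : Small N w) : {k | w k ≠ k}.Finite :=
  (Set.finite_Iio N).subset fun k hk => by
    by_contra hc
    exact hk (h k (not_lt.mp hc))

/-- The set of inversions of a permutation. -/
def inversions (w : Equiv.Perm ℕ) : Set (ℕ × ℕ) := {x | x.1 < x.2 ∧ w x.2 < w x.1}

theorem Small.inversions_finite {N : ℕ} {w : Equiv.Perm ℕ} (h : Small N w) :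
    (inversions w).Finite := by
  refine ((Set.finite_Iio N).prod (Set.finite_Iio N)).subset ?_
  rintro ⟨a, b⟩ ⟨h1, h2⟩
  simp only [Set.mem_prod, Set.mem_Iio] at h1 h2 ⊢
  by_cases hb : b < N
  · exact ⟨by omega, hb⟩
  · rw [h b (by omega)] at h2
    by_cases ha : a < N
    · have := h.lt ha
      omega
    · rw [h a (by omega)] at h2
      omega

/-- An injection from the inversions of `w` into the inversions of `w t_{pq}`. -/
def invMap (p q : ℕ) (x : ℕ × ℕ) : ℕ × ℕ :=
  if Equiv.swap p q x.1 < Equiv.swap p q x.2 then (Equiv.swap p q x.1, Equiv.swap p q x.2) else x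

/-- Exchanging `p` and `q` reverses the order of two positions only if one of them is `p` or `q` and
the other lies in the closed interval between them; `(p, q)` itself is not an inversion of `w`. -/
theorem invMap_cases {w : Equiv.Perm ℕ} {p q : ℕ} (hpq : p < q) (hw : w p < w q) {x : ℕ × ℕ}
    (hx : x ∈ inversions w) :
    (Equiv.swap p q x.1 < Equiv.swap p q x.2 ∧
      invMap p q x = (Equiv.swap p q x.1, Equiv.swap p q x.2)) ∨
    (invMap p q x = x ∧ ¬ Equiv.swap p q x.1 < Equiv.swap p q x.2 ∧
      ((x.1 = p ∧ x.2 < q ∧ w x.2 < w p) ∨ (x.2 = q ∧ p < x.1 ∧ w q < w x.1))) := by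
  obtain ⟨a, b⟩ := x
  obtain ⟨h1, h2⟩ := hx
  simp only at h1 h2
  by_cases h : Equiv.swap p q a < Equiv.swap p q b
  · left
    exact ⟨h, by simp [invMap, h]⟩
  · right
    refine ⟨by simp [invMap, h], h, ?_⟩
    simp only
    rw [Equiv.swap_apply_def, Equiv.swap_apply_def] at h
    by_cases ha : a = p
    · subst ha
      by_cases hb : b = q
      · subst hb; omega
      · left
        rw [if_pos rfl, if_neg (by omega), if_neg hb] at h
        exact ⟨rfl, by omega, h2⟩
    · rw [if_neg ha] at h
      by_cases haq : a = q
      · subst haq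
        rw [if_pos rfl, if_neg (by omega), if_neg (by omega)] at h
        omega
      · rw [if_neg haq] at h
        by_cases hb : b = p
        · subst hb
          rw [if_pos rfl] at h
          omega
        · rw [if_neg hb] at h
          by_cases hbq : b = q
          · subst hbq
            rw [if_pos rfl] at h
            right
            exact ⟨rfl, by omega, h2⟩
          · rw [if_neg hbq] at h
            omega

/-- The missed elements are what makes the length grow: `(p, q)` always, and in addition `(p, r)`
for every position `r` that prevents `t_{pq}` from being a cover. -/
theorem invMap_mem {w : Equiv.Perm ℕ} {p q : ℕ} (hpq : p < q) (hw : w p < w q) {x : ℕ × ℕ}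
    (hx : x ∈ inversions w) : invMap p q x ∈ inversions (w * Equiv.swap p q) ∧
      invMap p q x ≠ (p, q) ∧ ∀ r, p < r → r < q → w p < w r → w r < w q →
        invMap p q x ≠ (p, r) := by
  obtain ⟨a, b⟩ := x
  rcases invMap_cases hpq hw hx with ⟨h, e⟩ | ⟨e, h, h'⟩
  · rw [e]
    refine ⟨⟨h, by simpa using hx.2⟩, fun h' => ?_, fun r hr1 hr2 hr3 hr4 h' => ?_⟩
    · simp only [Prod.mk.injEq, Equiv.swap_apply_eq_iff, Equiv.swap_apply_left,
        Equiv.swap_apply_right] at h'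
      have := hx.1
      simp only at this
      omega
    · simp only [Prod.mk.injEq, Equiv.swap_apply_eq_iff, Equiv.swap_apply_left] at h'
      rw [Equiv.swap_apply_of_ne_of_ne (by omega) (by omega)] at h'
      have := hx.1
      simp only at this
      omega
  · rw [e]
    have h1 := hx.1
    have h2 := hx.2
    simp only at h1 h2 h'
    rcases h' with ⟨rfl, h3, h4⟩ | ⟨rfl, h3, h4⟩
    · refine ⟨⟨h1, ?_⟩, ?_, ?_⟩
      · simp only [Equiv.Perm.mul_apply, Equiv.swap_apply_left]
        rw [Equiv.swap_apply_of_ne_of_ne (by omega) (by omega)]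
        omega
      · intro hh
        simp only [Prod.mk.injEq] at hh
        omega
      · intro r hr1 hr2 hr3 hr4 hh
        simp only [Prod.mk.injEq] at hh
        rw [hh.2] at h4
        omega
    · refine ⟨⟨h1, ?_⟩, ?_, ?_⟩
      · simp only [Equiv.Perm.mul_apply, Equiv.swap_apply_right]
        rw [Equiv.swap_apply_of_ne_of_ne (by omega) (by omega)]
        omega
      · intro hh
        simp only [Prod.mk.injEq] at hh
        omega
      · intro r hr1 hr2 hr3 hr4 hh
        simp only [Prod.mk.injEq] at hh
        omega

theorem invMap_injOn {w : Equiv.Perm ℕ} {p q : ℕ} (hpq : p < q) (hw : w p < w q) :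
    Set.InjOn (invMap p q) (inversions w) := by
  have key : ∀ x ∈ inversions w, ∀ y ∈ inversions w, invMap p q x = y →
      Equiv.swap p q x.1 < Equiv.swap p q x.2 →
      ¬ Equiv.swap p q y.1 < Equiv.swap p q y.2 → False := by
    rintro ⟨a, b⟩ hx ⟨c, d⟩ hy hxy h h'
    rw [invMap, if_pos h] at hxy
    simp only [Prod.mk.injEq] at hxy
    apply h'
    simp only [← hxy.1, ← hxy.2, Equiv.swap_apply_self]
    exact hx.1
  intro x hx y hy hxy
  rcases invMap_cases hpq hw hx with ⟨h, e⟩ | ⟨e, h, -⟩ <;>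
  rcases invMap_cases hpq hw hy with ⟨h', e'⟩ | ⟨e', h', -⟩
  · rw [e, e'] at hxy
    simp only [Prod.mk.injEq, EmbeddingLike.apply_eq_iff_eq] at hxy
    exact Prod.ext hxy.1 hxy.2
  · exact (key x hx y hy (hxy.trans e') h h').elim
  · exact (key y hy x hx (hxy.symm.trans e) h' h).elim
  · rw [← e, ← e', hxy]

/-- For a pair whose order is reversed by `t_{pq}`, the cover condition at its other position forces
the pair to be an inversion of `w` already; any other pair is the image of its transpose. -/
theorem exists_invMap_eq {w : Equiv.Perm ℕ} {p q : ℕ} (h : Cov w p q) {y : ℕ × ℕ}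
    (hy : y ∈ inversions (w * Equiv.swap p q)) (hne : y ≠ (p, q)) :
    ∃ x ∈ inversions w, invMap p q x = y := by
  obtain ⟨hpq, hw, hc⟩ := h
  obtain ⟨a, b⟩ := y
  obtain ⟨h1, h2⟩ := hy
  simp only [Equiv.Perm.mul_apply] at h1 h2
  by_cases hs : Equiv.swap p q a < Equiv.swap p q b
  · exact ⟨(Equiv.swap p q a, Equiv.swap p q b), ⟨hs, h2⟩, by simp [invMap, h1]⟩
  · refine ⟨(a, b), ⟨h1, ?_⟩, by simp [invMap, hs]⟩
    simp only [Equiv.swap_apply_def] at hs h2 ⊢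
    have hab : ¬ (a = p ∧ b = q) := fun h => hne (by rw [h.1, h.2])
    by_cases ha : a = p
    · subst ha
      have hb : b ≠ q := fun h => hab ⟨rfl, h⟩
      rw [if_pos rfl, if_neg (by omega), if_neg hb] at hs
      rw [if_pos rfl, if_neg (by omega), if_neg hb] at h2
      rcases lt_trichotomy (w a) (w b) with h | h | h
      · exact (hc b h1 (by omega) h h2).elim
      · exact absurd (w.injective h) (by omega)
      · exact h
    · rw [if_neg ha] at hs h2
      by_cases haq : a = q
      · subst haq
        rw [if_pos rfl, if_neg (by omega), if_neg (by omega)] at hs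
        omega
      · rw [if_neg haq] at hs h2
        by_cases hb : b = p
        · subst hb
          rw [if_pos rfl] at hs
          omega
        · rw [if_neg hb] at hs h2
          by_cases hbq : b = q
          · subst hbq
            rw [if_pos rfl] at hs h2
            rcases lt_trichotomy (w a) (w b) with h | h | h
            · exact (hc a (by omega) h1 h2 h).elim
            · exact absurd (w.injective h) (by omega)
            · exact h
          · rw [if_neg hbq] at hs
            omega

theorem length_mul_swap_lower {N : ℕ} {w : Equiv.Perm ℕ} (hN : Small N w) {p q : ℕ} (hpq : p < q)
    (hw : w p < w q) : length w + 1 ≤ length (w * Equiv.swap p q) ∧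
      (¬ Cov w p q → length w + 2 ≤ length (w * Equiv.swap p q)) := by
  have hN' : Small (N + q + 1) (w * Equiv.swap p q) :=
    (hN.mono (by omega)).mul (small_swap (by omega) (by omega))
  have hfin := hN'.inversions_finite
  have himg : (invMap p q '' inversions w).ncard = length w :=
    (invMap_injOn hpq hw).ncard_image
  have hfinI : (invMap p q '' inversions w).Finite := hN.inversions_finite.image _
  have hpqmem : (p, q) ∈ inversions (w * Equiv.swap p q) := ⟨hpq, by simpa using hw⟩
  have hnot : (p, q) ∉ invMap p q '' inversions w := by
    rintro ⟨x, hx, e⟩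
    exact (invMap_mem hpq hw hx).2.1 e
  have hsub : insert (p, q) (invMap p q '' inversions w) ⊆ inversions (w * Equiv.swap p q) := by
    rw [Set.insert_subset_iff]
    refine ⟨hpqmem, ?_⟩
    rintro _ ⟨x, hx, rfl⟩
    exact (invMap_mem hpq hw hx).1
  have hcard : (insert (p, q) (invMap p q '' inversions w)).ncard = length w + 1 := by
    rw [Set.ncard_insert_of_notMem hnot hfinI, himg]
  refine ⟨hcard ▸ Set.ncard_le_ncard hsub hfin, fun hcov => ?_⟩
  have : ∃ r, p < r ∧ r < q ∧ w p < w r ∧ w r < w q := by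
    by_contra hcon
    push Not at hcon
    exact hcov ⟨hpq, hw, fun r h1 h2 h3 => not_lt.mpr (hcon r h1 h2 h3)⟩
  obtain ⟨r, h1, h2, h3, h4⟩ := this
  have hr : (p, r) ∈ inversions (w * Equiv.swap p q) := by
    refine ⟨h1, ?_⟩
    simp only [Equiv.Perm.mul_apply, Equiv.swap_apply_left]
    rw [Equiv.swap_apply_of_ne_of_ne (by omega) (by omega)]
    exact h4
  have hr' : (p, r) ∉ insert (p, q) (invMap p q '' inversions w) := by
    rintro (e | ⟨x, hx, e⟩)
    · simp only [Prod.mk.injEq] at e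
      omega
    · exact (invMap_mem hpq hw hx).2.2 r h1 h2 h3 h4 e
  have := Set.ncard_le_ncard (Set.insert_subset hr hsub) hfin
  rw [Set.ncard_insert_of_notMem hr' (hfinI.insert _), hcard] at this
  exact this

theorem length_mul_swap_of_cov {N : ℕ} {w : Equiv.Perm ℕ} (hN : Small N w) {p q : ℕ}
    (h : Cov w p q) : length (w * Equiv.swap p q) = length w + 1 := by
  refine le_antisymm ?_ (length_mul_swap_lower hN h.1 h.2.1).1
  have hsub : inversions (w * Equiv.swap p q) ⊆ insert (p, q) (invMap p q '' inversions w) := by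
    intro y hy
    by_cases hne : y = (p, q)
    · exact Or.inl hne
    · obtain ⟨x, hx, e⟩ := exists_invMap_eq h hy hne
      exact Or.inr ⟨x, hx, e⟩
  refine (Set.ncard_le_ncard hsub ((hN.inversions_finite.image _).insert _)).trans ?_
  refine (Set.ncard_insert_le _ _).trans ?_
  rw [(invMap_injOn h.1 h.2.1).ncard_image]
  rfl

theorem length_eq_succ_iff_cov {N : ℕ} {w : Equiv.Perm ℕ} (hN : Small N w) {p q : ℕ}
    (hpq : p < q) : length (w * Equiv.swap p q) = length w + 1 ↔ Cov w p q := by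
  refine ⟨fun h => ?_, length_mul_swap_of_cov hN⟩
  rcases lt_trichotomy (w p) (w q) with hw | hw | hw
  · by_contra hc
    have := (length_mul_swap_lower hN hpq hw).2 hc
    omega
  · exact absurd (w.injective hw) (by omega)
  · have := (length_mul_swap_lower (N := N + q + 1) (w := w * Equiv.swap p q)
      ((hN.mono (by omega)).mul (small_swap (by omega) (by omega))) hpq (by simpa using hw)).1
    rw [mul_assoc, Equiv.swap_mul_self, mul_one] at this
    omega

theorem length_one : length 1 = 0 := by
  have : {x : ℕ × ℕ | x.1 < x.2 ∧ (1 : Equiv.Perm ℕ) x.2 < (1 : Equiv.Perm ℕ) x.1} = ∅ := by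
    ext x
    simp only [Equiv.Perm.coe_one, id_eq, Set.mem_ofPred_eq, Set.mem_empty_iff_false, iff_false]
    omega
  rw [length, this, Set.ncard_empty]

/-- Left multiplication by a simple transposition removing an inversion of values. -/
theorem length_swap_mul {N : ℕ} {w : Equiv.Perm ℕ} (hN : Small N w) {k : ℕ}
    (h : w⁻¹ (k + 1) < w⁻¹ k) : length w = length (Equiv.swap k (k + 1) * w) + 1 := by
  set v := Equiv.swap k (k + 1) * w with hv
  -- Exchanging the values `k` and `k + 1` is exchanging their positions, and this is a cover
  -- because no value lies strictly between them.
  have hw : w = v * Equiv.swap (w⁻¹ (k + 1)) (w⁻¹ k) := by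
    have e : Equiv.swap (w⁻¹ (k + 1)) (w⁻¹ k) = w⁻¹ * Equiv.swap (k + 1) k * w := by
      ext x
      have := Equiv.swap_apply_apply w⁻¹ (k + 1) k
      rw [this]
      simp
    rw [e, hv, Equiv.swap_comm (k + 1) k]
    simp [mul_assoc]
  have hvN : Small (N + k + 2) v := (small_swap (by omega) (by omega)).mul (hN.mono (by omega))
  conv_lhs => rw [hw]
  refine length_mul_swap_of_cov hvN ⟨h, by simp [hv], fun r _ _ h1 h2 => ?_⟩
  simp only [hv, Equiv.Perm.mul_apply, perm_apply_inv, Equiv.swap_apply_left,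
    Equiv.swap_apply_right] at h1 h2
  omega

/-- At positions `≥ n` only the value at `q` can change, from `w q` down to `w p`. The positions in
`[n, q)` carry values below `w q`, hence below `w p` by the cover condition, so monotonicity
survives. -/
theorem Cov.permSet {n : ℕ} {w : Equiv.Perm ℕ} (hw : w ∈ permSet n) {p q : ℕ} (hp : p < n)
    (h : Cov w p q) : w * Equiv.swap p q ∈ permSet n := by
  obtain ⟨hf, hm⟩ := hw
  obtain ⟨N, hN⟩ := exists_small hf
  refine ⟨((hN.mono (show N ≤ N + p + q + 1 by omega)).mul
    (small_swap (by omega) (by omega))).finite, fun a ha b hb hab => ?_⟩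
  obtain ⟨h1, h2, h3⟩ := h
  rw [Set.mem_Ici] at ha hb
  simp only [Equiv.Perm.mul_apply]
  rw [Equiv.swap_apply_def, Equiv.swap_apply_def, if_neg (show a ≠ p by omega),
    if_neg (show b ≠ p by omega)]
  have hlt := hm ha hb hab
  by_cases haq : a = q
  · rw [if_pos haq, if_neg (by omega)]
    subst haq
    exact h2.trans hlt
  · rw [if_neg haq]
    by_cases hbq : b = q
    · rw [if_pos hbq]
      subst hbq
      rcases lt_trichotomy (w a) (w p) with h | h | h
      · exact h
      · exact absurd (w.injective h) (by omega)
      · exact (h3 a (by omega) hab h hlt).elim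
    · rw [if_neg hbq]
      exact hlt

theorem Cov.lt_of_small {N : ℕ} {w : Equiv.Perm ℕ} (hw : Small N w) {p q : ℕ} (hp : p < N)
    (h : Cov w p q) : q ≤ N := by
  by_contra hc
  obtain ⟨-, -, h3⟩ := h
  have := hw.lt hp
  -- The fixed point `N` would lie between `p` and `q` both as a position and as a value. Thus one
  -- step of a chain enlarges the support by at most one.
  refine h3 N hp (by omega) ?_ ?_
  · rw [hw N le_rfl]
    exact this
  · rw [hw N le_rfl, hw q (by omega)]
    omega

end Covers

/-! ### Chains -/

section Chains

theorem chainPerm_zero {d : ℕ} (w : Equiv.Perm ℕ) (c : Fin d → ℕ × ℕ) : chainPerm w c 0 = w := by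
  simp [chainPerm]

theorem chainPerm_succ {d : ℕ} (w : Equiv.Perm ℕ) (c : Fin (d + 1) → ℕ × ℕ) (j : ℕ) :
    chainPerm w c (j + 1) = chainPerm (w * Equiv.swap (c 0).1 (c 0).2) (Fin.tail c) j := by
  simp [chainPerm, transp, mul_assoc, Fin.tail]

theorem chainProd_succ {d : ℕ} (c : Fin (d + 1) → ℕ × ℕ) :
    chainProd c = Equiv.swap (c 0).1 (c 0).2 * chainProd (Fin.tail c) := by
  simp [chainProd, transp, Fin.tail]

theorem chainProd_zero (c : Fin 0 → ℕ × ℕ) : chainProd c = 1 := by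
  simp [chainProd]

theorem isPieriChain_succ {N d i : ℕ} {w : Equiv.Perm ℕ} (hN : Small N w)
    {c : Fin (d + 1) → ℕ × ℕ} : IsPieriChain w i c ↔
      ((c 0).1 < i ∧ i ≤ (c 0).2 ∧ Cov w (c 0).1 (c 0).2) ∧
        IsPieriChain (w * Equiv.swap (c 0).1 (c 0).2) i (Fin.tail c) := by
  rw [IsPieriChain, Fin.forall_fin_succ]
  refine and_congr ?_ ?_
  · refine and_congr_right fun h1 => and_congr_right fun h2 => ?_
    have := length_eq_succ_iff_cov hN (lt_of_lt_of_le h1 h2)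
    rw [← this]
    simp only [Fin.val_zero, chainPerm_succ, chainPerm_zero]
  · refine forall_congr' fun j => ?_
    simp only [Fin.val_succ, chainPerm_succ, Fin.tail]

/-- The conditions on the first step of a Pieri chain. -/
def FirstStep (w : Equiv.Perm ℕ) (i : ℕ) (x : ℕ × ℕ) : Prop :=
  x.1 < i ∧ i ≤ x.2 ∧ Cov w x.1 x.2

theorem strictMono_fin_succ_iff {d : ℕ} {f : Fin (d + 1) → ℕ} :
    StrictMono f ↔ (∀ j : Fin d, f 0 < f j.succ) ∧ StrictMono fun j : Fin d => f j.succ := by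
  constructor
  · intro h
    exact ⟨fun j => h (Fin.succ_pos j), fun a b hab => h (Fin.succ_lt_succ_iff.mpr hab)⟩
  · rintro ⟨h0, h1⟩ a b hab
    induction b using Fin.cases with
    | zero => exact absurd hab (Fin.not_lt_zero a)
    | succ b =>
      induction a using Fin.cases with
      | zero => exact h0 b
      | succ a => exact h1 (Fin.succ_lt_succ_iff.mp hab)

theorem strictAnti_fin_succ_iff {d : ℕ} {f : Fin (d + 1) → ℕ} :
    StrictAnti f ↔ (∀ j : Fin d, f j.succ < f 0) ∧ StrictAnti fun j : Fin d => f j.succ := by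
  constructor
  · intro h
    exact ⟨fun j => h (Fin.succ_pos j), fun a b hab => h (Fin.succ_lt_succ_iff.mpr hab)⟩
  · rintro ⟨h0, h1⟩ a b hab
    induction b using Fin.cases with
    | zero => exact absurd hab (Fin.not_lt_zero a)
    | succ b =>
      induction a using Fin.cases with
      | zero => exact h0 b
      | succ a => exact h1 (Fin.succ_lt_succ_iff.mp hab)

theorem isXChain_succ {N d i : ℕ} {w : Equiv.Perm ℕ} (hN : Small N w)
    {c : Fin (d + 1) → ℕ × ℕ} : IsXChain w i c ↔ FirstStep w i (c 0) ∧
      IsXChain (w * Equiv.swap (c 0).1 (c 0).2) i (Fin.tail c) ∧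
      ∀ j : Fin d, w (c 0).1 <
        chainPerm (w * Equiv.swap (c 0).1 (c 0).2) (Fin.tail c) j (Fin.tail c j).1 := by
  rw [IsXChain, IsXChain, isPieriChain_succ hN, strictMono_fin_succ_iff, FirstStep]
  simp only [Fin.val_succ, chainPerm_succ, Fin.tail, Fin.val_zero, chainPerm_zero]
  tauto

theorem isYChain_succ {N d i : ℕ} {w : Equiv.Perm ℕ} (hN : Small N w)
    {c : Fin (d + 1) → ℕ × ℕ} : IsYChain w i c ↔ FirstStep w i (c 0) ∧
      IsYChain (w * Equiv.swap (c 0).1 (c 0).2) i (Fin.tail c) ∧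
      ∀ j : Fin d,
        chainPerm (w * Equiv.swap (c 0).1 (c 0).2) (Fin.tail c) j (Fin.tail c j).2 <
          w (c 0).2 := by
  rw [IsYChain, IsYChain, isPieriChain_succ hN, strictAnti_fin_succ_iff, FirstStep]
  simp only [Fin.val_succ, chainPerm_succ, Fin.tail, Fin.val_zero, chainPerm_zero]
  tauto

theorem FirstStep.small {N i : ℕ} {w : Equiv.Perm ℕ} (hN : Small N w) (hi : i ≤ N) {x : ℕ × ℕ}
    (h : FirstStep w i x) : Small (N + 1) (w * Equiv.swap x.1 x.2) := by
  have := h.2.2.lt_of_small hN (by have := h.1; omega)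
  exact (hN.mono (by omega)).mul (small_swap (by have := h.1; omega) (by omega))

theorem FirstStep.permSet {n i : ℕ} {w : Equiv.Perm ℕ} (hw : w ∈ permSet n) (hi : i ≤ n)
    {x : ℕ × ℕ} (h : FirstStep w i x) : w * Equiv.swap x.1 x.2 ∈ permSet n :=
  h.2.2.permSet hw (lt_of_lt_of_le h.1 hi)

theorem isPieriChain_permSet {n i d : ℕ} (hi : i ≤ n) {w : Equiv.Perm ℕ} (hw : w ∈ permSet n)
    {c : Fin d → ℕ × ℕ} (hc : IsPieriChain w i c) : w * chainProd c ∈ permSet n := by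
  induction d generalizing w with
  | zero => simpa [chainProd_zero] using hw
  | succ d ih =>
    obtain ⟨N, hN⟩ := exists_small hw.1
    obtain ⟨h1, h2⟩ := (isPieriChain_succ hN).mp hc
    rw [chainProd_succ, ← mul_assoc]
    exact ih (FirstStep.permSet hw hi h1) h2

theorem isPieriChain_small {N i d : ℕ} (hi : i ≤ N) {w : Equiv.Perm ℕ} (hw : Small N w)
    {c : Fin d → ℕ × ℕ} (hc : IsPieriChain w i c) : Small (N + d) (w * chainProd c) := by
  induction d generalizing w N with
  | zero => simpa [chainProd_zero] using hw
  | succ d ih =>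
    obtain ⟨h1, h2⟩ := (isPieriChain_succ hw).mp hc
    rw [chainProd_succ, ← mul_assoc, show N + (d + 1) = (N + 1) + d by omega]
    exact ih (by omega) (FirstStep.small hw hi h1) h2

theorem isPieriChain_length {N i d : ℕ} {w : Equiv.Perm ℕ} (hw : Small N w)
    {c : Fin d → ℕ × ℕ} (hc : IsPieriChain w i c) : length (w * chainProd c) = length w + d := by
  induction d generalizing w N with
  | zero => simp [chainProd_zero]
  | succ d ih =>
    obtain ⟨h1, h2⟩ := (isPieriChain_succ hw).mp hc
    rw [chainProd_succ, ← mul_assoc, ih (N := max N i + 1)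
      (FirstStep.small (hw.mono (le_max_left N i)) (le_max_right N i) h1) h2,
      length_mul_swap_of_cov hw h1.2.2]
    omega

theorem FirstStep.inv_lt {w : Equiv.Perm ℕ} {i : ℕ} {x : ℕ × ℕ} (h : FirstStep w i x) {a : ℕ}
    (ha : a < w x.1) : (w * Equiv.swap x.1 x.2)⁻¹ a = w⁻¹ a := by
  have h2 := h.2.2.2.1
  rw [mul_inv_rev, Equiv.swap_inv, Equiv.Perm.mul_apply]
  refine Equiv.swap_apply_of_ne_of_ne ?_ ?_ <;> rw [Ne, Equiv.Perm.inv_eq_iff_eq] <;> omega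

theorem FirstStep.inv_gt {w : Equiv.Perm ℕ} {i : ℕ} {x : ℕ × ℕ} (h : FirstStep w i x) {a : ℕ}
    (ha : w x.2 < a) : (w * Equiv.swap x.1 x.2)⁻¹ a = w⁻¹ a := by
  have h2 := h.2.2.2.1
  rw [mul_inv_rev, Equiv.swap_inv, Equiv.Perm.mul_apply]
  refine Equiv.swap_apply_of_ne_of_ne ?_ ?_ <;> rw [Ne, Equiv.Perm.inv_eq_iff_eq] <;> omega

/-- A step exchanges its label with a larger value, so a value below all labels is never moved. This
lets `(w ζ)⁻¹` remember the steps of the chain one by one. -/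
theorem isXChain_inv_lt {i d N : ℕ} {w : Equiv.Perm ℕ} (hN : Small N w) {c : Fin d → ℕ × ℕ}
    (hc : IsXChain w i c) {a : ℕ} (ha : ∀ j : Fin d, a < chainPerm w c j (c j).1) :
    (w * chainProd c)⁻¹ a = w⁻¹ a := by
  induction d generalizing w N with
  | zero => simp [chainProd_zero]
  | succ d ih =>
    obtain ⟨h1, h2, h3⟩ := (isXChain_succ hN).mp hc
    have h0 := ha 0
    simp only [Fin.val_zero, chainPerm_zero] at h0
    rw [chainProd_succ, ← mul_assoc, ih (N := max N i + 1)
      (FirstStep.small (hN.mono (le_max_left N i)) (le_max_right N i) h1) h2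
      (fun j => h0.trans (h3 j)), h1.inv_lt h0]

theorem isYChain_inv_gt {i d N : ℕ} {w : Equiv.Perm ℕ} (hN : Small N w) {c : Fin d → ℕ × ℕ}
    (hc : IsYChain w i c) {a : ℕ} (ha : ∀ j : Fin d, chainPerm w c j (c j).2 < a) :
    (w * chainProd c)⁻¹ a = w⁻¹ a := by
  induction d generalizing w N with
  | zero => simp [chainProd_zero]
  | succ d ih =>
    obtain ⟨h1, h2, h3⟩ := (isYChain_succ hN).mp hc
    have h0 := ha 0
    simp only [Fin.val_zero, chainPerm_zero] at h0
    rw [chainProd_succ, ← mul_assoc, ih (N := max N i + 1)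
      (FirstStep.small (hN.mono (le_max_left N i)) (le_max_right N i) h1) h2
      (fun j => (h3 j).trans h0), h1.inv_gt h0]

/-- The value of `(w ζ)⁻¹` at the first label determines the first step of an `X`-chain. -/
theorem isXChain_inv_first {i d N : ℕ} {w : Equiv.Perm ℕ} (hN : Small N w)
    {c : Fin (d + 1) → ℕ × ℕ} (hc : IsXChain w i c) :
    (w * chainProd c)⁻¹ (w (c 0).1) = (c 0).2 ∧
      ∀ a < w (c 0).1, (w * chainProd c)⁻¹ a = w⁻¹ a := by
  obtain ⟨h1, h2, h3⟩ := (isXChain_succ hN).mp hc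
  have hs := FirstStep.small (hN.mono (le_max_left N i)) (le_max_right N i) h1
  rw [chainProd_succ, ← mul_assoc]
  refine ⟨?_, fun a ha => ?_⟩
  · rw [isXChain_inv_lt hs h2 h3]
    simp
  · rw [isXChain_inv_lt hs h2 (fun j => ha.trans (h3 j)), h1.inv_lt ha]

theorem isYChain_inv_first {i d N : ℕ} {w : Equiv.Perm ℕ} (hN : Small N w)
    {c : Fin (d + 1) → ℕ × ℕ} (hc : IsYChain w i c) :
    (w * chainProd c)⁻¹ (w (c 0).2) = (c 0).1 ∧
      ∀ a, w (c 0).2 < a → (w * chainProd c)⁻¹ a = w⁻¹ a := by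
  obtain ⟨h1, h2, h3⟩ := (isYChain_succ hN).mp hc
  have hs := FirstStep.small (hN.mono (le_max_left N i)) (le_max_right N i) h1
  rw [chainProd_succ, ← mul_assoc]
  refine ⟨?_, fun a ha => ?_⟩
  · rw [isYChain_inv_gt hs h2 h3]
    simp
  · rw [isYChain_inv_gt hs h2 (fun j => (h3 j).trans ha), h1.inv_gt ha]

theorem LexLt.asymm {u v : Equiv.Perm ℕ} (h : LexLt u v) (h' : LexLt v u) : False := by
  obtain ⟨k, h1, h2⟩ := h
  obtain ⟨l, h3, h4⟩ := h'
  rcases lt_trichotomy k l with hkl | rfl | hkl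
  · have := h3 k hkl; omega
  · omega
  · have := h1 l hkl; omega

theorem RevLexLt.asymm {u v : Equiv.Perm ℕ} (h : RevLexLt u v) (h' : RevLexLt v u) : False := by
  obtain ⟨k, h1, h2⟩ := h
  obtain ⟨l, h3, h4⟩ := h'
  rcases lt_trichotomy k l with hkl | rfl | hkl
  · have := h1 l hkl; omega
  · omega
  · have := h3 k hkl; omega

/-- The first steps of two `X`-chains compared in the lexicographic order of `(w ζ)⁻¹`. -/
theorem isXChain_first_of_lexLt {i d N : ℕ} {w : Equiv.Perm ℕ} (hN : Small N w)
    {c c' : Fin (d + 1) → ℕ × ℕ} (hc : IsXChain w i c) (hc' : IsXChain w i c')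
    (h : ¬ LexLt (w * chainProd c)⁻¹ (w * chainProd c')⁻¹) :
    w (c 0).1 < w (c' 0).1 ∨ ((c' 0).1 = (c 0).1 ∧ (c' 0).2 < (c 0).2) ∨ c' 0 = c 0 := by
  obtain ⟨e1, e2⟩ := isXChain_inv_first hN hc
  obtain ⟨e1', e2'⟩ := isXChain_inv_first hN hc'
  obtain ⟨⟨a1, a2, a3⟩, -, -⟩ := (isXChain_succ hN).mp hc
  obtain ⟨⟨b1, b2, b3⟩, -, -⟩ := (isXChain_succ hN).mp hc'
  rcases lt_trichotomy (w (c 0).1) (w (c' 0).1) with hlt | heq | hgt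
  · exact Or.inl hlt
  · have hp := w.injective heq
    rcases lt_trichotomy (c' 0).2 (c 0).2 with h1 | h1 | h1
    · exact Or.inr (Or.inl ⟨hp.symm, h1⟩)
    · exact Or.inr (Or.inr (Prod.ext hp.symm h1))
    · refine (h ⟨w (c 0).1, fun j hj => ?_, ?_⟩).elim
      · rw [e2 j hj, e2' j (heq ▸ hj)]
      · rw [e1, heq, e1']
        exact h1
  -- At the smaller label, that of `c'`, the inverse for `c'` has moved to `q'`, whereas the one for
  -- `c` still has the original position `p' < q'`.
  · refine (h ⟨w (c' 0).1, fun j hj => ?_, ?_⟩).elim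
    · rw [e2 j (hj.trans hgt), e2' j hj]
    · rw [e1', e2 _ hgt]
      simp only [perm_inv_apply]
      exact b3.1

theorem isYChain_first_of_revLexLt {i d N : ℕ} {w : Equiv.Perm ℕ} (hN : Small N w)
    {c c' : Fin (d + 1) → ℕ × ℕ} (hc : IsYChain w i c) (hc' : IsYChain w i c')
    (h : ¬ RevLexLt (w * chainProd c)⁻¹ (w * chainProd c')⁻¹) :
    w (c 0).2 < w (c' 0).2 ∨ ((c' 0).2 = (c 0).2 ∧ (c' 0).1 < (c 0).1) ∨ c' 0 = c 0 := by
  obtain ⟨e1, e2⟩ := isYChain_inv_first hN hc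
  obtain ⟨e1', e2'⟩ := isYChain_inv_first hN hc'
  obtain ⟨⟨a1, a2, a3⟩, -, -⟩ := (isYChain_succ hN).mp hc
  obtain ⟨⟨b1, b2, b3⟩, -, -⟩ := (isYChain_succ hN).mp hc'
  rcases lt_trichotomy (w (c 0).2) (w (c' 0).2) with hlt | heq | hgt
  · exact Or.inl hlt
  · have hp := w.injective heq
    rcases lt_trichotomy (c' 0).1 (c 0).1 with h1 | h1 | h1
    · exact Or.inr (Or.inl ⟨hp.symm, h1⟩)
    · exact Or.inr (Or.inr (Prod.ext h1 hp.symm))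
    · refine (h ⟨w (c 0).2, fun j hj => ?_, ?_⟩).elim
      · rw [e2 j hj, e2' j (heq ▸ hj)]
      · rw [e1, heq, e1']
        exact h1
  -- At the larger label, that of `c`, the inverse for `c` has moved down to `p`, whereas the one
  -- for `c'` still has the original position `q > p`.
  · refine (h ⟨w (c 0).2, fun j hj => ?_, ?_⟩).elim
    · rw [e2 j hj, e2' j (hgt.trans hj)]
    · rw [e1, e2' _ hgt]
      simp only [perm_inv_apply]
      exact a3.1

end Chains

end KP
end

noncomputable section
namespace KP

/-! ### Operators of left and right multiplication on functions of a permutation -/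

section Operators

/-- Adjacent values compare alike with every other value, so left multiplication by their
transposition only interferes with a cover that exchanges exactly these two. The order is arbitrary
in order to apply the results of this section to `ℕ` (chains of type `X`) and to `ℕᵒᵈ` (type `Y`).
-/
theorem cov_swap_mul_iff {α : Type*} [LinearOrder α] {k k' : α} (hk : k < k')
    (hadj : ∀ v, v ≤ k ∨ k' ≤ v) {w : Equiv.Perm α} {p q : α}
    (h1 : ¬ (w p = k ∧ w q = k')) (h2 : ¬ (w p = k' ∧ w q = k)) :
    (Cov w p q ∧ (w * Equiv.swap p q)⁻¹ k' < (w * Equiv.swap p q)⁻¹ k) ↔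
      (w⁻¹ k' < w⁻¹ k ∧ Cov (Equiv.swap k k' * w) p q) := by
  obtain ⟨x, rfl⟩ := w.surjective k
  obtain ⟨x', rfl⟩ := w.surjective k'
  have hinj := w.injective
  simp only [Cov, mul_inv_rev, Equiv.swap_inv, Equiv.Perm.mul_apply, perm_inv_apply,
    EmbeddingLike.apply_eq_iff_eq, Equiv.swap_apply_def] at *
  have hxx : x ≠ x' := fun h => by simp [h] at hk
  have o1 := lt_trichotomy x x'
  have o2 := lt_trichotomy x p
  have o3 := lt_trichotomy x q
  have o4 := lt_trichotomy x' p
  have o5 := lt_trichotomy x' q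
  have o6 := lt_trichotomy (w p) (w q)
  have o7 := @hinj x p
  have o8 := @hinj x q
  have o9 := @hinj x' p
  have o10 := @hinj x' q
  constructor
  · rintro ⟨⟨a1, a2, a3⟩, a4⟩
    have b1 := hadj (w p)
    have b2 := hadj (w q)
    have b3 := a3 x
    have b4 := a3 x'
    refine ⟨?_, a1, ?_, ?_⟩
    · grind
    · grind
    · intro r c1 c2
      have b5 := hadj (w r)
      have b6 := a3 r c1 c2
      grind
  · rintro ⟨a4, ⟨a1, a2, a3⟩⟩
    have b1 := hadj (w p)
    have b2 := hadj (w q)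
    have b3 := a3 x
    have b4 := a3 x'
    refine ⟨⟨a1, ?_, ?_⟩, ?_⟩
    · grind
    · intro r c1 c2
      have b5 := hadj (w r)
      have b6 := a3 r c1 c2
      grind
    · grind

variable {α R : Type*} [LinearOrder α] [CommRing R]

open Classical in
/-- The sum of `F` over the covers of `w` that move the value `a` from a position in `I` to a
position in `S`. -/
def stepOp (I : α → Prop) (S : Finset α) (a : α) (F : Equiv.Perm α → R) (w : Equiv.Perm α) : R :=
  if I (w⁻¹ a) then
    ∑ q ∈ S, if Cov w (w⁻¹ a) q then F (w * Equiv.swap (w⁻¹ a) q) else 0 else 0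

/-- The operator of left multiplication by the transposition of `k` and `k'`, when this decreases
the length. -/
def descOp (k k' : α) (F : Equiv.Perm α → R) (w : Equiv.Perm α) : R :=
  if w⁻¹ k' < w⁻¹ k then F (Equiv.swap k k' * w) else 0

open Classical in
/-- The indicator function of the permutations that have the value `a` at a position in `I`. -/
def ind (R : Type*) [CommRing R] (I : α → Prop) (a : α) (w : Equiv.Perm α) : R :=
  if I (w⁻¹ a) then 1 else 0

theorem stepOp_congr {I : α → Prop} {S : Finset α} {a : α} {F G : Equiv.Perm α → R}
    {w : Equiv.Perm α}
    (h : ∀ q ∈ S, I (w⁻¹ a) → Cov w (w⁻¹ a) q →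
      F (w * Equiv.swap (w⁻¹ a) q) = G (w * Equiv.swap (w⁻¹ a) q)) :
    stepOp I S a F w = stepOp I S a G w := by
  unfold stepOp
  split_ifs with h1
  · refine Finset.sum_congr rfl fun q hq => ?_
    split_ifs with h2
    · exact h q hq h1 h2
    · rfl
  · rfl

theorem stepOp_add (I : α → Prop) (S : Finset α) (a : α) (F G : Equiv.Perm α → R)
    (w : Equiv.Perm α) :
    stepOp I S a (fun u => F u + G u) w = stepOp I S a F w + stepOp I S a G w := by
  unfold stepOp
  split_ifs
  · rw [← Finset.sum_add_distrib]
    refine Finset.sum_congr rfl fun q _ => ?_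
    split_ifs <;> simp
  · simp

theorem stepOp_mul (I : α → Prop) (S : Finset α) (a : α) (r : R) (F : Equiv.Perm α → R)
    (w : Equiv.Perm α) :
    stepOp I S a (fun u => r * F u) w = r * stepOp I S a F w := by
  unfold stepOp
  split_ifs
  · rw [Finset.mul_sum]
    refine Finset.sum_congr rfl fun q _ => ?_
    split_ifs <;> simp
  · simp

theorem descOp_add (k k' : α) (F G : Equiv.Perm α → R) (w : Equiv.Perm α) :
    descOp k k' (fun u => F u + G u) w = descOp k k' F w + descOp k k' G w := by
  unfold descOp
  split_ifs <;> simp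

theorem descOp_mul (k k' : α) (r : R) (F : Equiv.Perm α → R) (w : Equiv.Perm α) :
    descOp k k' (fun u => r * F u) w = r * descOp k k' F w := by
  unfold descOp
  split_ifs <;> simp

theorem swap_mul_inv_apply (k k' : α) (w : Equiv.Perm α) (a : α) :
    (Equiv.swap k k' * w)⁻¹ a = w⁻¹ (Equiv.swap k k' a) := by
  simp

theorem mul_swap_inv_apply (p q : α) (w : Equiv.Perm α) (a : α) :
    (w * Equiv.swap p q)⁻¹ a = Equiv.swap p q (w⁻¹ a) := by
  simp

open Classical in
theorem stepOp_descOp_of_ne {I : α → Prop} {S : Finset α} {k k' : α} (hk : k < k')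
    (hadj : ∀ v, v ≤ k ∨ k' ≤ v) {a : α} (h1 : a ≠ k) (h2 : a ≠ k')
    (F : Equiv.Perm α → R) (w : Equiv.Perm α) :
    stepOp I S a (descOp k k' F) w = descOp k k' (stepOp I S a F) w := by
  have e : (Equiv.swap k k' * w)⁻¹ a = w⁻¹ a := by
    rw [swap_mul_inv_apply, Equiv.swap_apply_of_ne_of_ne h1 h2]
  have ha1 : ∀ q, ¬ (w (w⁻¹ a) = k ∧ w q = k') := fun q h => h1 (by rw [← h.1, perm_apply_inv])
  have ha2 : ∀ q, ¬ (w (w⁻¹ a) = k' ∧ w q = k) := fun q h => h2 (by rw [← h.1, perm_apply_inv])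
  have key : ∀ q, (if Cov w (w⁻¹ a) q then descOp k k' F (w * Equiv.swap (w⁻¹ a) q) else 0) =
      if w⁻¹ k' < w⁻¹ k then (if Cov (Equiv.swap k k' * w) (w⁻¹ a) q then
        F (Equiv.swap k k' * w * Equiv.swap (w⁻¹ a) q) else 0) else 0 := by
    intro q
    rw [descOp, ← ite_and, ← ite_and, mul_assoc]
    exact if_congr (cov_swap_mul_iff hk hadj (ha1 q) (ha2 q)) rfl rfl
  rw [descOp, stepOp, stepOp, e]
  by_cases hI : I (w⁻¹ a)
  · rw [if_pos hI, if_pos hI, Finset.sum_congr rfl fun q _ => key q]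
    by_cases hd : w⁻¹ k' < w⁻¹ k
    · simp only [hd, if_true]
    · simp only [hd, if_false, Finset.sum_const_zero]
  · rw [if_neg hI, if_neg hI, ite_self]

theorem swap_mul_swap_inv (w : Equiv.Perm α) (k k' : α) :
    Equiv.swap k k' * (w * Equiv.swap (w⁻¹ k) (w⁻¹ k')) = w := by
  ext x
  have := Equiv.swap_apply_apply w (w⁻¹ k) (w⁻¹ k')
  rw [perm_apply_inv, perm_apply_inv] at this
  rw [this]
  simp [mul_assoc]

open Classical in
-- Left multiplication by the transposition renames the moved value `k` to `k'`. The extra term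
-- comes from the cover that exchanges `k` and `k'` themselves: the descent operator undoes it at
-- once.
theorem stepOp_descOp_left {I : α → Prop} {S : Finset α} {k k' : α} (hk : k < k')
    (hadj : ∀ v, v ≤ k ∨ k' ≤ v) (hI : ∀ p q, I p → ¬ I q → p < q) (hS : ∀ q ∈ S, ¬ I q)
    (F : Equiv.Perm α → R) {w : Equiv.Perm α} (hw' : I (w⁻¹ k') ∨ w⁻¹ k' ∈ S) :
    stepOp I S k (descOp k k' F) w = descOp k k' (stepOp I S k' F) w +
      ind R I k w * (1 - ind R I k' w) * F w := by
  unfold stepOp descOp ind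
  simp only [swap_mul_inv_apply, Equiv.swap_apply_right]
  by_cases hIk : I (w⁻¹ k)
  · simp only [hIk, if_true, one_mul]
    have key : ∀ q ∈ S, (if Cov w (w⁻¹ k) q then
        if (w * Equiv.swap (w⁻¹ k) q)⁻¹ k' < (w * Equiv.swap (w⁻¹ k) q)⁻¹ k then
          F (Equiv.swap k k' * (w * Equiv.swap (w⁻¹ k) q)) else 0 else 0) =
        (if w⁻¹ k' < w⁻¹ k then (if Cov (Equiv.swap k k' * w) (w⁻¹ k) q then
          F (Equiv.swap k k' * w * Equiv.swap (w⁻¹ k) q) else 0) else 0) +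
        if q = w⁻¹ k' then F w else 0 := by
      intro q hq
      by_cases hqx : q = w⁻¹ k'
      · subst hqx
        have hlt := hI _ _ hIk (hS _ hq)
        have hcov : Cov w (w⁻¹ k) (w⁻¹ k') := by
          refine ⟨hlt, by simpa only [perm_apply_inv], fun r _ _ h1 h2 => ?_⟩
          rw [perm_apply_inv] at h1 h2
          rcases hadj (w r) with h | h
          · exact absurd h1 (not_lt.mpr h)
          · exact absurd h2 (not_lt.mpr h)
        simp only [hcov, if_true, mul_swap_inv_apply, Equiv.swap_apply_left,
          Equiv.swap_apply_right, hlt, not_lt.mpr hlt.le, if_false, zero_add, swap_mul_swap_inv]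
      · have := cov_swap_mul_iff hk hadj (w := w) (p := w⁻¹ k) (q := q)
          (by
            rw [perm_apply_inv]
            rintro ⟨-, h⟩
            exact hqx (by rw [← h, perm_inv_apply])) (by
            rw [perm_apply_inv]
            rintro ⟨h, -⟩
            exact hk.ne h)
        simp only [hqx, if_false, add_zero, ← ite_and, this, mul_assoc]
    rw [Finset.sum_congr rfl key, Finset.sum_add_distrib, Finset.sum_ite_eq']
    congr 1
    · split_ifs <;> simp
    · rcases hw' with h | h
      · have : w⁻¹ k' ∉ S := fun h' => hS _ h' h
        simp only [h, this, if_true, if_false, sub_self, zero_mul]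
      · simp only [h, hS _ h, if_true, if_false, sub_zero, one_mul]
  · simp only [hIk, if_false, ite_self, zero_mul, add_zero]

open Classical in
-- Mirror image of `stepOp_descOp_left`: here the cover that exchanges `k` and `k'` occurs only
-- after the left multiplication, which gives the minus sign.
theorem stepOp_descOp_right {I : α → Prop} {S : Finset α} {k k' : α} (hk : k < k')
    (hadj : ∀ v, v ≤ k ∨ k' ≤ v) (hI : ∀ p q, I p → ¬ I q → p < q) (hS : ∀ q ∈ S, ¬ I q)
    (F : Equiv.Perm α → R) {w : Equiv.Perm α} (hw : I (w⁻¹ k) ∨ w⁻¹ k ∈ S) :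
    stepOp I S k' (descOp k k' F) w = descOp k k' (stepOp I S k F) w -
      (1 - ind R I k w) * ind R I k' w * F w := by
  unfold stepOp descOp ind
  simp only [swap_mul_inv_apply, Equiv.swap_apply_left]
  by_cases hIk : I (w⁻¹ k')
  · simp only [hIk, if_true, mul_one]
    have key : ∀ q ∈ S, (if Cov w (w⁻¹ k') q then
        if (w * Equiv.swap (w⁻¹ k') q)⁻¹ k' < (w * Equiv.swap (w⁻¹ k') q)⁻¹ k then
          F (Equiv.swap k k' * (w * Equiv.swap (w⁻¹ k') q)) else 0 else 0) =
        (if w⁻¹ k' < w⁻¹ k then (if Cov (Equiv.swap k k' * w) (w⁻¹ k') q then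
          F (Equiv.swap k k' * w * Equiv.swap (w⁻¹ k') q) else 0) else 0) -
        if q = w⁻¹ k then F w else 0 := by
      intro q hq
      -- This is the only target excluded by `cov_swap_mul_iff`.
      by_cases hqx : q = w⁻¹ k
      · subst hqx
        have hlt := hI _ _ hIk (hS _ hq)
        have hcov : ¬ Cov w (w⁻¹ k') (w⁻¹ k) := by
          rintro ⟨-, h, -⟩
          rw [perm_apply_inv, perm_apply_inv] at h
          exact hk.not_gt h
        have hcov' : Cov (Equiv.swap k k' * w) (w⁻¹ k') (w⁻¹ k) := by
          refine ⟨hlt, by simpa only [Equiv.Perm.mul_apply, perm_apply_inv, Equiv.swap_apply_left,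
            Equiv.swap_apply_right] using hk, fun r h1 h2 h3 h4 => ?_⟩
          simp only [Equiv.Perm.mul_apply, perm_apply_inv, Equiv.swap_apply_left,
            Equiv.swap_apply_right] at h3 h4
          rcases hadj (Equiv.swap k k' (w r)) with h | h
          · exact absurd h3 (not_lt.mpr h)
          · exact absurd h4 (not_lt.mpr h)
        simp only [hcov, hcov', if_true, hlt, if_false, mul_assoc]
        rw [Equiv.swap_comm (w⁻¹ k'), swap_mul_swap_inv, sub_self]
      · have := cov_swap_mul_iff hk hadj (w := w) (p := w⁻¹ k') (q := q)
          (by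
            rw [perm_apply_inv]
            rintro ⟨h, -⟩
            exact hk.ne h.symm) (by
            rw [perm_apply_inv]
            rintro ⟨-, h⟩
            exact hqx (by rw [← h, perm_inv_apply]))
        simp only [hqx, if_false, sub_zero, ← ite_and, this, mul_assoc]
    rw [Finset.sum_congr rfl key, Finset.sum_sub_distrib, Finset.sum_ite_eq']
    congr 1
    · split_ifs <;> simp
    · rcases hw with h | h
      · have : w⁻¹ k ∉ S := fun h' => hS _ h' h
        simp only [h, this, if_true, if_false, sub_self, zero_mul]
      · simp only [h, hS _ h, if_true, if_false, sub_zero, one_mul]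
  · simp only [hIk, if_false, ite_self, zero_mul, mul_zero, sub_zero]

theorem ind_mul_stepOp (I : α → Prop) (S : Finset α) (a : α) (F : Equiv.Perm α → R)
    (w : Equiv.Perm α) : ind R I a w * stepOp I S a F w = stepOp I S a F w := by
  unfold ind stepOp
  split_ifs <;> simp

theorem stepOp_one_sub_ind {I : α → Prop} {S : Finset α} (hS : ∀ q ∈ S, ¬ I q) (a : α)
    (F : Equiv.Perm α → R) (w : Equiv.Perm α) :
    stepOp I S a (fun u => (1 - ind R I a u) * F u) w = stepOp I S a F w :=
  stepOp_congr fun q hq _ _ => by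
    have : ind R I a (w * Equiv.swap (w⁻¹ a) q) = 0 := by
      simp only [ind, mul_swap_inv_apply, Equiv.swap_apply_left, hS q hq, if_false]
    rw [this, sub_zero, one_mul]

theorem swap_swap_comm {x x' r : α} (h1 : x ≠ x') (h2 : x' ≠ r) (h3 : x ≠ r) :
    Equiv.swap x r * Equiv.swap x' r = Equiv.swap x x' * Equiv.swap x r := by
  ext y
  simp only [Equiv.Perm.mul_apply, Equiv.swap_apply_def]
  grind

/-- With `k` ahead of `k'` after the left multiplication, moving `k` past the position of `k'` is
blocked until `k'` has been moved out of the way. The surviving two-step paths combine with the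
transposition of `k` and `k'` into single steps from `w`. -/
theorem descOp_stepOp_commutator {I : α → Prop} {S : Finset α} {k k' : α} (hk : k < k')
    (hadj : ∀ v, v ≤ k ∨ k' ≤ v) (hI : ∀ p q, I p → ¬ I q → p < q) (hS : ∀ q ∈ S, ¬ I q)
    (F : Equiv.Perm α → R) {w : Equiv.Perm α} (hw : I (w⁻¹ k) ∨ w⁻¹ k ∈ S) :
    descOp k k' (stepOp I S k' (stepOp I S k F)) w - descOp k k' (stepOp I S k (stepOp I S k' F)) w
      = ind R I k w * ind R I k' w * stepOp I S k F w -
        (1 - ind R I k w) * ind R I k' w * stepOp I S k' F w := by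
  obtain ⟨x, hx⟩ := w.surjective k
  obtain ⟨x', hx'⟩ := w.surjective k'
  have ex : w⁻¹ k = x := by rw [← hx, perm_inv_apply]
  have ex' : w⁻¹ k' = x' := by rw [← hx', perm_inv_apply]
  have hxx : x ≠ x' := by
    rintro rfl
    exact hk.ne (hx.symm.trans hx')
  rw [ex] at hw
  have hinj := w.injective
  by_cases hd : x' < x
  · set v := Equiv.swap k k' * w with hv
    have hvw : ∀ y, v y = Equiv.swap k k' (w y) := fun y => rfl
    have evx : v⁻¹ k' = x := by rw [hv, swap_mul_inv_apply, Equiv.swap_apply_right, ex]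
    have evx' : v⁻¹ k = x' := by rw [hv, swap_mul_inv_apply, Equiv.swap_apply_left, ex']
    have vx : v x = k' := by rw [← evx, perm_apply_inv]
    have vx' : v x' = k := by rw [← evx', perm_apply_inv]
    have hvx : v * Equiv.swap x x' = w := by
      have := swap_mul_swap_inv w k k'
      rw [← mul_assoc, ex, ex'] at this
      exact this
    have hvinj := v.injective
    simp only [descOp, ex, ex', hd, if_true, ← hv]
    have hz : ∀ G : Equiv.Perm α → R, ¬ I x' → stepOp I S k G v = 0 := fun G h => by
      simp [-Equiv.Perm.coe_inv, stepOp, evx', h]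
    have hz' : ∀ G : Equiv.Perm α → R, ¬ I x → stepOp I S k' G v = 0 := fun G h => by
      simp [-Equiv.Perm.coe_inv, stepOp, evx, h]
    by_cases hIx' : I x'
    · by_cases hIx : I x
      -- The value `k'` at `x` lies between `x'` and every target, and it is just above `k`: no
      -- cover moves `k`.
      · have h0 : stepOp I S k (stepOp I S k' F) v = 0 := by
          rw [stepOp, evx', if_pos hIx']
          refine Finset.sum_eq_zero fun q hq => if_neg ?_
          rintro ⟨c1, c2, c3⟩
          have hxq := hI x q hIx (hS q hq)
          have := c3 x hd hxq (by rwa [vx, vx'])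
          rw [vx'] at c2
          rw [vx] at this
          rcases hadj (v q) with h | h
          · exact absurd c2 (not_lt.mpr h)
          · refine this (lt_of_le_of_ne h fun h => ?_)
            exact hxq.ne (hvinj (by rw [vx, h]))
        rw [h0, sub_zero]
        simp only [ind, ex, ex', hIx, hIx', if_true, sub_self, mul_one, one_mul, zero_mul,
          sub_zero]
        rw [stepOp, stepOp, evx, ex, if_pos hIx, if_pos hIx]
        refine Finset.sum_congr rfl fun r hr => ?_
        have hxr := hI x r hIx (hS r hr)
        have hcov : Cov v x r ↔ Cov w x r := by
          have o1 := hadj (w r)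
          have o2 := @hinj r x
          have o3 := @hinj r x'
          simp only [Cov, hvw, hx, Equiv.swap_apply_left, hxr, true_and]
          constructor
          · rintro ⟨c1, c2⟩
            refine ⟨?_, fun s s1 s2 => ?_⟩
            · rw [Equiv.swap_apply_def] at c1
              grind
            · have := c2 s s1 s2
              have o4 := hadj (w s)
              have o5 := @hinj s x
              have o6 := @hinj s x'
              rw [Equiv.swap_apply_def] at c1
              simp only [Equiv.swap_apply_def] at this
              grind
          · rintro ⟨c1, c2⟩
            refine ⟨?_, fun s s1 s2 => ?_⟩
            · rw [Equiv.swap_apply_def]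
              grind
            · have := c2 s s1 s2
              have o4 := hadj (w s)
              have o5 := @hinj s x
              have o6 := @hinj s x'
              simp only [Equiv.swap_apply_def]
              grind
        by_cases hc : Cov v x r
        · rw [if_pos hc, if_pos (hcov.mp hc)]
          have hx'r : x' < r := hd.trans hxr
          have e1 : (v * Equiv.swap x r)⁻¹ k = x' := by
            rw [mul_swap_inv_apply, evx', Equiv.swap_apply_of_ne_of_ne hxx.symm hx'r.ne]
          -- Once `k'` is at `r`, the value `k` can only be exchanged with it: any other target is
          -- blocked by the values now at `x` or `r`, or contradicts the cover `(x, r)`.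
          rw [stepOp, e1, if_pos hIx', Finset.sum_eq_single_of_mem r hr]
          · rw [if_pos, mul_assoc, swap_swap_comm hxx hx'r.ne hxr.ne, ← mul_assoc, hvx]
            refine ⟨hx'r, ?_, fun s s1 s2 => ?_⟩
            · simp only [Equiv.Perm.mul_apply, Equiv.swap_apply_right, vx,
                Equiv.swap_apply_of_ne_of_ne hxx.symm hx'r.ne, vx', hk]
            · simp only [Equiv.Perm.mul_apply, Equiv.swap_apply_right, vx,
                Equiv.swap_apply_of_ne_of_ne hxx.symm hx'r.ne, vx']
              intro h1 h2
              rcases hadj (v (Equiv.swap x r s)) with h | h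
              · exact absurd h1 (not_lt.mpr h)
              · exact absurd h2 (not_lt.mpr h)
          · intro q hq hqr
            refine if_neg ?_
            have hxq := hI x q hIx (hS q hq)
            rintro ⟨c1, c2, c3⟩
            obtain ⟨a1, a2, a3⟩ := hc
            have s1 := c3 x hd hxq
            have s2 := c3 r hx'r
            have s3 := a3 q hxq
            simp only [Equiv.Perm.mul_apply, Equiv.swap_apply_right, Equiv.swap_apply_left, vx,
                Equiv.swap_apply_of_ne_of_ne hxx.symm hx'r.ne, vx',
                Equiv.swap_apply_of_ne_of_ne hxq.ne' hqr] at c2 s1 s2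
            rw [vx] at a2 s3
            have o1 := hadj (v q)
            have o2 := @hvinj q x
            have o3 := @hvinj q r
            have o4 := lt_trichotomy q r
            have o5 := lt_trichotomy (v q) (v r)
            grind
        · rw [if_neg hc, if_neg (fun h => hc (hcov.mpr h))]
      · have hxS : x ∈ S := hw.resolve_left hIx
        rw [hz' _ hIx]
        simp only [ind, ex, ex', hIx, hIx', if_true, if_false, sub_zero, mul_one, one_mul,
          zero_mul, zero_sub, neg_inj]
        rw [stepOp, evx', if_pos hIx', Finset.sum_eq_single_of_mem x hxS]
        · rw [if_pos, Equiv.swap_comm, hvx]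
          refine ⟨hd, by rwa [vx, vx'], fun r _ _ h1 h2 => ?_⟩
          rw [vx'] at h1
          rw [vx] at h2
          rcases hadj (v r) with h | h
          · exact absurd h1 (not_lt.mpr h)
          · exact absurd h2 (not_lt.mpr h)
        · intro q hq hqx
          have : (v * Equiv.swap x' q)⁻¹ k' = x := by
            rw [mul_swap_inv_apply, evx, Equiv.swap_apply_of_ne_of_ne hxx hqx.symm]
          rw [stepOp, this, if_neg hIx, ite_self]
    · have hIx : ¬ I x := fun h => (hI x x' h hIx').not_gt hd
      rw [hz _ hIx', hz' _ hIx]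
      simp [-Equiv.Perm.coe_inv, ind, ex, ex', hIx, hIx']
  · simp only [descOp, ex, ex', hd, if_false, sub_zero]
    by_cases hIx' : I x'
    · have hIx : I x := by
        by_contra h
        exact hd (hI x' x hIx' h)
      have h0 : stepOp I S k F w = 0 := by
        rw [stepOp, ex, if_pos hIx]
        refine Finset.sum_eq_zero fun q hq => if_neg ?_
        rintro ⟨c1, c2, c3⟩
        have hxq := hI x' q hIx' (hS q hq)
        have := c3 x' (lt_of_le_of_ne (not_lt.mp hd) hxx) hxq
        rw [hx] at c2 this
        rw [hx'] at this
        rcases hadj (w q) with h | h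
        · exact absurd c2 (not_lt.mpr h)
        · refine this hk (lt_of_le_of_ne h fun h => ?_)
          exact hxq.ne (hinj (by rw [hx', h]))
      simp [-Equiv.Perm.coe_inv, ind, ex, ex', hIx, hIx', h0]
    · simp [-Equiv.Perm.coe_inv, ind, ex', hIx']

/-- One factor `1 + r B_a` of the generating function of chains. -/
def genOp (I : α → Prop) (S : Finset α) (r : R) (a : α) (F : Equiv.Perm α → R)
    (w : Equiv.Perm α) : R := F w + r * stepOp I S a F w

/-- The two correction terms are one and the same expression, attached to the labels `k` and `k'`.
In a sum over `k` with weights increasing by one they therefore telescope. -/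
theorem genOp_genOp_descOp {I : α → Prop} {S : Finset α} {k k' : α} (hk : k < k')
    (hadj : ∀ v, v ≤ k ∨ k' ≤ v) (hI : ∀ p q, I p → ¬ I q → p < q) (hS : ∀ q ∈ S, ¬ I q)
    (r : R) (F : Equiv.Perm α → R) {w : Equiv.Perm α} (hw : I (w⁻¹ k) ∨ w⁻¹ k ∈ S)
    (hw' : I (w⁻¹ k') ∨ w⁻¹ k' ∈ S) :
    genOp I S r k (genOp I S r k' (descOp k k' F)) w =
      descOp k k' (genOp I S r k (genOp I S r k' F)) w +
        r * (ind R I k w - 1) * genOp I S r k' F w -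
        genOp I S r k (fun u => r * (ind R I k' u - 1) * F u) w := by
  have e1 : stepOp I S k (genOp I S r k' (descOp k k' F)) w = stepOp I S k (descOp k k' F) w +
      r * stepOp I S k (stepOp I S k' (descOp k k' F)) w := by
    unfold genOp
    rw [stepOp_add, stepOp_mul]
  have e2 : stepOp I S k (stepOp I S k' (descOp k k' F)) w =
      stepOp I S k (descOp k k' (stepOp I S k F)) w - stepOp I S k (fun u => ind R I k' u * F u) w := by
    -- After a step the value `k` is at a position in `S`, outside `I`, so the factor `1 - ind k` of
    -- the correction may be inserted for free.
    rw [← stepOp_one_sub_ind hS k (fun u => ind R I k' u * F u), eq_sub_iff_add_eq, ← stepOp_add]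
    refine stepOp_congr fun q hq _ _ => ?_
    rw [stepOp_descOp_right hk hadj hI hS]
    · ring
    · rw [mul_swap_inv_apply, Equiv.swap_apply_left]
      exact Or.inr hq
  have e3 : stepOp I S k (fun u => r * (ind R I k' u - 1) * F u) w =
      r * stepOp I S k (fun u => ind R I k' u * F u) w - r * stepOp I S k F w := by
    rw [eq_sub_iff_add_eq, ← stepOp_mul, ← stepOp_mul, ← stepOp_add]
    refine stepOp_congr fun q hq _ _ => ?_
    ring
  have e4 : descOp k k' (genOp I S r k (genOp I S r k' F)) w = descOp k k' F w +
      r * descOp k k' (stepOp I S k' F) w + r * descOp k k' (stepOp I S k F) w +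
      r ^ 2 * descOp k k' (stepOp I S k (stepOp I S k' F)) w := by
    have : genOp I S r k (genOp I S r k' F) = fun u => (F u + r * stepOp I S k' F u) +
        (r * stepOp I S k F u + r ^ 2 * stepOp I S k (stepOp I S k' F) u) := by
      funext u
      unfold genOp
      rw [stepOp_add, stepOp_mul]
      ring
    rw [this, descOp_add, descOp_add, descOp_add, descOp_mul, descOp_mul, descOp_mul]
    ring
  have e5 := descOp_stepOp_commutator hk hadj hI hS F hw
  rw [genOp, e1, e2, stepOp_descOp_left hk hadj hI hS F hw',
    stepOp_descOp_left hk hadj hI hS _ hw', e4, genOp, stepOp_descOp_right hk hadj hI hS F hw,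
    genOp, genOp, e3]
  have e6 := ind_mul_stepOp I S k F w
  have e7 := ind_mul_stepOp I S k' F w
  linear_combination r ^ 2 * e5 + r ^ 2 * e6 - r ^ 2 * (1 - ind R I k w) * e7

theorem genOp_descOp_of_ne {I : α → Prop} {S : Finset α} {k k' : α} (hk : k < k')
    (hadj : ∀ v, v ≤ k ∨ k' ≤ v) {a : α} (h1 : a ≠ k) (h2 : a ≠ k') (r : R)
    (F : Equiv.Perm α → R) (w : Equiv.Perm α) :
    genOp I S r a (descOp k k' F) w = descOp k k' (genOp I S r a F) w := by
  unfold genOp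
  rw [stepOp_descOp_of_ne hk hadj h1 h2, descOp_add, descOp_mul]

end Operators

end KP
end

noncomputable section
namespace KP

/-! ### Generating functions of Pieri chains -/

section ChainGenerating

open Polynomial

theorem nat_adj (k : ℕ) : ∀ v : ℕ, v ≤ k ∨ k + 1 ≤ v := fun v => by omega

/-- The weighted sum of the operators `descOp`. -/
def descSum {R : Type*} [CommRing R] (l n : ℕ) (F : Equiv.Perm ℕ → R) (w : Equiv.Perm ℕ) : R :=
  ∑ j ∈ Finset.range n, ((l + j + 1 : ℕ) : R) * descOp (l + j) (l + j + 1) F w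

/-- The factor with label `a` of the generating function of `X`-chains. -/
abbrev upGen (i N a : ℕ) (F : Equiv.Perm ℕ → ℚ[X]) (w : Equiv.Perm ℕ) : ℚ[X] :=
  genOp (fun p => p < i) (Finset.Ico i N) X a F w

/-- The generating function of the `X`-chains with labels in `[l, l + n)`. -/
def upGens (i N : ℕ) : ℕ → ℕ → (Equiv.Perm ℕ → ℚ[X]) → Equiv.Perm ℕ → ℚ[X]
  | 0, _, F => F
  | n + 1, l, F => upGen i N l (upGens i N n (l + 1) F)

section General

variable {α R : Type*} [LinearOrder α] [CommRing R] (I : α → Prop) (S : Finset α)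

theorem genOp_add (r : R) (a : α) (F G : Equiv.Perm α → R) (w : Equiv.Perm α) :
    genOp I S r a (fun u => F u + G u) w = genOp I S r a F w + genOp I S r a G w := by
  unfold genOp
  rw [stepOp_add]
  ring

theorem genOp_mul (r : R) (a : α) (s : R) (F : Equiv.Perm α → R) (w : Equiv.Perm α) :
    genOp I S r a (fun u => s * F u) w = s * genOp I S r a F w := by
  unfold genOp
  rw [stepOp_mul]
  ring

theorem genOp_zero (r : R) (a : α) (w : Equiv.Perm α) :
    genOp I S r a (fun _ => 0) w = 0 := by
  have := genOp_mul I S r a 0 (fun _ => 0) w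
  simpa using this

theorem genOp_sum {ι : Type*} (s : Finset ι) (r : R) (a : α) (F : ι → Equiv.Perm α → R)
    (w : Equiv.Perm α) :
    genOp I S r a (fun u => ∑ j ∈ s, F j u) w = ∑ j ∈ s, genOp I S r a (F j) w := by
  classical
  induction s using Finset.induction_on with
  | empty => simp [genOp_zero]
  | insert j s hj ih =>
    simp only [Finset.sum_insert hj]
    rw [genOp_add, ih]

theorem genOp_congr {r : R} {a : α} {F G : Equiv.Perm α → R} {w : Equiv.Perm α} (h0 : F w = G w)
    (h : ∀ q ∈ S, I (w⁻¹ a) → Cov w (w⁻¹ a) q →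
      F (w * Equiv.swap (w⁻¹ a) q) = G (w * Equiv.swap (w⁻¹ a) q)) :
    genOp I S r a F w = genOp I S r a G w := by
  unfold genOp
  rw [h0, stepOp_congr h]

end General

theorem stepOp_derivative {α : Type*} [LinearOrder α] (I : α → Prop) (S : Finset α) (a : α)
    (F : Equiv.Perm α → ℚ[X]) (w : Equiv.Perm α) :
    derivative (stepOp I S a F w) = stepOp I S a (fun u => derivative (F u)) w := by
  unfold stepOp
  split_ifs
  · rw [derivative_sum]
    refine Finset.sum_congr rfl fun q _ => ?_
    split_ifs <;> simp
  · simp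

theorem descSum_genOp {I : ℕ → Prop} {S : Finset ℕ} {l n a : ℕ} (h : a < l) (r : ℚ[X])
    (F : Equiv.Perm ℕ → ℚ[X]) (w : Equiv.Perm ℕ) :
    genOp I S r a (descSum l n F) w = descSum l n (genOp I S r a F) w := by
  unfold descSum
  rw [genOp_sum]
  refine Finset.sum_congr rfl fun j _ => ?_
  rw [genOp_mul, genOp_descOp_of_ne (by omega) (nat_adj _) (by omega) (by omega)]

theorem upGens_add (i N n l : ℕ) (F G : Equiv.Perm ℕ → ℚ[X]) (w : Equiv.Perm ℕ) :
    upGens i N n l (fun u => F u + G u) w = upGens i N n l F w + upGens i N n l G w := by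
  induction n generalizing l w with
  | zero => rfl
  | succ n ih =>
    simp only [upGens]
    rw [← genOp_add]
    exact congrArg (fun H => upGen i N l H w) (funext fun u => ih (l + 1) u)

theorem upGens_mul (i N n l : ℕ) (r : ℚ[X]) (F : Equiv.Perm ℕ → ℚ[X]) (w : Equiv.Perm ℕ) :
    upGens i N n l (fun u => r * F u) w = r * upGens i N n l F w := by
  induction n generalizing l w with
  | zero => rfl
  | succ n ih =>
    simp only [upGens]
    rw [← genOp_mul]
    exact congrArg (fun H => upGen i N l H w) (funext fun u => ih (l + 1) u)

theorem upGens_descOp {i N n l k : ℕ} (h : k + 1 < l) (F : Equiv.Perm ℕ → ℚ[X]) :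
    upGens i N n l (descOp k (k + 1) F) = descOp k (k + 1) (upGens i N n l F) := by
  induction n generalizing l with
  | zero => rfl
  | succ n ih =>
    funext w
    simp only [upGens]
    rw [ih (by omega)]
    exact genOp_descOp_of_ne (by omega) (nat_adj _) (by omega) (by omega) _ _ _

/-- The number of positions `p < i` with value at least `l`. -/
def countGe (i l : ℕ) (w : Equiv.Perm ℕ) : ℚ[X] := ∑ p ∈ Finset.range i, if l ≤ w p then 1 else 0

theorem sum_range_eq_ind (i l : ℕ) (w : Equiv.Perm ℕ) :
    (∑ p ∈ Finset.range i, if w p = l then (1 : ℚ[X]) else 0) =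
      ind ℚ[X] (fun p => p < i) l w := by
  have : ∀ p, w p = l ↔ w⁻¹ l = p := fun p => by
    rw [Equiv.Perm.inv_eq_iff_eq, eq_comm]
  simp only [this, Finset.sum_ite_eq, Finset.mem_range, ind]
  congr

theorem countGe_succ (i l : ℕ) (w : Equiv.Perm ℕ) :
    countGe i l w = countGe i (l + 1) w + ind ℚ[X] (fun p => p < i) l w := by
  rw [← sum_range_eq_ind, countGe, countGe, ← Finset.sum_add_distrib]
  refine Finset.sum_congr rfl fun p _ => ?_
  split_ifs <;> first | omega | simp

/-- The step replaces the value `l` at a position `< i` by a larger one. -/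
theorem countGe_mul_swap {i l q : ℕ} {w : Equiv.Perm ℕ} (hq : i ≤ q) (hI : w⁻¹ l < i)
    (hc : Cov w (w⁻¹ l) q) :
    countGe i (l + 1) (w * Equiv.swap (w⁻¹ l) q) = countGe i (l + 1) w + 1 := by
  have hp : w⁻¹ l ∈ Finset.range i := Finset.mem_range.mpr hI
  unfold countGe
  rw [← Finset.add_sum_erase _ _ hp, ← Finset.add_sum_erase _ _ hp]
  have h2 := hc.2.1
  rw [perm_apply_inv] at h2
  rw [if_pos, if_neg]
  · rw [zero_add, add_comm]
    congr 1
    refine Finset.sum_congr rfl fun p hp => ?_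
    rw [Finset.mem_erase, Finset.mem_range] at hp
    rw [Equiv.Perm.mul_apply, Equiv.swap_apply_of_ne_of_ne hp.1 (by omega)]
  · rw [perm_apply_inv]
    omega
  · rw [Equiv.Perm.mul_apply, Equiv.swap_apply_left]
    omega

/-- The correction term in the commutator of `descSum` and `upGens`. -/
def upCorr (i N n l : ℕ) (F : Equiv.Perm ℕ → ℚ[X]) (w : Equiv.Perm ℕ) : ℚ[X] :=
  X * (countGe i l w * upGens i N n l F w + X * derivative (upGens i N n l F w) +
    (l : ℚ[X]) * upGens i N n l F w -
    (N : ℚ[X]) * upGens i N n l (fun u => ind ℚ[X] (fun p => p < i) (N - 1) u * F u) w)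

/-- The factor `1 + X B_l` is carried through the correction term by two rules: a step raises
`countGe` by one, and the product rule makes `X d/dX` produce one more copy of `X B_l`. -/
theorem genOp_upCorr {i N n l : ℕ} (F : Equiv.Perm ℕ → ℚ[X]) (w : Equiv.Perm ℕ) :
    upGen i N l (upCorr i N n (l + 1) F) w +
      X * (ind ℚ[X] (fun p => p < i) l w - 1) * upGens i N n (l + 1) F w =
      upCorr i N (n + 1) l F w := by
  set Q := upGens i N n (l + 1) F with hQ
  set Q' := upGens i N n (l + 1) (fun u => ind ℚ[X] (fun p => p < i) (N - 1) u * F u) with hQ'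
  have e : upCorr i N n (l + 1) F = fun u => X * (countGe i (l + 1) u * Q u +
      (X * derivative (Q u) + (((l + 1 : ℕ) : ℚ[X]) * Q u + (-(N : ℚ[X])) * Q' u))) := by
    funext u
    simp only [upCorr, ← hQ, ← hQ']
    ring
  have e1 : stepOp (fun p => p < i) (Finset.Ico i N) l (fun u => countGe i (l + 1) u * Q u) w =
      (countGe i (l + 1) w + 1) * stepOp (fun p => p < i) (Finset.Ico i N) l Q w := by
    rw [← stepOp_mul]
    refine stepOp_congr fun q hq h1 h2 => ?_
    rw [countGe_mul_swap (Finset.mem_Ico.mp hq).1 h1 h2]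
  have e2 : derivative (upGens i N (n + 1) l F w) = derivative (Q w) +
      (stepOp (fun p => p < i) (Finset.Ico i N) l Q w +
        X * stepOp (fun p => p < i) (Finset.Ico i N) l (fun u => derivative (Q u)) w) := by
    simp only [upGens, ← hQ, upGen, genOp]
    rw [derivative_add, derivative_mul, derivative_X, one_mul, stepOp_derivative]
  have e3 := ind_mul_stepOp (fun p => p < i) (Finset.Ico i N) l Q w
  rw [e, upCorr, e2]
  simp only [upGens, ← hQ, ← hQ', upGen]
  rw [genOp_mul, genOp_add, genOp_add, genOp_add, genOp_mul, genOp_mul, genOp_mul]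
  simp only [genOp]
  rw [e1, countGe_succ i l w]
  push_cast
  linear_combination (-X ^ 2) * e3

/-- Labels are added from the largest downwards. A new label `l` meets only the descent operator at
`l, l + 1`, through `genOp_genOp_descOp`; it commutes with the others. The last summand is the
uncancelled end of the telescoping sum and vanishes for `l = 0`. -/
theorem upGens_descSum {i N n l : ℕ} (hN : l + n + 1 = N) (hi : i ≤ N) (F : Equiv.Perm ℕ → ℚ[X])
    (hF : ∀ u, derivative (F u) = 0) {w : Equiv.Perm ℕ} (hw : Small N w) :
    upGens i N (n + 1) l (descSum l n F) w = descSum l n (upGens i N (n + 1) l F) w +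
      upCorr i N (n + 1) l F w +
      (l : ℚ[X]) * (X * (ind ℚ[X] (fun p => p < i) l w - 1) * upGens i N n (l + 1) F w) := by
  induction n generalizing l w with
  | zero =>
    have hl : N - 1 = l := by omega
    -- Here `l = N - 1` is the largest value at the positions `< N`, so it is never the smaller
    -- value of a cover with target in `[i, N)`.
    have hstep : ∀ G : Equiv.Perm ℕ → ℚ[X],
        stepOp (fun p => p < i) (Finset.Ico i N) l G w = 0 := by
      intro G
      unfold stepOp
      split_ifs with h
      · refine Finset.sum_eq_zero fun q hq => if_neg fun hc => ?_
        have h1 := hc.2.1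
        have h2 := hw.lt (Finset.mem_Ico.mp hq).2
        rw [perm_apply_inv] at h1
        omega
      · rfl
    have hgen : ∀ G : Equiv.Perm ℕ → ℚ[X], upGen i N l G w = G w := by
      intro G
      simp only [upGen, genOp]
      rw [hstep, mul_zero, add_zero]
    have hcount : countGe i l w = ind ℚ[X] (fun p => p < i) l w := by
      rw [← sum_range_eq_ind]
      refine Finset.sum_congr rfl fun p hp => ?_
      have := hw.lt (show p < N by have := Finset.mem_range.mp hp; omega)
      split_ifs <;> first | rfl | omega
    simp only [upGens, descSum, Finset.range_zero, Finset.sum_empty, upCorr, hgen, hcount, hF, hl]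
    rw [show (N : ℚ[X]) = l + 1 by rw [← hN]; push_cast; ring]
    ring
  | succ n ih =>
    set Q := upGens i N (n + 1) (l + 1) F with hQ
    set H := upGens i N n (l + 2) F with hH
    have hdesc : ∀ G : Equiv.Perm ℕ → ℚ[X], descSum l (n + 1) G = fun u =>
        ((l + 1 : ℕ) : ℚ[X]) * descOp l (l + 1) G u + descSum (l + 1) n G u := by
      intro G
      funext u
      rw [descSum, Finset.sum_range_succ', add_comm, descSum]
      simp only [add_zero, add_right_inj]
      refine Finset.sum_congr rfl fun j _ => ?_
      rw [show l + (j + 1) = l + 1 + j by ring]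
    have hpos : ∀ a < N, w⁻¹ a < i ∨ w⁻¹ a ∈ Finset.Ico i N := by
      intro a ha
      have := hw.inv.lt ha
      rw [Finset.mem_Ico]
      omega
    have e1 : upGens i N (n + 2) l (descOp l (l + 1) F) w =
        descOp l (l + 1) (upGens i N (n + 2) l F) w +
        X * (ind ℚ[X] (fun p => p < i) l w - 1) * Q w -
        upGen i N l (fun u => X * (ind ℚ[X] (fun p => p < i) (l + 1) u - 1) * H u) w := by
      have := genOp_genOp_descOp (I := fun p => p < i) (S := Finset.Ico i N) (k := l)
        (k' := l + 1) (by omega) (nat_adj l) (fun p q h1 h2 => by omega)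
        (fun q hq => by rw [Finset.mem_Ico] at hq; omega) X H (w := w)
        (hpos _ (by omega)) (hpos _ (by omega))
      rw [upGens, upGens, upGens_descOp (by omega)]
      exact this
    have e2 : upGens i N (n + 2) l (descSum (l + 1) n F) w =
        descSum (l + 1) n (upGens i N (n + 2) l F) w + upGen i N l (upCorr i N (n + 1) (l + 1) F) w +
        ((l + 1 : ℕ) : ℚ[X]) * upGen i N l
          (fun u => X * (ind ℚ[X] (fun p => p < i) (l + 1) u - 1) * H u) w := by
      have e3 : upGens i N (n + 2) l (descSum (l + 1) n F) w = upGen i N l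
          (fun u => (descSum (l + 1) n Q u + upCorr i N (n + 1) (l + 1) F u) +
            ((l + 1 : ℕ) : ℚ[X]) *
              (X * (ind ℚ[X] (fun p => p < i) (l + 1) u - 1) * H u)) w := by
        rw [upGens]
        refine genOp_congr _ _ ?_ fun q hq h1 h2 => ?_
        · exact ih (by omega) hw
        -- The targets are confined to `[i, N)` so that `N` keeps bounding the support after a step.
        · refine ih (by omega) (hw.mul (small_swap (hw.inv.lt (by omega)) ?_))
          exact (Finset.mem_Ico.mp hq).2
      rw [e3, upGen, genOp_add, genOp_mul, genOp_add]
      congr 2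
      exact descSum_genOp (by omega) _ _ _
    rw [hdesc F, upGens_add, upGens_mul, e1, e2, ← genOp_upCorr, hdesc]
    push_cast
    ring

/-- The set of the permutations reached by `X`-chains of length `d` with labels at least `l`. -/
def upSet (i l d : ℕ) (w : Equiv.Perm ℕ) : Set (Equiv.Perm ℕ) :=
  {z | ∃ c : Fin d → ℕ × ℕ, IsXChain w i c ∧ (∀ j : Fin d, l ≤ chainPerm w c j (c j).1) ∧
    w * chainProd c = z}

theorem upSet_zero (i l : ℕ) (w : Equiv.Perm ℕ) : upSet i l 0 w = {w} := by
  ext z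
  rw [upSet, Set.mem_ofPred_eq, Set.mem_singleton_iff]
  constructor
  · rintro ⟨c, -, -, rfl⟩
    rw [chainProd_zero, mul_one]
  · rintro rfl
    refine ⟨Fin.elim0, ⟨fun j => j.elim0, fun j => j.elim0⟩, fun j => j.elim0, ?_⟩
    rw [chainProd_zero, mul_one]

theorem upSet_succ {i l d N : ℕ} {w : Equiv.Perm ℕ} (hN : Small N w) :
    upSet i l (d + 1) w = upSet i (l + 1) (d + 1) w ∪
      ⋃ q ∈ {q | w⁻¹ l < i ∧ i ≤ q ∧ Cov w (w⁻¹ l) q},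
        upSet i (l + 1) d (w * Equiv.swap (w⁻¹ l) q) := by
  ext z
  simp only [upSet, Set.mem_union, Set.mem_iUnion, Set.mem_ofPred_eq, exists_prop]
  constructor
  · rintro ⟨c, hc, hl, rfl⟩
    obtain ⟨h1, h2, h3⟩ := (isXChain_succ hN).mp hc
    have hl0 := hl 0
    simp only [Fin.val_zero, chainPerm_zero] at hl0
    rcases Nat.lt_or_ge l (w (c 0).1) with h | h
    · refine Or.inl ⟨c, hc, fun j => ?_, rfl⟩
      induction j using Fin.cases with
      | zero =>
        rw [Fin.val_zero, chainPerm_zero]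
        exact h
      | succ j =>
        rw [Fin.val_succ, chainPerm_succ]
        have := h3 j
        simp only [Fin.tail] at this ⊢
        omega
    · have hp : w⁻¹ l = (c 0).1 := by
        rw [Equiv.Perm.inv_eq_iff_eq]
        omega
      refine Or.inr ⟨(c 0).2, ?_, Fin.tail c, ?_, fun j => ?_, ?_⟩
      · rw [hp]
        exact h1
      · rw [hp]
        exact h2
      · rw [hp]
        have := h3 j
        omega
      · rw [hp, chainProd_succ, mul_assoc]
  · rintro (⟨c, hc, hl, rfl⟩ | ⟨q, hq, c, hc, hl, rfl⟩)
    · exact ⟨c, hc, fun j => (Nat.le_succ l).trans (hl j), rfl⟩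
    · refine ⟨Fin.cons (w⁻¹ l, q) c, (isXChain_succ hN).mpr ⟨?_, ?_, fun j => ?_⟩, fun j => ?_, ?_⟩
      · rw [Fin.cons_zero]
        exact hq
      · simpa only [Fin.cons_zero, Fin.tail_cons] using hc
      · simp only [Fin.cons_zero, Fin.tail_cons, perm_apply_inv]
        exact hl j
      · induction j using Fin.cases with
        | zero => simp only [Fin.val_zero, chainPerm_zero, Fin.cons_zero, perm_apply_inv, le_refl]
        | succ j =>
          rw [Fin.val_succ, chainPerm_succ]
          simp only [Fin.cons_zero, Fin.tail_cons, Fin.cons_succ]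
          exact (Nat.le_succ l).trans (hl j)
      · rw [chainProd_succ, Fin.cons_zero, Fin.tail_cons, mul_assoc]

theorem upSet_inv {i l d N : ℕ} {w z : Equiv.Perm ℕ} (hN : Small N w) (hz : z ∈ upSet i (l + 1) d w) :
    z⁻¹ l = w⁻¹ l := by
  obtain ⟨c, hc, hl, rfl⟩ := hz
  exact isXChain_inv_lt hN hc fun j => hl j

/-- No permutation is counted twice, because `z⁻¹ l` tells whether the label `l` was used and with
which target. The bound `M + d ≤ N` leaves room for the growth of the support by one at each of the
`d` steps, so no chain is lost by truncating at `N`. -/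
theorem coeff_upGens {i N n l d M : ℕ} (hl : l + n = N) (hi : i ≤ M) (hd : M + d ≤ N)
    {w : Equiv.Perm ℕ} (hw : Small M w) :
    ∃ Z : Finset (Equiv.Perm ℕ), (Z : Set (Equiv.Perm ℕ)) = upSet i l d w ∧
      ∀ f : Equiv.Perm ℕ → ℚ,
        (upGens i N n l (fun u => C (f u)) w).coeff d = ∑ z ∈ Z, f z := by
  classical
  induction n generalizing l d M w with
  | zero =>
    rcases d with _ | d
    · refine ⟨{w}, by rw [upSet_zero, Finset.coe_singleton], fun f => ?_⟩
      simp [upGens]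
    · refine ⟨∅, ?_, fun f => by simp [upGens]⟩
      rw [Finset.coe_empty, eq_comm, Set.eq_empty_iff_forall_notMem]
      -- With `l = N`, the first label is a value at a position `< i ≤ M`, hence smaller than `M ≤
      -- N`.
      rintro z ⟨c, hc, hlab, -⟩
      have h0 := hlab 0
      simp only [Fin.val_zero, chainPerm_zero] at h0
      have := hw.lt (lt_of_lt_of_le ((isXChain_succ hw).mp hc).1.1 hi)
      omega
  | succ n ih =>
    rcases d with _ | d
    · refine ⟨{w}, by rw [upSet_zero, Finset.coe_singleton], fun f => ?_⟩
      obtain ⟨Z, hZ, hZ'⟩ := ih (l := l + 1) (by omega) hi hd hw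
      rw [upSet_zero, ← Finset.coe_singleton, Finset.coe_inj] at hZ
      rw [upGens, upGen, genOp, coeff_add, coeff_X_mul_zero, add_zero, hZ', hZ]
    · obtain ⟨Z, hZ, hZ'⟩ := ih (l := l + 1) (by omega) hi hd hw
      have hsmall : ∀ q, w⁻¹ l < i → Cov w (w⁻¹ l) q →
          q ≤ M ∧ Small (M + 1) (w * Equiv.swap (w⁻¹ l) q) := by
        intro q h1 h2
        have := h2.lt_of_small hw (lt_of_lt_of_le h1 hi)
        exact ⟨this, (hw.mono (Nat.le_succ M)).mul (small_swap (by omega) (by omega))⟩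
      have key : ∀ q, ∃ Z : Finset (Equiv.Perm ℕ), w⁻¹ l < i → Cov w (w⁻¹ l) q →
          ((Z : Set (Equiv.Perm ℕ)) = upSet i (l + 1) d (w * Equiv.swap (w⁻¹ l) q) ∧
          ∀ f : Equiv.Perm ℕ → ℚ,
            (upGens i N n (l + 1) (fun u => C (f u)) (w * Equiv.swap (w⁻¹ l) q)).coeff d =
              ∑ z ∈ Z, f z) := by
        intro q
        by_cases h : w⁻¹ l < i ∧ Cov w (w⁻¹ l) q
        · obtain ⟨Z, hZ, hZ'⟩ := ih (l := l + 1) (by omega) (show i ≤ M + 1 by omega)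
            (show M + 1 + d ≤ N by omega) (hsmall q h.1 h.2).2
          exact ⟨Z, fun _ _ => ⟨hZ, hZ'⟩⟩
        · exact ⟨∅, fun h1 h2 => (h ⟨h1, h2⟩).elim⟩
      choose Zq hZq using key
      set T := (Finset.Ico i N).filter fun q => w⁻¹ l < i ∧ Cov w (w⁻¹ l) q with hT
      have hTmem : ∀ q, q ∈ T ↔ w⁻¹ l < i ∧ i ≤ q ∧ Cov w (w⁻¹ l) q := by
        intro q
        rw [hT, Finset.mem_filter, Finset.mem_Ico]
        constructor
        · rintro ⟨⟨h1, -⟩, h2, h3⟩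
          exact ⟨h2, h1, h3⟩
        · rintro ⟨h1, h2, h3⟩
          exact ⟨⟨h2, by have := (hsmall q h1 h3).1; omega⟩, h1, h3⟩
      -- Later labels exceed `l`, so the value `l` stays where the first step put it.
      have hZinv : ∀ q ∈ T, ∀ z ∈ Zq q, z⁻¹ l = q := by
        intro q hq z hz
        obtain ⟨h1, h2, h3⟩ := (hTmem q).mp hq
        have hz' : z ∈ (Zq q : Set (Equiv.Perm ℕ)) := hz
        rw [(hZq q h1 h3).1] at hz'
        rw [upSet_inv (hsmall q h1 h3).2 hz', mul_swap_inv_apply, Equiv.swap_apply_left]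
      refine ⟨Z ∪ T.biUnion Zq, ?_, fun f => ?_⟩
      · rw [upSet_succ hw, Finset.coe_union, hZ, Finset.coe_biUnion]
        congr 1
        refine Set.iUnion_congr fun q => ?_
        refine Set.iUnion_congr_Prop ?_ fun h => ?_
        · rw [Finset.mem_coe, hTmem, Set.mem_ofPred_eq]
        · obtain ⟨h1, h2, h3⟩ := h
          exact (hZq q h1 h3).1
      · rw [upGens, upGen, genOp, coeff_add, coeff_X_mul, hZ', Finset.sum_union, Finset.sum_biUnion]
        · congr 1
          unfold stepOp
          by_cases hp : w⁻¹ l < i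
          · rw [if_pos hp, finsetSum_coeff, hT, Finset.sum_filter]
            refine Finset.sum_congr rfl fun q hq => ?_
            simp only [hp, true_and]
            split_ifs with h
            · exact (hZq q hp h).2 f
            · rw [coeff_zero]
          · rw [if_neg hp, coeff_zero, hT]
            simp only [hp, false_and, Finset.filter_false, Finset.sum_empty]
        · intro q hq q' hq' hne
          refine Finset.disjoint_left.mpr fun z hz hz' => hne ?_
          rw [← hZinv q hq z hz, hZinv q' hq' z hz']
        · refine Finset.disjoint_left.mpr fun z hz hz' => ?_
          obtain ⟨q, hq, hz'⟩ := Finset.mem_biUnion.mp hz'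
          have h1 := hZinv q hq z hz'
          have h2 : z ∈ (Z : Set (Equiv.Perm ℕ)) := hz
          rw [hZ] at h2
          rw [upSet_inv hw h2] at h1
          obtain ⟨h3, h4, -⟩ := (hTmem q).mp hq
          omega

end ChainGenerating

end KP
end

noncomputable section
namespace KP

/-! ### Macdonald numbers and the Pieri rule -/

section Macdonald

open Polynomial

/-- Macdonald's sum over the reduced words of length `m`, as a recursion. -/
def macAux (N : ℕ) : ℕ → Equiv.Perm ℕ → ℚ
  | 0 => fun _ => 1
  | m + 1 => fun w => (1 / (m + 1 : ℚ)) * descSum 0 N (macAux N m) w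

/-- The Macdonald number of `w`, which is the value at `1` of its Schubert polynomial (for `w`
fixing all large values compared to `N`). -/
def mac (N : ℕ) (w : Equiv.Perm ℕ) : ℚ := macAux N (length w) w

theorem descOp_congr {R : Type*} [CommRing R] {k k' : ℕ} {F G : Equiv.Perm ℕ → R}
    {w : Equiv.Perm ℕ}
    (h : w⁻¹ k' < w⁻¹ k → F (Equiv.swap k k' * w) = G (Equiv.swap k k' * w)) :
    descOp k k' F w = descOp k k' G w := by
  unfold descOp
  split_ifs with h1
  · exact h h1
  · rfl

theorem mac_of_length_eq_zero (N : ℕ) {w : Equiv.Perm ℕ} (h : length w = 0) : mac N w = 1 := by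
  rw [mac, h, macAux]

/-- Every term of the descent sum has length `ℓ(w) - 1`, so the recursion in `macAux` closes up. In
this form `mac` is an eigenvector of `descSum` on each length, which is all that the Pieri rules
use. -/
theorem length_mul_mac {M : ℕ} (N : ℕ) {w : Equiv.Perm ℕ} (hw : Small M w) :
    (length w : ℚ) * mac N w = descSum 0 N (mac N) w := by
  rcases h : length w with _ | m
  · rw [Nat.cast_zero, zero_mul, descSum, eq_comm]
    refine Finset.sum_eq_zero fun j _ => ?_
    rw [descOp, if_neg, mul_zero]
    intro h1
    have := length_swap_mul hw h1
    omega
  · rw [mac, h, macAux]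
    push_cast
    have : (m + 1 : ℚ) ≠ 0 := by positivity
    field_simp
    unfold descSum
    refine Finset.sum_congr rfl fun j _ => ?_
    congr 1
    refine descOp_congr fun h1 => ?_
    have := length_swap_mul hw h1
    rw [mac, show length (Equiv.swap (0 + j) (0 + j + 1) * w) = m by omega]

theorem small_swap_mul {M k : ℕ} {w : Equiv.Perm ℕ} (hw : Small M w) (h : w⁻¹ (k + 1) < w⁻¹ k) :
    Small M (Equiv.swap k (k + 1) * w) := by
  have hk : k + 1 < M := by
    by_contra hc
    rw [hw.inv (k + 1) (by omega)] at h
    rcases Nat.lt_or_ge k M with h1 | h1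
    · have := hw.inv.lt h1
      omega
    · rw [hw.inv k h1] at h
      omega
  exact (small_swap (by omega) hk).mul hw

theorem descSum_C (l n : ℕ) (f : Equiv.Perm ℕ → ℚ) (w : Equiv.Perm ℕ) :
    descSum l n (fun u => C (f u)) w = C (descSum l n f w) := by
  unfold descSum descOp
  rw [map_sum]
  refine Finset.sum_congr rfl fun j _ => ?_
  split_ifs <;> simp

theorem coeff_descSum (l n d : ℕ) (F : Equiv.Perm ℕ → ℚ[X]) (w : Equiv.Perm ℕ) :
    (descSum l n F w).coeff d = descSum l n (fun u => (F u).coeff d) w := by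
  unfold descSum descOp
  rw [finsetSum_coeff]
  refine Finset.sum_congr rfl fun j _ => ?_
  rw [← C_eq_natCast, coeff_C_mul]
  split_ifs <;> simp

theorem descSum_mul_left {M : ℕ} {l n : ℕ} {r : ℚ} {F G : Equiv.Perm ℕ → ℚ} {w : Equiv.Perm ℕ}
    (hw : Small M w)
    (h : ∀ u, Small M u → length u < length w → F u = r * G u) :
    descSum l n F w = r * descSum l n G w := by
  unfold descSum
  rw [Finset.mul_sum]
  refine Finset.sum_congr rfl fun j _ => ?_
  rw [mul_left_comm]
  congr 1
  rw [← descOp_mul]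
  refine descOp_congr (F := F) (G := fun u => r * G u) fun h1 => h _ (small_swap_mul hw h1) ?_
  have := length_swap_mul hw h1
  omega

theorem coeff_X_mul_derivative (p : ℚ[X]) (d : ℕ) :
    (X * derivative p).coeff d = d * p.coeff d := by
  rcases d with _ | d
  · simp
  · rw [coeff_X_mul, coeff_derivative]
    push_cast
    ring

theorem sum_mac_of_length {Z : Finset (Equiv.Perm ℕ)} {N M ℓ : ℕ} (h : ∀ z ∈ Z, length z = ℓ)
    (hM : ∀ z ∈ Z, Small M z) :
    ∑ z ∈ Z, descSum 0 N (mac N) z = ℓ * ∑ z ∈ Z, mac N z := by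
  rw [Finset.mul_sum]
  refine Finset.sum_congr rfl fun z hz => ?_
  rw [← length_mul_mac N (hM z hz), h z hz]

/-- Write `P_d(w)` for the left side. The coefficient of `X^{d+1}` in `upGens_descSum` says `(ℓ(w) +
d + 1) P_{d+1}(w) = descSum P_{d+1}(w) + (i + d) P_d(w)`. By induction the descent sum is `ℓ(w)`
times the expected value, and `(i + d) C(i+d-1, d) = (d + 1) C(i+d, d+1)` finishes. -/
theorem coeff_upGens_mac {i N M : ℕ} (hi : 1 ≤ i) (hiM : i ≤ M) (d : ℕ) (hd : M + d ≤ N + 1)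
    {w : Equiv.Perm ℕ} (hw : Small M w) :
    (upGens i (N + 1) (N + 1) 0 (fun u => C (mac N u)) w).coeff d =
      (Nat.multichoose i d : ℚ) * mac N w := by
  induction hm : length w + d using Nat.strong_induction_on generalizing w d with
  | _ m ih =>
    subst hm
    obtain ⟨Z, hZ, hZ'⟩ := coeff_upGens (l := 0) (show 0 + (N + 1) = N + 1 by omega) hiM hd hw
    rcases d with _ | d
    · rw [upSet_zero, ← Finset.coe_singleton, Finset.coe_inj] at hZ
      rw [hZ', hZ]
      simp
    · have hZlen : ∀ z ∈ Z, length z = length w + (d + 1) ∧ Small (M + (d + 1)) z := by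
        intro z hz
        have hz' : z ∈ (Z : Set (Equiv.Perm ℕ)) := hz
        rw [hZ] at hz'
        obtain ⟨c, hc, -, rfl⟩ := hz'
        exact ⟨isPieriChain_length hw hc.1, isPieriChain_small hiM hw hc.1⟩
      have key := upGens_descSum (i := i) (l := 0) (n := N) (N := N + 1) (by omega) (by omega)
        (fun u => C (mac N u)) (fun u => derivative_C) (hw.mono (show M ≤ N + 1 by omega))
      have key' := congrArg (fun p => p.coeff (d + 1)) key
      simp only [coeff_add, Nat.cast_zero, zero_mul, add_zero] at key'
      rw [funext (descSum_C 0 N (mac N)), hZ', sum_mac_of_length (fun z hz => (hZlen z hz).1)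
        (fun z hz => (hZlen z hz).2), ← hZ', coeff_descSum,
        descSum_mul_left (r := (Nat.multichoose i (d + 1) : ℚ)) (G := mac N) hw,
        ← length_mul_mac N hw, upCorr, coeff_X_mul] at key'
      -- The `i` in the factor `i + d` counts all positions `< i`; the `d` comes from `X d/dX`.
      · have hcount : countGe i 0 w = C (i : ℚ) := by
          simp [countGe]
        -- The ends of chains of length `d` fix `N`, and `N` is not a position `< i`, so the
        -- boundary term at the largest label disappears.
        have hind : (upGens i (N + 1) (N + 1) 0 (fun u => ind ℚ[X] (fun p => p < i) (N + 1 - 1) u *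
            C (mac N u)) w).coeff d = 0 := by
          obtain ⟨Y, hY, hY'⟩ := coeff_upGens (l := 0) (show 0 + (N + 1) = N + 1 by omega) hiM
            (show M + d ≤ N + 1 by omega) hw
          have e : (fun u => ind ℚ[X] (fun p => p < i) (N + 1 - 1) u * C (mac N u)) =
              fun u => C (ind ℚ (fun p => p < i) (N + 1 - 1) u * mac N u) := by
            funext u
            unfold ind
            split_ifs <;> simp
          rw [e, hY']
          refine Finset.sum_eq_zero fun z hz => ?_
          have hz' : z ∈ (Y : Set (Equiv.Perm ℕ)) := hz
          rw [hY] at hz'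
          obtain ⟨c, hc, -, rfl⟩ := hz'
          have := (isPieriChain_small hiM hw hc.1).inv (N + 1 - 1) (by omega)
          rw [ind, if_neg, zero_mul]
          rw [this]
          omega
        rw [coeff_sub, coeff_add, coeff_add, hcount, coeff_C_mul, coeff_X_mul_derivative,
          ← C_eq_natCast, coeff_C_mul, ← C_eq_natCast, coeff_C_mul, hind,
          ih (length w + d) (by omega) d (by omega) hw rfl] at key'
        have hchoose : ((d + 1 : ℕ) : ℚ) * (Nat.multichoose i (d + 1) : ℚ) =
            ((i + d : ℕ) : ℚ) * (Nat.multichoose i d : ℚ) := by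
          have := Nat.add_one_mul_choose_eq (i + d - 1) d
          rw [show i + d - 1 + 1 = i + d by omega] at this
          rw [Nat.multichoose_eq, Nat.multichoose_eq, show i + (d + 1) - 1 = i + d by omega]
          exact_mod_cast by rw [this, mul_comm]
        have hpos : ((length w + (d + 1) : ℕ) : ℚ) ≠ 0 := by positivity
        apply mul_left_cancel₀ hpos
        push_cast at key' hchoose ⊢
        linear_combination key' - mac N w * hchoose
      · intro u hu hlt
        exact ih (length u + (d + 1)) (by omega) (d + 1) hd hu rfl

/-- The Pieri rule for Macdonald numbers. -/
theorem sum_mac_upSet {i N M d : ℕ} (hi : 1 ≤ i) (hiM : i ≤ M) (hd : M + d ≤ N + 1)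
    {w : Equiv.Perm ℕ} (hw : Small M w) : ∃ Z : Finset (Equiv.Perm ℕ),
      (Z : Set (Equiv.Perm ℕ)) = upSet i 0 d w ∧
      ∑ z ∈ Z, mac N z = (Nat.multichoose i d : ℚ) * mac N w := by
  obtain ⟨Z, hZ, hZ'⟩ := coeff_upGens (l := 0) (show 0 + (N + 1) = N + 1 by omega) hiM hd hw
  exact ⟨Z, hZ, by rw [← hZ', coeff_upGens_mac hi hiM d hd hw]⟩

end Macdonald

/-! ### The dual Pieri rule -/

section DualPieri

open Polynomial

open Classical in
/-- The sum of `F` over the covers of `w` that move the value `a` from a position `≥ i` to a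
position `< i`. -/
def downStep {R : Type*} [CommRing R] (i a : ℕ) (F : Equiv.Perm ℕ → R) (w : Equiv.Perm ℕ) : R :=
  if i ≤ w⁻¹ a then
    ∑ p ∈ Finset.range i, if Cov w p (w⁻¹ a) then F (w * Equiv.swap p (w⁻¹ a)) else 0 else 0

/-- The factor with label `a` of the generating function of `Y`-chains. -/
def downGen (i a : ℕ) (F : Equiv.Perm ℕ → ℚ[X]) (w : Equiv.Perm ℕ) : ℚ[X] :=
  F w + X * downStep i a F w

/-- The generating function of the `Y`-chains with labels smaller than the argument. -/
def downGens (i : ℕ) : ℕ → (Equiv.Perm ℕ → ℚ[X]) → Equiv.Perm ℕ → ℚ[X]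
  | 0, F => F
  | u + 1, F => downGen i u (downGens i u F)

theorem cov_orderDual_iff (w : Equiv.Perm ℕ) (p q : ℕ) : Cov (α := ℕᵒᵈ) w q p ↔ Cov w p q := by
  unfold Cov
  constructor
  · rintro ⟨h1, h2, h3⟩
    exact ⟨h1, h2, fun r r1 r2 r3 r4 => h3 r r2 r1 r4 r3⟩
  · rintro ⟨h1, h2, h3⟩
    exact ⟨h1, h2, fun r r1 r2 r3 r4 => h3 r r2 r1 r4 r3⟩

/-- Reversing the order of both positions and values preserves covers and turns `Y`-steps into
`X`-steps. The commutation relations of the dual case are thus instances of the earlier ones. -/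
theorem downStep_eq_stepOp {R : Type*} [CommRing R] (i a : ℕ) (F : Equiv.Perm ℕ → R)
    (w : Equiv.Perm ℕ) : downStep i a F w =
      stepOp (α := ℕᵒᵈ) (fun q : ℕ => i ≤ q) (Finset.range i) a F w := by
  classical
  unfold downStep stepOp
  by_cases h : i ≤ w⁻¹ a
  · refine (if_pos h).trans (Eq.trans ?_ (if_pos h).symm)
    refine Finset.sum_congr rfl fun p _ => ?_
    refine if_congr (cov_orderDual_iff w p _).symm ?_ rfl
    rw [Equiv.swap_comm]
    rfl
  · exact (if_neg h).trans (if_neg h).symm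

theorem downGen_eq_genOp (i a : ℕ) (F : Equiv.Perm ℕ → ℚ[X]) (w : Equiv.Perm ℕ) :
    downGen i a F w = genOp (α := ℕᵒᵈ) (fun q : ℕ => i ≤ q) (Finset.range i) X a F w := by
  rw [downGen, downStep_eq_stepOp]
  rfl

theorem descOp_eq_orderDual {R : Type*} [CommRing R] (k : ℕ) (F : Equiv.Perm ℕ → R) :
    descOp k (k + 1) F = descOp (α := ℕᵒᵈ) (k + 1 : ℕ) (k : ℕ) F := by
  funext w
  unfold descOp
  refine if_congr Iff.rfl ?_ rfl
  rw [Equiv.swap_comm]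
  rfl

theorem downGen_add (i a : ℕ) (F G : Equiv.Perm ℕ → ℚ[X]) (w : Equiv.Perm ℕ) :
    downGen i a (fun u => F u + G u) w = downGen i a F w + downGen i a G w := by
  simp only [downGen_eq_genOp]
  exact genOp_add (α := ℕᵒᵈ) _ _ _ _ _ _ _

theorem downGen_mul (i a : ℕ) (r : ℚ[X]) (F : Equiv.Perm ℕ → ℚ[X]) (w : Equiv.Perm ℕ) :
    downGen i a (fun u => r * F u) w = r * downGen i a F w := by
  simp only [downGen_eq_genOp]
  exact genOp_mul (α := ℕᵒᵈ) _ _ _ _ _ _ _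

theorem nat_adj_dual (k : ℕ) : ∀ v : ℕᵒᵈ, v ≤ OrderDual.toDual (k + 1) ∨
    OrderDual.toDual k ≤ v := fun v => by
  rcases nat_adj k (OrderDual.ofDual v) with h | h
  · exact Or.inr h
  · exact Or.inl h

theorem downGen_descSum {i n a : ℕ} (h : n < a) (F : Equiv.Perm ℕ → ℚ[X]) (w : Equiv.Perm ℕ) :
    downGen i a (descSum 0 n F) w = descSum 0 n (downGen i a F) w := by
  have e : descSum 0 n F = fun u => ∑ j ∈ Finset.range n, ((0 + j + 1 : ℕ) : ℚ[X]) *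
    descOp (0 + j) (0 + j + 1) F u := rfl
  rw [e, downGen_eq_genOp]
  refine (genOp_sum (α := ℕᵒᵈ) _ _ _ _ _ _ _).trans ?_
  refine Finset.sum_congr rfl fun j hj => ?_
  rw [Finset.mem_range] at hj
  refine (genOp_mul (α := ℕᵒᵈ) _ _ _ _ _ _ _).trans ?_
  congr 1
  rw [descOp_eq_orderDual, descOp_eq_orderDual]
  have := genOp_descOp_of_ne (α := ℕᵒᵈ) (I := fun q : ℕ => i ≤ q) (S := Finset.range i)
    (k := OrderDual.toDual (0 + j + 1)) (k' := OrderDual.toDual (0 + j))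
    (show 0 + j < 0 + j + 1 by omega) (nat_adj_dual _) (a := OrderDual.toDual a)
    (show a ≠ 0 + j + 1 by omega) (show a ≠ 0 + j by omega) X F w
  refine this.trans ?_
  refine congrArg (fun G => descOp (α := ℕᵒᵈ) _ _ G w) (funext fun u => ?_)
  exact (downGen_eq_genOp i a F u).symm

theorem downGens_add (i n : ℕ) (F G : Equiv.Perm ℕ → ℚ[X]) (w : Equiv.Perm ℕ) :
    downGens i n (fun u => F u + G u) w = downGens i n F w + downGens i n G w := by
  induction n generalizing w with
  | zero => rfl
  | succ n ih =>
    simp only [downGens]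
    rw [← downGen_add]
    exact congrArg (fun H => downGen i n H w) (funext ih)

theorem downGens_mul (i n : ℕ) (r : ℚ[X]) (F : Equiv.Perm ℕ → ℚ[X]) (w : Equiv.Perm ℕ) :
    downGens i n (fun u => r * F u) w = r * downGens i n F w := by
  induction n generalizing w with
  | zero => rfl
  | succ n ih =>
    simp only [downGens]
    rw [← downGen_mul]
    exact congrArg (fun H => downGen i n H w) (funext ih)

theorem downGen_descOp {i k a : ℕ} (h1 : a ≠ k) (h2 : a ≠ k + 1) (F : Equiv.Perm ℕ → ℚ[X])
    (w : Equiv.Perm ℕ) :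
    downGen i a (descOp k (k + 1) F) w = descOp k (k + 1) (downGen i a F) w := by
  rw [downGen_eq_genOp, descOp_eq_orderDual, descOp_eq_orderDual]
  have := genOp_descOp_of_ne (α := ℕᵒᵈ) (I := fun q : ℕ => i ≤ q) (S := Finset.range i)
    (k := OrderDual.toDual (k + 1)) (k' := OrderDual.toDual k)
    (show k < k + 1 by omega) (nat_adj_dual _) (a := OrderDual.toDual a)
    h2 h1 X F w
  refine this.trans ?_
  refine congrArg (fun G => descOp (α := ℕᵒᵈ) _ _ G w) (funext fun u => ?_)
  exact (downGen_eq_genOp i a F u).symm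

theorem downGens_descOp {i n k : ℕ} (h : n ≤ k) (F : Equiv.Perm ℕ → ℚ[X]) :
    downGens i n (descOp k (k + 1) F) = descOp k (k + 1) (downGens i n F) := by
  induction n with
  | zero => rfl
  | succ n ih =>
    funext w
    simp only [downGens]
    rw [ih (by omega)]
    exact downGen_descOp (by omega) (by omega) _ _

/-- The indicator of the permutations with the value `a` at a position `< i`. -/
abbrev lowInd (i a : ℕ) (w : Equiv.Perm ℕ) : ℚ[X] := ind ℚ[X] (fun p => p < i) a w

theorem lowInd_eq (i a : ℕ) (w : Equiv.Perm ℕ) :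
    ind ℚ[X] (α := ℕᵒᵈ) (fun q : ℕ => i ≤ q) a w - 1 = - lowInd i a w := by
  unfold lowInd ind
  by_cases h : w⁻¹ a < i
  · rw [if_pos h, if_neg]
    · ring
    · exact not_le.mpr h
  · rw [if_neg h, if_pos]
    · ring
    · exact not_lt.mp h

theorem downGen_downGen_descOp (i k : ℕ) (F : Equiv.Perm ℕ → ℚ[X]) (w : Equiv.Perm ℕ) :
    downGen i (k + 1) (downGen i k (descOp k (k + 1) F)) w =
      descOp k (k + 1) (downGen i (k + 1) (downGen i k F)) w -
        X * lowInd i (k + 1) w * downGen i k F w +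
        downGen i (k + 1) (fun u => X * lowInd i k u * F u) w := by
  have hpos : ∀ a : ℕ, i ≤ w⁻¹ a ∨ w⁻¹ a ∈ Finset.range i := fun a => by
    rw [Finset.mem_range]
    omega
  have h := genOp_genOp_descOp (α := ℕᵒᵈ) (I := fun q : ℕ => i ≤ q) (S := Finset.range i)
    (k := OrderDual.toDual (k + 1)) (k' := OrderDual.toDual k) (show k < k + 1 by omega)
    (nat_adj_dual _) (fun p q h1 h2 => lt_of_lt_of_le (α := ℕ) (not_le.mp h2) h1)
    (fun q hq => not_le.mpr (Finset.mem_range.mp hq)) X F (w := w) (hpos _) (hpos _)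
  have e : ∀ (a : ℕ) (G : Equiv.Perm ℕ → ℚ[X]), downGen i a G =
      genOp (α := ℕᵒᵈ) (fun q : ℕ => i ≤ q) (Finset.range i) X a G :=
    fun a G => funext (downGen_eq_genOp i a G)
  have e2 : downGen i (k + 1) (fun u => X * lowInd i k u * F u) w = -genOp (α := ℕᵒᵈ)
      (fun q : ℕ => i ≤ q) (Finset.range i) X (k + 1 : ℕ) (fun u : Equiv.Perm ℕ =>
        X * (ind ℚ[X] (α := ℕᵒᵈ) (fun q : ℕ => i ≤ q) k u - 1) * F u) w := by
    have e4 : (fun u : Equiv.Perm ℕ => X * lowInd i k u * F u) = fun u =>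
        (-1) * (X * (ind ℚ[X] (α := ℕᵒᵈ) (fun q : ℕ => i ≤ q) k u - 1) * F u) := by
      funext u
      rw [lowInd_eq]
      ring
    exact (congrArg (fun G => downGen i (k + 1) G w) e4).trans
      ((downGen_mul _ _ _ _ _).trans ((neg_one_mul _).trans
        (congrArg Neg.neg (downGen_eq_genOp _ _ _ _))))
  have e3 : X * lowInd i (k + 1) w * downGen i k F w =
      - (X * (ind ℚ[X] (α := ℕᵒᵈ) (fun q : ℕ => i ≤ q) (k + 1 : ℕ) w - 1) *
        genOp (α := ℕᵒᵈ) (fun q : ℕ => i ≤ q) (Finset.range i) X k F w) := by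
    have := downGen_eq_genOp i k F w
    rw [lowInd_eq, ← this]
    ring
  rw [e2, e3, sub_neg_eq_add, ← sub_eq_add_neg]
  have eL : downGen i (k + 1) (downGen i k (descOp k (k + 1) F)) =
      genOp (α := ℕᵒᵈ) (fun q : ℕ => i ≤ q) (Finset.range i) X (k + 1 : ℕ)
        (genOp (α := ℕᵒᵈ) (fun q : ℕ => i ≤ q) (Finset.range i) X k
          (descOp (α := ℕᵒᵈ) (k + 1 : ℕ) (k : ℕ) F)) := by
    rw [descOp_eq_orderDual]
    exact (e _ _).trans (congrArg _ (e _ _))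
  have eR : descOp k (k + 1) (downGen i (k + 1) (downGen i k F)) =
      descOp (α := ℕᵒᵈ) (k + 1 : ℕ) (k : ℕ)
        (genOp (α := ℕᵒᵈ) (fun q : ℕ => i ≤ q) (Finset.range i) X (k + 1 : ℕ)
          (genOp (α := ℕᵒᵈ) (fun q : ℕ => i ≤ q) (Finset.range i) X k F)) := by
    rw [descOp_eq_orderDual]
    exact congrArg _ ((e _ _).trans (congrArg _ (e _ _)))
  rw [eL, eR]
  exact h

/-- The number of positions `p < i` with value smaller than `l`. -/
def countLt (i l : ℕ) (w : Equiv.Perm ℕ) : ℚ[X] := ∑ p ∈ Finset.range i, if w p < l then 1 else 0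

theorem countLt_succ (i l : ℕ) (w : Equiv.Perm ℕ) :
    countLt i (l + 1) w = countLt i l w + lowInd i l w := by
  rw [lowInd, ← sum_range_eq_ind, countLt, countLt, ← Finset.sum_add_distrib]
  refine Finset.sum_congr rfl fun p _ => ?_
  split_ifs <;> first | omega | simp

/-- A position `< i` gives up a value smaller than `l` and receives `l`. The sign is opposite to the
one for `countGe`, and so is the sign of the derivative in `downCorr`. -/
theorem countLt_mul_swap {i l p : ℕ} {w : Equiv.Perm ℕ} (hp : p < i) (hI : i ≤ w⁻¹ l)
    (hc : Cov w p (w⁻¹ l)) :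
    countLt i l (w * Equiv.swap p (w⁻¹ l)) = countLt i l w - 1 := by
  have hp' : p ∈ Finset.range i := Finset.mem_range.mpr hp
  unfold countLt
  rw [← Finset.add_sum_erase _ _ hp', ← Finset.add_sum_erase _ _ hp']
  have h2 := hc.2.1
  rw [perm_apply_inv] at h2
  rw [if_neg, if_pos h2]
  · rw [zero_add, add_sub_cancel_left]
    refine Finset.sum_congr rfl fun p hp => ?_
    rw [Finset.mem_erase, Finset.mem_range] at hp
    rw [Equiv.Perm.mul_apply, Equiv.swap_apply_of_ne_of_ne hp.1 (by omega)]
  · rw [Equiv.Perm.mul_apply, Equiv.swap_apply_left, perm_apply_inv]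
    omega

theorem downStep_congr {R : Type*} [CommRing R] {i a : ℕ} {F G : Equiv.Perm ℕ → R}
    {w : Equiv.Perm ℕ} (h : ∀ p < i, i ≤ w⁻¹ a → Cov w p (w⁻¹ a) →
      F (w * Equiv.swap p (w⁻¹ a)) = G (w * Equiv.swap p (w⁻¹ a))) :
    downStep i a F w = downStep i a G w := by
  unfold downStep
  split_ifs with h1
  · refine Finset.sum_congr rfl fun q hq => ?_
    split_ifs with h2
    · exact h q (Finset.mem_range.mp hq) h1 h2
    · rfl
  · rfl

theorem downStep_mul (i a : ℕ) (r : ℚ[X]) (F : Equiv.Perm ℕ → ℚ[X]) (w : Equiv.Perm ℕ) :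
    downStep i a (fun u => r * F u) w = r * downStep i a F w := by
  simp only [downStep_eq_stepOp]
  exact stepOp_mul (α := ℕᵒᵈ) _ _ _ _ _ _

theorem downStep_derivative (i a : ℕ) (F : Equiv.Perm ℕ → ℚ[X]) (w : Equiv.Perm ℕ) :
    derivative (downStep i a F w) = downStep i a (fun u => derivative (F u)) w := by
  simp only [downStep_eq_stepOp]
  exact stepOp_derivative (α := ℕᵒᵈ) _ _ _ _ _

theorem lowInd_mul_downStep (i a : ℕ) (F : Equiv.Perm ℕ → ℚ[X]) (w : Equiv.Perm ℕ) :
    lowInd i a w * downStep i a F w = 0 := by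
  unfold lowInd ind downStep
  by_cases h : w⁻¹ a < i
  · rw [if_neg (not_le.mpr h), mul_zero]
  · rw [if_neg h, zero_mul]

/-- The correction term in the commutator of `descSum` and `downGens`. -/
def downCorr (i n : ℕ) (F : Equiv.Perm ℕ → ℚ[X]) (w : Equiv.Perm ℕ) : ℚ[X] :=
  X * (countLt i n w * downGens i n F w - X * derivative (downGens i n F w))

theorem downGen_downCorr (i n : ℕ) (F : Equiv.Perm ℕ → ℚ[X]) (w : Equiv.Perm ℕ) :
    downGen i n (downCorr i n F) w + X * lowInd i n w * downGens i n F w =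
      downCorr i (n + 1) F w := by
  set Q := downGens i n F with hQ
  have e : downCorr i n F = fun u => X * (countLt i n u * Q u +
      (-1) * (X * derivative (Q u))) := by
    funext u
    simp only [downCorr, ← hQ]
    ring
  have e1 : downStep i n (fun u => countLt i n u * Q u) w =
      (countLt i n w - 1) * downStep i n Q w := by
    rw [← downStep_mul]
    refine downStep_congr fun p hp h1 h2 => ?_
    rw [countLt_mul_swap hp h1 h2]
  have e2 : derivative (downGens i (n + 1) F w) = derivative (Q w) +
      (downStep i n Q w + X * downStep i n (fun u => derivative (Q u)) w) := by
    simp only [downGens, ← hQ, downGen]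
    rw [derivative_add, derivative_mul, derivative_X, one_mul, downStep_derivative]
  have e3 := lowInd_mul_downStep i n Q w
  rw [e, downCorr, e2]
  simp only [downGens, ← hQ]
  rw [downGen_mul, downGen_add, downGen_mul, downGen_mul]
  simp only [downGen]
  rw [e1, countLt_succ i n w]
  linear_combination (-X ^ 2) * e3

/-- Dual of `upGens_descSum`, with labels added from the smallest upwards. The telescoping sum now
has its uncancelled end at the largest label `n`. -/
theorem downGens_descSum (i n : ℕ) (F : Equiv.Perm ℕ → ℚ[X])
    (hF : ∀ u, derivative (F u) = 0) (w : Equiv.Perm ℕ) :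
    downGens i (n + 1) (descSum 0 n F) w = descSum 0 n (downGens i (n + 1) F) w +
      downCorr i (n + 1) F w - ((n + 1 : ℕ) : ℚ[X]) * (X * lowInd i n w * downGens i n F w) := by
  induction n generalizing w with
  | zero =>
    -- The value `0` is never the larger value of a cover.
    have hstep : ∀ G : Equiv.Perm ℕ → ℚ[X], downStep i 0 G w = 0 := by
      intro G
      unfold downStep
      split_ifs with h
      · refine Finset.sum_eq_zero fun q hq => if_neg fun hc => ?_
        have h1 := hc.2.1
        rw [perm_apply_inv] at h1
        omega
      · rfl
    have hcount : countLt i 1 w = lowInd i 0 w := by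
      rw [countLt_succ, countLt]
      simp
    simp only [downGens, descSum, Finset.range_zero, Finset.sum_empty, downCorr, downGen, hcount,
      hstep, mul_zero, add_zero, hF]
    push_cast
    ring
  | succ n ih =>
    set Q := downGens i (n + 1) F with hQ
    have hdesc : ∀ G : Equiv.Perm ℕ → ℚ[X], descSum 0 (n + 1) G = fun u =>
        descSum 0 n G u + ((n + 1 : ℕ) : ℚ[X]) * descOp n (n + 1) G u := by
      intro G
      funext u
      rw [descSum, Finset.sum_range_succ, descSum]
      simp only [zero_add]
    have e1 : downGens i (n + 2) (descOp n (n + 1) F) w =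
        descOp n (n + 1) (downGens i (n + 2) F) w -
        X * lowInd i (n + 1) w * Q w +
        downGen i (n + 1) (fun u => X * lowInd i n u * downGens i n F u) w := by
      have := downGen_downGen_descOp i n (downGens i n F) w
      rw [downGens, downGens, downGens_descOp le_rfl]
      exact this
    have e2 : downGens i (n + 2) (descSum 0 n F) w =
        descSum 0 n (downGens i (n + 2) F) w + downGen i (n + 1) (downCorr i (n + 1) F) w -
        ((n + 1 : ℕ) : ℚ[X]) * downGen i (n + 1)
          (fun u => X * lowInd i n u * downGens i n F u) w := by
      have e3 : downGens i (n + 1) (descSum 0 n F) =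
          (fun u => (descSum 0 n Q u + downCorr i (n + 1) F u) +
            (-((n + 1 : ℕ) : ℚ[X])) *
              (X * lowInd i n u * downGens i n F u)) := by
        funext u
        rw [ih u]
        ring
      rw [downGens, e3, downGen_add, downGen_mul, downGen_add, downGen_descSum (by omega)]
      rw [neg_mul, ← sub_eq_add_neg]
      rfl
    rw [hdesc F, downGens_add, downGens_mul, e1, e2, ← downGen_downCorr, hdesc]
    push_cast
    ring

/-- The set of the permutations reached by `Y`-chains of length `d` with labels less than `l`. -/
def downSet (i l d : ℕ) (w : Equiv.Perm ℕ) : Set (Equiv.Perm ℕ) :=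
  {z | ∃ c : Fin d → ℕ × ℕ, IsYChain w i c ∧ (∀ j : Fin d, chainPerm w c j (c j).2 < l) ∧
    w * chainProd c = z}

theorem downSet_zero (i l : ℕ) (w : Equiv.Perm ℕ) : downSet i l 0 w = {w} := by
  ext z
  rw [downSet, Set.mem_ofPred_eq, Set.mem_singleton_iff]
  constructor
  · rintro ⟨c, -, -, rfl⟩
    rw [chainProd_zero, mul_one]
  · rintro rfl
    refine ⟨Fin.elim0, ⟨fun j => j.elim0, fun j => j.elim0⟩, fun j => j.elim0, ?_⟩
    rw [chainProd_zero, mul_one]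

theorem downSet_succ {i l d N : ℕ} {w : Equiv.Perm ℕ} (hN : Small N w) :
    downSet i (l + 1) (d + 1) w = downSet i l (d + 1) w ∪
      ⋃ p ∈ {p | p < i ∧ i ≤ w⁻¹ l ∧ Cov w p (w⁻¹ l)},
        downSet i l d (w * Equiv.swap p (w⁻¹ l)) := by
  ext z
  simp only [downSet, Set.mem_union, Set.mem_iUnion, Set.mem_ofPred_eq, exists_prop]
  constructor
  · rintro ⟨c, hc, hl, rfl⟩
    obtain ⟨h1, h2, h3⟩ := (isYChain_succ hN).mp hc
    have hl0 := hl 0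
    simp only [Fin.val_zero, chainPerm_zero] at hl0
    rcases Nat.lt_or_ge (w (c 0).2) l with h | h
    · refine Or.inl ⟨c, hc, fun j => ?_, rfl⟩
      induction j using Fin.cases with
      | zero =>
        rw [Fin.val_zero, chainPerm_zero]
        exact h
      | succ j =>
        rw [Fin.val_succ, chainPerm_succ]
        have := h3 j
        simp only [Fin.tail] at this ⊢
        omega
    · have hp : w⁻¹ l = (c 0).2 := by
        rw [Equiv.Perm.inv_eq_iff_eq]
        omega
      refine Or.inr ⟨(c 0).1, ?_, Fin.tail c, ?_, fun j => ?_, ?_⟩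
      · rw [hp]
        exact h1
      · rw [hp]
        exact h2
      · rw [hp]
        have := h3 j
        omega
      · rw [hp, chainProd_succ, mul_assoc]
  · rintro (⟨c, hc, hl, rfl⟩ | ⟨p, hp, c, hc, hl, rfl⟩)
    · exact ⟨c, hc, fun j => (hl j).trans (Nat.lt_succ_self l), rfl⟩
    · refine ⟨Fin.cons (p, w⁻¹ l) c, (isYChain_succ hN).mpr ⟨?_, ?_, fun j => ?_⟩, fun j => ?_, ?_⟩
      · rw [Fin.cons_zero]
        exact hp
      · simpa only [Fin.cons_zero, Fin.tail_cons] using hc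
      · simp only [Fin.cons_zero, Fin.tail_cons, perm_apply_inv]
        exact hl j
      · induction j using Fin.cases with
        | zero =>
          simp only [Fin.val_zero, chainPerm_zero, Fin.cons_zero, perm_apply_inv]
          omega
        | succ j =>
          rw [Fin.val_succ, chainPerm_succ]
          simp only [Fin.cons_zero, Fin.tail_cons, Fin.cons_succ]
          exact (hl j).trans (Nat.lt_succ_self l)
      · rw [chainProd_succ, Fin.cons_zero, Fin.tail_cons, mul_assoc]

theorem downSet_inv {i l d N : ℕ} {w z : Equiv.Perm ℕ} (hN : Small N w) (hz : z ∈ downSet i l d w) :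
    z⁻¹ l = w⁻¹ l := by
  obtain ⟨c, hc, hl, rfl⟩ := hz
  exact isYChain_inv_gt hN hc fun j => hl j

/-- As for `coeff_upGens`, the position of `l` in `z` recovers the step with label `l`. No room for
growth is needed, since the sources `p` already lie in the finite set of positions `< i`. -/
theorem coeff_downGens {i l d M : ℕ} {w : Equiv.Perm ℕ} (hw : Small M w) :
    ∃ Z : Finset (Equiv.Perm ℕ), (Z : Set (Equiv.Perm ℕ)) = downSet i l d w ∧
      ∀ f : Equiv.Perm ℕ → ℚ,
        (downGens i l (fun u => C (f u)) w).coeff d = ∑ z ∈ Z, f z := by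
  classical
  induction l generalizing d M w with
  | zero =>
    rcases d with _ | d
    · refine ⟨{w}, by rw [downSet_zero, Finset.coe_singleton], fun f => ?_⟩
      simp [downGens]
    · refine ⟨∅, ?_, fun f => by simp [downGens]⟩
      rw [Finset.coe_empty, eq_comm, Set.eq_empty_iff_forall_notMem]
      rintro z ⟨c, hc, hlab, -⟩
      exact Nat.not_lt_zero _ (hlab 0)
  | succ l ih =>
    rcases d with _ | d
    · refine ⟨{w}, by rw [downSet_zero, Finset.coe_singleton], fun f => ?_⟩
      obtain ⟨Z, hZ, hZ'⟩ := ih (d := 0) hw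
      rw [downSet_zero, ← Finset.coe_singleton, Finset.coe_inj] at hZ
      rw [downGens, downGen, coeff_add, coeff_X_mul_zero, add_zero, hZ', hZ]
    · obtain ⟨Z, hZ, hZ'⟩ := ih (d := d + 1) hw
      have hsmall : ∀ p, Cov w p (w⁻¹ l) → Small (M + w⁻¹ l + 1) (w * Equiv.swap p (w⁻¹ l)) := by
        intro p h
        have := h.1
        exact (hw.mono (by omega)).mul (small_swap (by omega) (by omega))
      choose Zp hZp using fun p : {p // Cov w p (w⁻¹ l)} => ih (d := d) (hsmall p p.2)
      set T := ((Finset.range i).filter fun p => i ≤ w⁻¹ l ∧ Cov w p (w⁻¹ l)).attach with hT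
      have hTm : ∀ p, p ∈ (Finset.range i).filter (fun p => i ≤ w⁻¹ l ∧ Cov w p (w⁻¹ l)) ↔
          p < i ∧ i ≤ w⁻¹ l ∧ Cov w p (w⁻¹ l) := by
        intro p
        rw [Finset.mem_filter, Finset.mem_range]
      let Zq : ℕ → Finset (Equiv.Perm ℕ) := fun p =>
        if h : Cov w p (w⁻¹ l) then Zp ⟨p, h⟩ else ∅
      have hZq : ∀ p, Cov w p (w⁻¹ l) →
          ((Zq p : Set (Equiv.Perm ℕ)) = downSet i l d (w * Equiv.swap p (w⁻¹ l)) ∧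
          ∀ f : Equiv.Perm ℕ → ℚ,
            (downGens i l (fun u => C (f u)) (w * Equiv.swap p (w⁻¹ l))).coeff d =
              ∑ z ∈ Zq p, f z) := by
        intro p h
        simp only [Zq, dif_pos h]
        exact hZp ⟨p, h⟩
      clear hT T
      set T := (Finset.range i).filter fun p => i ≤ w⁻¹ l ∧ Cov w p (w⁻¹ l) with hT
      have hZinv : ∀ p ∈ T, ∀ z ∈ Zq p, z⁻¹ l = p := by
        intro p hp z hz
        obtain ⟨h1, h2, h3⟩ := (hTm p).mp hp
        have hz' : z ∈ (Zq p : Set (Equiv.Perm ℕ)) := hz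
        rw [(hZq p h3).1] at hz'
        rw [downSet_inv (hsmall p h3) hz', mul_swap_inv_apply, Equiv.swap_apply_right]
      refine ⟨Z ∪ T.biUnion Zq, ?_, fun f => ?_⟩
      · rw [downSet_succ hw, Finset.coe_union, hZ, Finset.coe_biUnion]
        congr 1
        refine Set.iUnion_congr fun q => ?_
        refine Set.iUnion_congr_Prop ?_ fun h => ?_
        · rw [Finset.mem_coe, hTm, Set.mem_ofPred_eq]
        · obtain ⟨h1, h2, h3⟩ := h
          exact (hZq q h3).1
      · rw [downGens, downGen, coeff_add, coeff_X_mul, hZ', Finset.sum_union, Finset.sum_biUnion]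
        · congr 1
          unfold downStep
          by_cases hp : i ≤ w⁻¹ l
          · rw [if_pos hp, finsetSum_coeff, hT, Finset.sum_filter]
            refine Finset.sum_congr rfl fun q hq => ?_
            simp only [hp, true_and]
            split_ifs with h
            · exact (hZq q h).2 f
            · rw [coeff_zero]
          · rw [if_neg hp, coeff_zero, hT]
            simp only [hp, false_and, Finset.filter_false, Finset.sum_empty]
        · intro q hq q' hq' hne
          refine Finset.disjoint_left.mpr fun z hz hz' => hne ?_
          rw [← hZinv q hq z hz, hZinv q' hq' z hz']
        · refine Finset.disjoint_left.mpr fun z hz hz' => ?_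
          obtain ⟨q, hq, hz'⟩ := Finset.mem_biUnion.mp hz'
          have h1 := hZinv q hq z hz'
          have h2 : z ∈ (Z : Set (Equiv.Perm ℕ)) := hz
          rw [hZ] at h2
          rw [downSet_inv hw h2] at h1
          obtain ⟨h3, h4, -⟩ := (hTm q).mp hq
          omega

/-- The recursion is now `(ℓ(w) + d + 1) P_{d+1}(w) = descSum P_{d+1}(w) + (i - d) P_d(w)`, solved
by `(d + 1) C(i, d+1) = (i - d) C(i, d)`. -/
theorem coeff_downGens_mac {i N M : ℕ} (hiM : i ≤ M) (hN : M ≤ N) (d : ℕ)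
    {w : Equiv.Perm ℕ} (hw : Small M w) :
    (downGens i (N + 1) (fun u => C (mac N u)) w).coeff d = (Nat.choose i d : ℚ) * mac N w := by
  induction hm : length w + d using Nat.strong_induction_on generalizing w d with
  | _ m ih =>
    subst hm
    obtain ⟨Z, hZ, hZ'⟩ := coeff_downGens (i := i) (l := N + 1) (d := d) hw
    rcases d with _ | d
    · rw [downSet_zero, ← Finset.coe_singleton, Finset.coe_inj] at hZ
      rw [hZ', hZ]
      simp
    · have hZlen : ∀ z ∈ Z, length z = length w + (d + 1) ∧ Small (M + (d + 1)) z := by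
        intro z hz
        have hz' : z ∈ (Z : Set (Equiv.Perm ℕ)) := hz
        rw [hZ] at hz'
        obtain ⟨c, hc, -, rfl⟩ := hz'
        exact ⟨isPieriChain_length hw hc.1, isPieriChain_small hiM hw hc.1⟩
      have key := downGens_descSum i N (fun u => C (mac N u)) (fun u => derivative_C) w
      -- The value `N` is fixed by `w` and `N ≥ i`; this removes the boundary term.
      have hlow : lowInd i N w = 0 := by
        rw [lowInd, ind, if_neg]
        rw [hw.inv N hN]
        omega
      rw [hlow, mul_zero, zero_mul, mul_zero, sub_zero] at key
      have key' := congrArg (fun p => p.coeff (d + 1)) key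
      simp only [coeff_add] at key'
      rw [funext (descSum_C 0 N (mac N)), hZ', sum_mac_of_length (fun z hz => (hZlen z hz).1)
        (fun z hz => (hZlen z hz).2), ← hZ', coeff_descSum,
        descSum_mul_left (r := (Nat.choose i (d + 1) : ℚ)) (G := mac N) hw,
        ← length_mul_mac N hw, downCorr, coeff_X_mul] at key'
      · have hcount : countLt i (N + 1) w = C (i : ℚ) := by
          rw [countLt, Finset.sum_congr rfl fun p hp => if_pos ?_]
          · simp
          · have := hw.lt (show p < M by have := Finset.mem_range.mp hp; omega)
            omega
        rw [coeff_sub, hcount, coeff_C_mul, coeff_X_mul_derivative,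
          ih (length w + d) (by omega) d hw rfl] at key'
        have hchoose : ((d + 1 : ℕ) : ℚ) * (Nat.choose i (d + 1) : ℚ) =
            ((i : ℚ) - d) * (Nat.choose i d : ℚ) := by
          have := Nat.choose_succ_right_eq i d
          rcases Nat.lt_or_ge i d with h | h
          · rw [Nat.choose_eq_zero_of_lt h, Nat.choose_eq_zero_of_lt (by omega)]
            simp
          · rw [← Nat.cast_sub h]
            exact_mod_cast by rw [mul_comm, this, mul_comm]
        have hpos : ((length w + (d + 1) : ℕ) : ℚ) ≠ 0 := by positivity
        apply mul_left_cancel₀ hpos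
        push_cast at key' hchoose ⊢
        linear_combination key' - mac N w * hchoose
      · intro u hu hlt
        exact ih (length u + (d + 1)) (by omega) (d + 1) hu rfl

/-- The dual Pieri rule for Macdonald numbers. -/
theorem sum_mac_downSet {i N M d : ℕ} (hiM : i ≤ M) (hN : M ≤ N)
    {w : Equiv.Perm ℕ} (hw : Small M w) : ∃ Z : Finset (Equiv.Perm ℕ),
      (Z : Set (Equiv.Perm ℕ)) = downSet i (N + 1) d w ∧
      ∑ z ∈ Z, mac N z = (Nat.choose i d : ℚ) * mac N w := by
  obtain ⟨Z, hZ, hZ'⟩ := coeff_downGens (i := i) (l := N + 1) (d := d) hw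
  exact ⟨Z, hZ, by rw [← hZ', coeff_downGens_mac hiM hN d hw]⟩

end DualPieri

end KP
end

noncomputable section
namespace KP

/-! ### Monomials in an exterior algebra -/

section Monomials

variable {K X : Type*} [Field K]

variable (K) in
/-- The generator of the exterior algebra attached to a basis vector. -/
def gen (x : X) : ExteriorAlgebra K (X →₀ K) := ExteriorAlgebra.ι K (Finsupp.single x 1)

theorem gen_mul_self (x : X) : gen K x * gen K x = 0 := ExteriorAlgebra.ι_sq_zero _

theorem gen_mul_comm (x y : X) : gen K x * gen K y = -(gen K y * gen K x) :=
  eq_neg_of_add_eq_zero_left (ExteriorAlgebra.ι_add_mul_swap _ _)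

variable (K) in
/-- The product of the generators in a list. -/
def genProd (l : List X) : ExteriorAlgebra K (X →₀ K) := (l.map (gen K)).prod

theorem genProd_cons (x : X) (l : List X) : genProd K (x :: l) = gen K x * genProd K l := by
  simp [genProd]

theorem genProd_append (l l' : List X) : genProd K (l ++ l') = genProd K l * genProd K l' := by
  simp [genProd]

theorem genProd_perm {l l' : List X} (h : l.Perm l') :
    ∃ c : K, c ≠ 0 ∧ genProd K l' = c • genProd K l := by
  induction h with
  | nil => exact ⟨1, one_ne_zero, (one_smul _ _).symm⟩
  | cons x _ ih =>
    obtain ⟨c, hc, e⟩ := ih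
    exact ⟨c, hc, by rw [genProd_cons, genProd_cons, e, mul_smul_comm]⟩
  | swap x y l =>
    refine ⟨-1, neg_ne_zero.mpr one_ne_zero, ?_⟩
    simp only [genProd_cons]
    rw [← mul_assoc, ← mul_assoc, gen_mul_comm x y, neg_mul, neg_one_smul]
  | trans _ _ ih ih' =>
    obtain ⟨c, hc, e⟩ := ih
    obtain ⟨c', hc', e'⟩ := ih'
    exact ⟨c' * c, mul_ne_zero hc' hc, by rw [e', e, smul_smul]⟩

theorem gen_mul_genProd {x : X} {l : List X} (h : x ∈ l) : gen K x * genProd K l = 0 := by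
  induction l with
  | nil => simp at h
  | cons y l ih =>
    rw [genProd_cons, ← mul_assoc]
    rcases List.mem_cons.mp h with rfl | h
    · rw [gen_mul_self, zero_mul]
    · rw [gen_mul_comm, neg_mul, mul_assoc, ih h, mul_zero, neg_zero]

/-- The element `y` is a nonzero multiple of the product of the generators in the set `D`. -/
def IsMon (D : Set X) (y : ExteriorAlgebra K (X →₀ K)) : Prop :=
  ∃ l : List X, l.Nodup ∧ (∀ x, x ∈ l ↔ x ∈ D) ∧ ∃ c : K, c ≠ 0 ∧ y = c • genProd K l

theorem isMon_genProd {l : List X} (hl : l.Nodup) : IsMon {x | x ∈ l} (genProd K l) :=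
  ⟨l, hl, fun _ => Iff.rfl, 1, one_ne_zero, (one_smul _ _).symm⟩

theorem IsMon.of_list {D : Set X} {y : ExteriorAlgebra K (X →₀ K)} (h : IsMon D y) {l : List X}
    (hl : l.Nodup) (hD : ∀ x, x ∈ l ↔ x ∈ D) : ∃ c : K, c ≠ 0 ∧ y = c • genProd K l := by
  obtain ⟨l', hl', hD', c, hc, rfl⟩ := h
  obtain ⟨c', hc', e⟩ := genProd_perm (K := K) (l := l) (l' := l')
    ((List.perm_ext_iff_of_nodup hl hl').mpr fun x => (hD x).trans (hD' x).symm)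
  exact ⟨c * c', mul_ne_zero hc hc', by rw [e, smul_smul]⟩

theorem IsMon.smul_eq {D : Set X} {y y' : ExteriorAlgebra K (X →₀ K)} (h : IsMon D y)
    (h' : IsMon D y') : ∃ c : K, c ≠ 0 ∧ y = c • y' := by
  obtain ⟨l, hl, hD, c', hc', rfl⟩ := h'
  obtain ⟨c, hc, rfl⟩ := h.of_list hl hD
  exact ⟨c * c'⁻¹, mul_ne_zero hc (inv_ne_zero hc'), by
    rw [smul_smul, mul_assoc, inv_mul_cancel₀ hc', mul_one]⟩

theorem IsMon.smul {D : Set X} {y : ExteriorAlgebra K (X →₀ K)} (h : IsMon D y) {c : K}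
    (hc : c ≠ 0) : IsMon D (c • y) := by
  obtain ⟨l, hl, hD, c', hc', rfl⟩ := h
  exact ⟨l, hl, hD, c * c', mul_ne_zero hc hc', by rw [smul_smul]⟩

theorem IsMon.gen_mul {D : Set X} {y : ExteriorAlgebra K (X →₀ K)} (h : IsMon D y) {x : X}
    (hx : x ∉ D) : IsMon (insert x D) (gen K x * y) := by
  obtain ⟨l, hl, hD, c, hc, rfl⟩ := h
  refine ⟨x :: l, List.nodup_cons.mpr ⟨fun h => hx ((hD x).mp h), hl⟩, fun z => ?_, c, hc, ?_⟩
  · rw [List.mem_cons, hD, Set.mem_insert_iff]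
  · rw [genProd_cons, mul_smul_comm]

theorem IsMon.gen_mul_eq_zero {D : Set X} {y : ExteriorAlgebra K (X →₀ K)} (h : IsMon D y) {x : X}
    (hx : x ∈ D) : gen K x * y = 0 := by
  obtain ⟨l, hl, hD, c, hc, rfl⟩ := h
  rw [mul_smul_comm, gen_mul_genProd ((hD x).mpr hx), smul_zero]

/-- The hypothesis on `z` is inherited by `z * gen K x`, because degree one elements anticommute. -/
theorem mul_deriv_genProd {f : Module.End K (X →₀ K)} {l : List X}
    {z : ExteriorAlgebra K (X →₀ K)}
    (h : ∀ x ∈ l, z * ExteriorAlgebra.ι K (f (Finsupp.single x 1)) = 0) :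
    z * deriv f (genProd K l) = 0 := by
  induction l generalizing z with
  | nil => simp [genProd, deriv_one]
  | cons x l ih =>
    rw [genProd_cons, deriv_mul, gen, deriv_ι, mul_add, ← mul_assoc, h x (by simp), zero_mul,
      zero_add, ← mul_assoc]
    refine ih fun y hy => ?_
    rw [mul_assoc, eq_neg_of_add_eq_zero_left (ExteriorAlgebra.ι_add_mul_swap (R := K)
      (Finsupp.single x (1 : K)) (f (Finsupp.single y 1))), mul_neg, ← mul_assoc, h y (by simp [hy]),
      zero_mul, neg_zero]

/-- Leibniz's formula for `f ^ k`, cut off after two terms since `f` kills `a` when applied twice.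
-/
theorem deriv_pow_mul (f : Module.End K (X →₀ K)) {a b : ExteriorAlgebra K (X →₀ K)}
    (h : deriv f (deriv f a) = 0) (k : ℕ) :
    (deriv f ^ k) (a * b) = a * (deriv f ^ k) b +
      (k : K) • (deriv f a * (deriv f ^ (k - 1)) b) := by
  induction k with
  | zero => simp
  | succ k ih =>
    rw [pow_succ', Module.End.mul_apply, ih, map_add, deriv_mul, map_smul, deriv_mul, h, zero_mul,
      zero_add, ← Module.End.mul_apply (deriv f), ← pow_succ']
    rcases k with _ | k
    · simp [add_comm]
    · rw [← Module.End.mul_apply (deriv f), ← pow_succ']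
      push_cast
      module

/-- The operator `f` moves the basis vectors in `S` by means of `τ` and kills the others. -/
structure IsMove (f : Module.End K (X →₀ K)) (S : Set X) (τ : X → X) : Prop where
  apply_mem : ∀ x ∈ S, f (Finsupp.single x 1) = Finsupp.single (τ x) 1
  apply_notMem : ∀ x ∉ S, f (Finsupp.single x 1) = 0
  notMem : ∀ x ∈ S, τ x ∉ S
  injOn : Set.InjOn τ S

/-- The elements of `D` that are moved out of `D`. -/
def moved (D S : Set X) (τ : X → X) : Set X := {x | x ∈ D ∧ x ∈ S ∧ τ x ∉ D}

/-- The result of moving all the elements of `D` that can be moved. -/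
def moveSet (D S : Set X) (τ : X → X) : Set X := (D \ moved D S τ) ∪ τ '' moved D S τ

/-- Each factor in `l` can be moved exactly once and the rest `y` not at all. With as many
applications as factors, all of them must be moved, and each order of doing so contributes alike:
the coefficient is a factorial, nonzero in characteristic zero. -/
theorem IsMove.deriv_pow_genProd [CharZero K] {f : Module.End K (X →₀ K)} {S : Set X} {τ : X → X}
    (hf : IsMove f S τ) {y : ExteriorAlgebra K (X →₀ K)} {D : Set X} (hy : IsMon D y)
    (hz : deriv f y = 0) {l : List X} (hl : l.Nodup) (hS : ∀ x ∈ l, x ∈ S)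
    (hD : ∀ x ∈ l, τ x ∉ D) :
    IsMon (τ '' {x | x ∈ l} ∪ D) ((deriv f ^ l.length) (genProd K l * y)) ∧
      ∀ k, l.length < k → (deriv f ^ k) (genProd K l * y) = 0 := by
  induction l with
  | nil =>
    refine ⟨by simpa [genProd] using hy, fun k hk => ?_⟩
    obtain ⟨k, rfl⟩ : ∃ k', k = k' + 1 := ⟨k - 1, by simp at hk; omega⟩
    rw [genProd, List.map_nil, List.prod_nil, one_mul, pow_succ, Module.End.mul_apply, hz, map_zero]
  | cons x l ih =>
    rw [List.nodup_cons] at hl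
    obtain ⟨ih1, ih2⟩ := ih hl.2 (fun z hz => hS z (by simp [hz])) fun z hz => hD z (by simp [hz])
    have hx := hS x (by simp)
    have e1 : deriv f (gen K x) = gen K (τ x) := by rw [gen, deriv_ι, hf.apply_mem x hx, gen]
    have e2 : deriv f (deriv f (gen K x)) = 0 := by
      rw [e1, gen, deriv_ι, hf.apply_notMem _ (hf.notMem x hx), map_zero]
    constructor
    · rw [List.length_cons, genProd_cons, mul_assoc, deriv_pow_mul f e2, ih2 _ (Nat.lt_succ_self _),
        mul_zero, zero_add, e1, Nat.add_sub_cancel]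
      have : τ '' {z | z ∈ x :: l} ∪ D = insert (τ x) (τ '' {z | z ∈ l} ∪ D) := by
        ext z
        simp [or_assoc, eq_comm]
      rw [this]
      refine (ih1.gen_mul ?_).smul (Nat.cast_ne_zero.mpr (Nat.succ_ne_zero _))
      rintro (⟨z, hz, e⟩ | h)
      · have : z = x := hf.injOn (hS z (List.mem_cons_of_mem _ hz)) hx e
        exact hl.1 (this ▸ hz)
      · exact hD x (by simp) h
    · intro k hk
      rw [List.length_cons] at hk
      rw [genProd_cons, mul_assoc, deriv_pow_mul f e2, ih2 _ (by omega), ih2 _ (by omega), mul_zero,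
        mul_zero, smul_zero, zero_add]

/-- Moving a factor onto one that is already present creates a square. -/
theorem IsMove.deriv_eq_zero {f : Module.End K (X →₀ K)} {S : Set X} {τ : X → X}
    (hf : IsMove f S τ) {y : ExteriorAlgebra K (X →₀ K)} {D : Set X} (hy : IsMon D y)
    (h : ∀ x ∈ D, x ∈ S → τ x ∈ D) : deriv f y = 0 := by
  classical
  obtain ⟨l, hl, hD, c, hc, rfl⟩ := hy
  rw [map_smul]
  -- Factors outside `S` are put in front: `f` kills them, and they include every target `τ x`.
  obtain ⟨c', -, e⟩ := genProd_perm (K := K) (List.filter_append_perm (fun x => decide (x ∉ S)) l)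
  rw [e, map_smul, genProd_append, deriv_mul]
  have h1 : deriv f (genProd K (l.filter fun x => decide (x ∉ S))) = 0 := by
    rw [← one_mul (deriv f _)]
    refine mul_deriv_genProd fun x hx => ?_
    rw [hf.apply_notMem x (by simpa using (List.mem_filter.mp hx).2), map_zero, mul_zero]
  rw [h1, zero_mul, zero_add, mul_deriv_genProd, smul_zero, smul_zero]
  intro x hx
  rw [List.mem_filter] at hx
  have hxS : x ∈ S := by simpa using hx.2
  rw [hf.apply_mem x hxS]
  have h2 : τ x ∈ l.filter fun x => decide (x ∉ S) := by
    rw [List.mem_filter]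
    exact ⟨(hD _).mpr (h x ((hD x).mp hx.1) hxS), by simpa using hf.notMem x hxS⟩
  obtain ⟨l1, l2, e⟩ := List.append_of_mem h2
  obtain ⟨c2, -, e2⟩ := genProd_perm (K := K) (l := l1 ++ l2 ++ [τ x]) (l' := l1 ++ τ x :: l2) (by
    rw [List.append_assoc]
    exact List.Perm.append_left _ (List.perm_append_singleton _ _))
  rw [e, e2, genProd_append, genProd_cons]
  change c2 • (genProd K (l1 ++ l2) * (gen K (τ x) * genProd K [])) * gen K (τ x) = 0
  rw [show genProd K ([] : List X) = 1 from rfl, mul_one, smul_mul_assoc, mul_assoc, gen_mul_self,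
    mul_zero, smul_zero]

/-- The effect of the maximal nonvanishing power of a move on a monomial. -/
theorem IsMove.deriv_pow [CharZero K] {f : Module.End K (X →₀ K)} {S : Set X} {τ : X → X}
    (hf : IsMove f S τ) {y : ExteriorAlgebra K (X →₀ K)} {D : Set X} (hy : IsMon D y) :
    IsMon (moveSet D S τ) ((deriv f ^ (moved D S τ).ncard) y) ∧
      ∀ k, (moved D S τ).ncard < k → (deriv f ^ k) y = 0 := by
  classical
  obtain ⟨l, hl, hD, c, hc, rfl⟩ := hy
  simp only [map_smul]
  have hM : ∀ x, x ∈ l.filter (fun x => decide (x ∈ moved D S τ)) ↔ x ∈ moved D S τ := fun x => by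
    rw [List.mem_filter, decide_eq_true_eq, and_iff_right_iff_imp, hD]
    exact fun h => h.1
  have hR : ∀ x, x ∈ l.filter (fun x => !decide (x ∈ moved D S τ)) ↔ x ∈ D \ moved D S τ :=
    fun x => by simp [hD]
  have hlen : (moved D S τ).ncard = (l.filter fun x => decide (x ∈ moved D S τ)).length := by
    rw [← List.toFinset_card_of_nodup (hl.filter _), ← Set.ncard_coe_finset]
    congr 1
    ext x
    rw [Finset.mem_coe, List.mem_toFinset, hM]
  obtain ⟨c', hc', e⟩ := genProd_perm (K := K)
    (List.filter_append_perm (fun x => decide (x ∈ moved D S τ)) l)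
  rw [e, genProd_append]
  simp only [map_smul, smul_smul]
  have hRmon : IsMon (D \ moved D S τ)
      (genProd K (l.filter fun x => !decide (x ∈ moved D S τ))) := by
    have hs : {x | x ∈ l.filter fun x => !decide (x ∈ moved D S τ)} = D \ moved D S τ := Set.ext hR
    rw [← hs]
    exact isMon_genProd (hl.filter _)
  obtain ⟨h1, h2⟩ := hf.deriv_pow_genProd hRmon (hf.deriv_eq_zero hRmon fun x hx hxS => by
      by_contra hc
      refine hx.2 ⟨hx.1, hxS, fun h => hc ⟨h, fun h' => hf.notMem x hxS h'.2.1⟩⟩)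
    (hl.filter fun x => decide (x ∈ moved D S τ)) (fun x hx => ((hM x).mp hx).2.1)
    (fun x hx h => ((hM x).mp hx).2.2 h.1)
  rw [hlen]
  refine ⟨?_, fun k hk => by rw [h2 k hk, smul_zero]⟩
  have : moveSet D S τ = τ '' {x | x ∈ l.filter fun x => decide (x ∈ moved D S τ)} ∪
      D \ moved D S τ := by
    have hs : {x | x ∈ l.filter fun x => decide (x ∈ moved D S τ)} = moved D S τ := Set.ext hM
    rw [hs, moveSet, Set.union_comm]
  rw [this]
  exact h1.smul (mul_ne_zero hc hc')

end Monomials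

end KP
end

noncomputable section
namespace KP

/-! ### Row and column operators on monomials -/

section Boxes

variable {K : Type*} [Field K] {n : ℕ}

variable (n) in
/-- The boxes satisfying `P` in the first `n` rows. -/
def boxes (P : ℕ → ℕ → Prop) : Set (Fin n × ℕ) := {x | P x.1 x.2}

/-- The boxes of the diagram of `w`. -/
def InvBox (w : Equiv.Perm ℕ) (a b : ℕ) : Prop := a < b ∧ w b < w a

variable (K n) in
/-- The generator `u_{pq}` in `T`. -/
def box (p q : ℕ) : T K n := if h : p < n then gen K (⟨p, h⟩, q) else 0

theorem box_of_lt {p : ℕ} (h : p < n) (q : ℕ) : box K n p q = gen K (⟨p, h⟩, q) := dif_pos h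

theorem isMon_uVec (w : Equiv.Perm ℕ) : IsMon (boxes n (InvBox w)) (uVec K n w) := by
  set l := (invSet_finite n w).toFinset.sort (· ≤ ·) with hl
  refine ⟨l.map fun x => (ofLex x), ?_, fun x => ?_, 1, one_ne_zero, ?_⟩
  · exact (Finset.sort_nodup _ _).map ofLex.injective
  · rw [List.mem_map]
    constructor
    · rintro ⟨y, hy, rfl⟩
      rw [hl, Finset.mem_sort, Set.Finite.mem_toFinset] at hy
      exact hy
    · intro hx
      refine ⟨toLex x, ?_, rfl⟩
      rw [hl, Finset.mem_sort, Set.Finite.mem_toFinset]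
      exact hx
  · rw [one_smul, genProd, List.map_map, uVec]
    rfl

theorem box_mul_eq_zero {P : ℕ → ℕ → Prop} {y : T K n} (h : IsMon (boxes n P) y) {p q : ℕ}
    (hpq : P p q) : box K n p q * y = 0 := by
  unfold box
  split_ifs with hp
  · exact h.gen_mul_eq_zero hpq
  · exact zero_mul _

theorem box_mul_isMon {P : ℕ → ℕ → Prop} {y : T K n} (h : IsMon (boxes n P) y) {p q : ℕ}
    (hp : p < n) (hpq : ¬ P p q) :
    IsMon (boxes n fun a b => (a = p ∧ b = q) ∨ P a b) (box K n p q * y) := by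
  rw [box_of_lt hp]
  have := h.gen_mul (x := (⟨p, hp⟩, q)) hpq
  convert this using 1
  ext ⟨a, b⟩
  simp [boxes, Fin.ext_iff]

variable (K n) in
/-- The operator `e_{pq}` on `U`. -/
def rowMap (p q : ℕ) : Module.End K (U K n) := rowAct K n (matUnit K n p q).1

variable (K n) in
/-- The operator `e'_{qp}` on `U`. -/
def colMap (q p : ℕ) : Module.End K (U K n) :=
  Finsupp.linearCombination K fun x : Fin n × ℕ => if x.2 = p then uBasis K x.1 q else 0

theorem colOp_eq (q p : ℕ) : colOp K n q p = deriv (colMap K n q p) := rfl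

variable (K n) in
/-- The operator `e_{pq}` on `T`. -/
def rowOp (p q : ℕ) : Module.End K (T K n) := deriv (rowMap K n p q)

theorem lie_eq_deriv (x : borel K n) (y : T K n) : ⁅x, y⁆ = deriv (rowAct K n x.1) y := rfl

theorem rowMap_single (p q : ℕ) (x : Fin n × ℕ) :
    rowMap K n p q (Finsupp.single x 1) =
      if h : p < n then if (x.1 : ℕ) = q ∧ p ≤ q then Finsupp.single (⟨p, h⟩, x.2) 1 else 0
      else 0 := by
  have e := rowAct_uBasis K n (matUnit K n p q).1 x.1 x.2
  rw [uBasis] at e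
  rw [rowMap, show x = (x.1, x.2) from rfl, e]
  simp only [matUnit, Matrix.of_apply, ite_smul, one_smul, zero_smul]
  split_ifs with h h1
  · rw [Finset.sum_eq_single ⟨p, h⟩]
    · rw [if_pos ⟨rfl, h1⟩, uBasis]
    · intro a _ ha
      rw [if_neg]
      rintro ⟨h2, -⟩
      exact ha (Fin.ext h2)
    · simp
  · refine Finset.sum_eq_zero fun a _ => if_neg ?_
    rintro ⟨-, h2⟩
    exact h1 h2
  · refine Finset.sum_eq_zero fun a _ => if_neg ?_
    rintro ⟨rfl, -⟩
    exact h a.2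

theorem colMap_single (q p : ℕ) (x : Fin n × ℕ) :
    colMap K n q p (Finsupp.single x 1) = if x.2 = p then Finsupp.single (x.1, q) 1 else 0 := by
  rw [colMap, Finsupp.linearCombination_single, one_smul, uBasis]

theorem isMove_rowMap {p q : ℕ} (hp : p < n) (hpq : p < q) :
    IsMove (rowMap K n p q) {x | (x.1 : ℕ) = q} fun x => (⟨p, hp⟩, x.2) where
  apply_mem x hx := by
    rw [rowMap_single, dif_pos hp, if_pos ⟨hx, hpq.le⟩]
  apply_notMem x hx := by
    rw [rowMap_single, dif_pos hp, if_neg fun h => hx h.1]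
  notMem x _ h := hpq.ne h
  injOn := by
    rintro ⟨a, b⟩ (h : (a : ℕ) = q) ⟨a', b'⟩ (h' : (a' : ℕ) = q) e
    simp only [Prod.mk.injEq, true_and] at e
    rw [e, Fin.ext (h.trans h'.symm)]

theorem isMove_colMap {p q : ℕ} (hpq : p ≠ q) :
    IsMove (colMap K n q p) {x | x.2 = p} fun x => (x.1, q) where
  apply_mem x hx := by
    rw [colMap_single]
    exact if_pos hx
  apply_notMem x hx := by
    rw [colMap_single]
    exact if_neg hx
  notMem x _ h := hpq h.symm
  injOn := by
    rintro ⟨a, b⟩ (h : b = p) ⟨a', b'⟩ (h' : b' = p) e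
    simp only [Prod.mk.injEq, and_true] at e
    rw [e, h, h']

/-- The diagram obtained from `P` by moving boxes from row `q` to row `p`. -/
def rowMoved (P : ℕ → ℕ → Prop) (p q a b : ℕ) : Prop :=
  (P a b ∧ ¬ (a = q ∧ ¬ P p b)) ∨ (a = p ∧ P q b ∧ ¬ P p b)

/-- The diagram obtained from `P` by moving boxes from column `p` to column `q`. -/
def colMoved (P : ℕ → ℕ → Prop) (q p a b : ℕ) : Prop :=
  (P a b ∧ ¬ (b = p ∧ ¬ P a q)) ∨ (b = q ∧ P a p ∧ ¬ P a q)

theorem rowOp_pow [CharZero K] {P : ℕ → ℕ → Prop} {y : T K n} (h : IsMon (boxes n P) y) {p q : ℕ}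
    (hp : p < n) (hpq : p < q) (hq : n ≤ q → ∀ b, ¬ P q b) :
    IsMon (boxes n (rowMoved P p q)) ((rowOp K n p q ^ Set.ncard {b | P q b ∧ ¬ P p b}) y) ∧
      ∀ k, Set.ncard {b | P q b ∧ ¬ P p b} < k → (rowOp K n p q ^ k) y = 0 := by
  have key := (isMove_rowMap (K := K) hp hpq).deriv_pow h
  set M := moved (boxes n P) {x : Fin n × ℕ | (x.1 : ℕ) = q} (fun x => (⟨p, hp⟩, x.2)) with hM
  have hmem : ∀ x : Fin n × ℕ, x ∈ M ↔ P x.1 x.2 ∧ (x.1 : ℕ) = q ∧ ¬ P p x.2 := fun x => Iff.rfl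
  have e1 : {b | P q b ∧ ¬ P p b} = Prod.snd '' M := by
    ext b
    constructor
    · rintro ⟨h1, h2⟩
      have hq' : q < n := lt_of_not_ge fun h => hq h b h1
      exact ⟨(⟨q, hq'⟩, b), (hmem _).mpr ⟨h1, rfl, h2⟩, rfl⟩
    · rintro ⟨x, hx, rfl⟩
      obtain ⟨h1, h2, h3⟩ := (hmem x).mp hx
      exact ⟨h2 ▸ h1, h3⟩
  have e2 : Set.ncard {b | P q b ∧ ¬ P p b} = M.ncard := by
    rw [e1]
    refine Set.InjOn.ncard_image fun x hx x' hx' e => ?_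
    have h1 := ((hmem x).mp hx).2.1
    have h2 := ((hmem x').mp hx').2.1
    exact Prod.ext (Fin.ext (h1.trans h2.symm)) e
  have e3 : moveSet (boxes n P) {x : Fin n × ℕ | (x.1 : ℕ) = q} (fun x => (⟨p, hp⟩, x.2)) =
      boxes n (rowMoved P p q) := by
    ext ⟨a, b⟩
    rw [moveSet, ← hM]
    constructor
    · rintro (⟨h1, h2⟩ | ⟨x, hx, e⟩)
      · exact Or.inl ⟨h1, fun h3 => h2 ((hmem _).mpr ⟨h1, h3⟩)⟩
      · obtain ⟨h1, h2, h3⟩ := (hmem x).mp hx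
        simp only [Prod.mk.injEq] at e
        obtain ⟨rfl, rfl⟩ := e
        exact Or.inr ⟨rfl, h2 ▸ h1, h3⟩
    · rintro (⟨h1, h2⟩ | ⟨h1, h2, h3⟩)
      · exact Or.inl ⟨h1, fun h3 => h2 ((hmem _).mp h3).2⟩
      · have hq' : q < n := lt_of_not_ge fun h => hq h b h2
        exact Or.inr ⟨(⟨q, hq'⟩, b), (hmem _).mpr ⟨h2, rfl, h3⟩, Prod.ext (Fin.ext h1.symm) rfl⟩
  rw [e2, ← e3]
  exact key

theorem colOp_pow [CharZero K] {P : ℕ → ℕ → Prop} {y : T K n} (h : IsMon (boxes n P) y) {p q : ℕ}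
    (hpq : p ≠ q) :
    IsMon (boxes n (colMoved P q p)) ((colOp K n q p ^ Set.ncard {a | a < n ∧ P a p ∧ ¬ P a q}) y) ∧
      ∀ k, Set.ncard {a | a < n ∧ P a p ∧ ¬ P a q} < k → (colOp K n q p ^ k) y = 0 := by
  have key := (isMove_colMap (K := K) (n := n) hpq).deriv_pow h
  set M := moved (boxes n P) {x : Fin n × ℕ | x.2 = p} (fun x => (x.1, q)) with hM
  have hmem : ∀ x : Fin n × ℕ, x ∈ M ↔ P x.1 x.2 ∧ x.2 = p ∧ ¬ P x.1 q := fun x => Iff.rfl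
  have e1 : {a | a < n ∧ P a p ∧ ¬ P a q} = (fun x => (x.1 : ℕ)) '' M := by
    ext a
    constructor
    · rintro ⟨h0, h1, h2⟩
      exact ⟨(⟨a, h0⟩, p), (hmem _).mpr ⟨h1, rfl, h2⟩, rfl⟩
    · rintro ⟨x, hx, rfl⟩
      obtain ⟨h1, h2, h3⟩ := (hmem x).mp hx
      exact ⟨x.1.2, h2 ▸ h1, h3⟩
  have e2 : Set.ncard {a | a < n ∧ P a p ∧ ¬ P a q} = M.ncard := by
    rw [e1]
    refine Set.InjOn.ncard_image fun x hx x' hx' e => ?_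
    have h1 := ((hmem x).mp hx).2.1
    have h2 := ((hmem x').mp hx').2.1
    exact Prod.ext (Fin.ext e) (h1.trans h2.symm)
  have e3 : moveSet (boxes n P) {x : Fin n × ℕ | x.2 = p} (fun x => (x.1, q)) =
      boxes n (colMoved P q p) := by
    ext ⟨a, b⟩
    rw [moveSet, ← hM]
    constructor
    · rintro (⟨h1, h2⟩ | ⟨x, hx, e⟩)
      · exact Or.inl ⟨h1, fun h3 => h2 ((hmem _).mpr ⟨h1, h3⟩)⟩
      · obtain ⟨h1, h2, h3⟩ := (hmem x).mp hx
        simp only [Prod.mk.injEq] at e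
        obtain ⟨rfl, rfl⟩ := e
        exact Or.inr ⟨rfl, h2 ▸ h1, h3⟩
    · rintro (⟨h1, h2⟩ | ⟨h1, h2, h3⟩)
      · exact Or.inl ⟨h1, fun h3 => h2 ((hmem _).mp h3).2⟩
      · exact Or.inr ⟨(a, p), (hmem _).mpr ⟨h2, rfl, h3⟩, Prod.ext rfl h1.symm⟩
  rw [e2, ← e3]
  exact key

theorem not_invBox_of_permSet {w : Equiv.Perm ℕ} (hw : w ∈ permSet n) {q b : ℕ} (h : n ≤ q) :
    ¬ InvBox w q b := by
  rintro ⟨h1, h2⟩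
  have := hw.2 (show q ∈ Set.Ici n from h) (show b ∈ Set.Ici n from h.trans h1.le) h1
  omega

/-- The boxes of row `q` that have no box above them in row `p` are those with `w p < w b < w q`, so
`mRight` is the largest exponent that does not kill. The diagram `P` need only agree with that of
`w` to the right of column `q`, which allows a previous column move. For `q ≥ n` there is nothing to
move and the exponent is `0`. -/
theorem rowOp_mRight [CharZero K] {w : Equiv.Perm ℕ} (hw : w ∈ permSet n) {p q : ℕ} (hp : p < n)
    (hpq : p < q) {P : ℕ → ℕ → Prop} {y : T K n} (h : IsMon (boxes n P) y)
    (hP : ∀ a b, p ≤ a → q < b → (P a b ↔ InvBox w a b)) (hP' : ∀ b, P q b → q < b) :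
    IsMon (boxes n (rowMoved P p q)) ((rowOp K n p q ^ mRight w p q) y) ∧
      ∀ k, mRight w p q < k → (rowOp K n p q ^ k) y = 0 := by
  have e : mRight w p q = Set.ncard {b | P q b ∧ ¬ P p b} := by
    unfold mRight
    congr 1
    ext r
    simp only [Set.mem_ofPred_eq]
    constructor
    · rintro ⟨h1, h2, h3⟩
      rw [hP q r hpq.le h1, hP p r le_rfl h1]
      unfold InvBox
      omega
    · rintro ⟨h1, h2⟩
      have h3 := hP' r h1
      rw [hP q r hpq.le h3] at h1
      rw [hP p r le_rfl h3] at h2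
      unfold InvBox at h1 h2
      have : w p ≠ w r := fun h => by have := w.injective h; omega
      omega
  rw [e]
  refine rowOp_pow h hp hpq fun hq b hb => ?_
  have h3 := hP' b hb
  rw [hP q b hpq.le h3] at hb
  exact not_invBox_of_permSet hw hq hb

theorem colOp_mLeft [CharZero K] {w : Equiv.Perm ℕ} {p q : ℕ} (hp : p ≤ n) (hpq : p < q)
    {y : T K n} (h : IsMon (boxes n (InvBox w)) y) :
    IsMon (boxes n (colMoved (InvBox w) q p)) ((colOp K n q p ^ mLeft w q p) y) ∧
      ∀ k, mLeft w q p < k → (colOp K n q p ^ k) y = 0 := by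
  have e : mLeft w q p = Set.ncard {a | a < n ∧ InvBox w a p ∧ ¬ InvBox w a q} := by
    unfold mLeft
    congr 1
    ext r
    simp only [Set.mem_ofPred_eq, InvBox]
    constructor
    · rintro ⟨h1, h2, h3⟩
      omega
    · rintro ⟨h1, h2, h3⟩
      have : w q ≠ w r := fun h => by have := w.injective h; omega
      omega
  rw [e]
  exact colOp_pow h hpq.ne

/-- The diagram of `w t_{pq}` is obtained from that of `w` by moving boxes between the rows and
the columns `p` and `q` and adding the box `(p, q)`. -/
theorem Cov.invBox_mul_swap {w : Equiv.Perm ℕ} {p q : ℕ} (hc : Cov w p q) (a b : ℕ) :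
    InvBox (w * Equiv.swap p q) a b ↔
      (a = p ∧ b = q) ∨ rowMoved (colMoved (InvBox w) q p) p q a b := by
  obtain ⟨h1, h2, h3⟩ := hc
  have inj : ∀ x y, w x = w y → x = y := fun x y h => w.injective h
  have ha := h3 a
  have hb := h3 b
  simp only [rowMoved, colMoved, InvBox, Equiv.Perm.mul_apply, Equiv.swap_apply_def]
  have i1 := inj a b
  have i2 := inj a p
  have i3 := inj a q
  have i4 := inj b p
  have i5 := inj b q
  clear inj h3
  grind

/-- Both sides are monomials with the same set of boxes, by `Cov.invBox_mul_swap`. -/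
theorem box_mul_rowOp_colOp [CharZero K] {w : Equiv.Perm ℕ} (hw : w ∈ permSet n) {p q : ℕ}
    (hp : p < n) (hc : Cov w p q) : ∃ c : K, c ≠ 0 ∧ box K n p q *
      ((rowOp K n p q ^ mRight w p q) ((colOp K n q p ^ mLeft w q p) (uVec K n w))) =
        c • uVec K n (w * Equiv.swap p q) := by
  have h1 := (colOp_mLeft (K := K) (n := n) hp.le hc.1 (isMon_uVec w)).1
  -- The column move changes only columns `p` and `q`, so right of column `q` the diagram is still
  -- that of `w`.
  have h2 := (rowOp_mRight hw hp hc.1 h1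
    (fun a b ha hb => by
      have := hc.1
      have e1 : ¬ InvBox w a p := fun h => by have := h.1; omega
      simp only [colMoved, show b ≠ p by omega, show b ≠ q by omega, e1]
      tauto)
    (fun b hb => by
      rcases hb with hb | hb
      · exact hb.1.1
      · have := hb.2.1.1
        have := hc.1
        omega)).1
  have h3 := box_mul_isMon h2 hp (q := q) (by
    have := hc.1
    have := hc.2.1
    unfold rowMoved colMoved InvBox
    omega)
  refine h3.smul_eq ?_
  convert isMon_uVec (K := K) (n := n) (w * Equiv.swap p q) using 2
  funext a b
  exact propext (hc.invBox_mul_swap a b).symm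

/-- The box `(p, r)` is already there: if `w r < w p` it belongs to the diagram of `w`; otherwise `w
p < w r < w q`, the cover condition puts `r` to the right of `q`, and the box was moved up from `(q,
r)`. -/
theorem box_mul_rowOp_eq_zero [CharZero K] {w : Equiv.Perm ℕ} (hw : w ∈ permSet n) {p q r : ℕ}
    (hp : p < n) (hc : Cov w p q) (hr : p < r) (hrq : w r < w q) :
    box K n p r * ((rowOp K n p q ^ mRight w p q) (uVec K n w)) = 0 := by
  refine box_mul_eq_zero (rowOp_mRight hw hp hc.1 (isMon_uVec w)
    (fun a b _ _ => Iff.rfl) fun b hb => hb.1).1 ?_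
  obtain ⟨h1, h2, h3⟩ := hc
  have := h3 r
  have i1 : w r = w p → r = p := fun h => w.injective h
  have i2 : w r = w q → r = q := fun h => w.injective h
  unfold rowMoved InvBox
  grind

/-- The box `(r, q)` is already there: if `w r > w q` it belongs to the diagram of `w`; otherwise
the cover condition gives `r < p`, and the box was moved over from `(r, p)`. -/
theorem box_mul_colOp_eq_zero [CharZero K] {w : Equiv.Perm ℕ} {p q r : ℕ}
    (hp : p < n) (hc : Cov w p q) (hr : r < q) (hrp : w p < w r) :
    box K n r q * ((colOp K n q p ^ mLeft w q p) (uVec K n w)) = 0 := by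
  refine box_mul_eq_zero (colOp_mLeft hp.le hc.1 (isMon_uVec w)).1 ?_
  obtain ⟨h1, h2, h3⟩ := hc
  have := h3 r
  have i1 : w r = w p → r = p := fun h => w.injective h
  have i2 : w r = w q → r = q := fun h => w.injective h
  unfold colMoved InvBox
  grind

end Boxes

/-! ### Commutation -/

section Commutation

variable {K : Type*} [Field K] {n : ℕ}

theorem deriv_zero {V : Type*} [AddCommGroup V] [Module K V] :
    deriv (0 : Module.End K V) = 0 := by
  have := deriv_smul (0 : K) (0 : Module.End K V)
  rwa [zero_smul, zero_smul] at this

theorem commute_deriv {V : Type*} [AddCommGroup V] [Module K V] {f g : Module.End K V}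
    (h : Commute f g) : Commute (deriv f) (deriv g) := by
  have e := deriv_lie f g
  rw [LieRing.of_associative_ring_bracket, h.eq, sub_self, deriv_zero,
    LieRing.of_associative_ring_bracket] at e
  exact (sub_eq_zero.mp e.symm)

theorem rowAct_comm_colMap (A : Matrix (Fin n) (Fin n) K) (q p : ℕ) :
    Commute (rowAct K n A) (colMap K n q p) := by
  refine Finsupp.lhom_ext' fun x => LinearMap.ext_ring ?_
  change rowAct K n A (colMap K n q p (Finsupp.single x 1)) =
    colMap K n q p (rowAct K n A (uBasis K x.1 x.2))
  rw [rowAct_uBasis, map_sum, colMap_single]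
  simp only [map_smul, uBasis, colMap_single]
  split_ifs with h
  · exact rowAct_uBasis K n A x.1 q
  · simp

theorem rowMap_mul_rowMap {p q p' q' : ℕ} (h : q ≠ p') :
    rowMap K n p q * rowMap K n p' q' = 0 := by
  refine Finsupp.lhom_ext' fun x => LinearMap.ext_ring ?_
  change rowMap K n p q (rowMap K n p' q' (Finsupp.single x 1)) = 0
  rw [rowMap_single]
  split_ifs
  · rw [rowMap_single]
    split_ifs with h1 h2
    · exact absurd h2.1.symm h
    · rfl
    · rfl
  · exact map_zero _
  · exact map_zero _

theorem colMap_mul_colMap {p q p' q' : ℕ} (h : q' ≠ p) :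
    colMap K n q p * colMap K n q' p' = 0 := by
  refine Finsupp.lhom_ext' fun x => LinearMap.ext_ring ?_
  change colMap K n q p (colMap K n q' p' (Finsupp.single x 1)) = 0
  rw [colMap_single]
  split_ifs
  · rw [colMap_single, if_neg h]
  · exact map_zero _

variable (K n) in
/-- The operators `e_{pq}` and `e'_{qp}` on `T` with `p < i ≤ q`. -/
def crossOps (i : ℕ) : Set (Module.End K (T K n)) :=
  {g | ∃ p q, p < i ∧ i ≤ q ∧ (g = rowOp K n p q ∨ g = colOp K n q p)}

/-- Row and column operators commute anyway. Two row operators, or two column operators, have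
product zero on `U`, because the indices `< i` and `≥ i` never match. -/
theorem crossOps_commute {i : ℕ} {g h : Module.End K (T K n)} (hg : g ∈ crossOps K n i)
    (hh : h ∈ crossOps K n i) : Commute g h := by
  obtain ⟨p, q, h1, h2, rfl | rfl⟩ := hg <;> obtain ⟨p', q', h1', h2', rfl | rfl⟩ := hh
  · refine commute_deriv ?_
    rw [commute_iff_eq, rowMap_mul_rowMap (by omega), rowMap_mul_rowMap (by omega)]
  · exact commute_deriv (rowAct_comm_colMap _ _ _)
  · exact commute_deriv (rowAct_comm_colMap _ _ _).symm
  · rw [colOp_eq, colOp_eq]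
    refine commute_deriv ?_
    rw [commute_iff_eq, colMap_mul_colMap (by omega), colMap_mul_colMap (by omega)]

theorem crossOps_closure_commute {i : ℕ} {g h : Module.End K (T K n)}
    (hg : g ∈ Submonoid.closure (crossOps K n i)) (hh : h ∈ Submonoid.closure (crossOps K n i)) :
    Commute g h := by
  induction hg, hh using Submonoid.closure_induction₂ with
  | mem x y hx hy => exact crossOps_commute hx hy
  | one_left x _ => exact Commute.one_left x
  | one_right x _ => exact Commute.one_right x
  | mul_left x y z _ _ _ h1 h2 => exact h1.mul_left h2
  | mul_right x y z _ _ _ h1 h2 => exact h1.mul_right h2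

/-- The row index of the box is `< i` and its column index is `≥ i`, so each of these derivations
kills the box. -/
theorem crossOps_closure_box_mul {i : ℕ} {g : Module.End K (T K n)}
    (hg : g ∈ Submonoid.closure (crossOps K n i)) {p q : ℕ} (hp : p < i) (hq : i ≤ q) (y : T K n) :
    g (box K n p q * y) = box K n p q * g y := by
  induction hg using Submonoid.closure_induction generalizing y with
  | mem g hg =>
    have : ∀ f : Module.End K (U K n), (∀ a : Fin n, (a : ℕ) = p → f (Finsupp.single (a, q) 1) = 0) →
        deriv f (box K n p q * y) = box K n p q * deriv f y := by
      intro f hf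
      unfold box
      split_ifs with h
      · rw [deriv_mul, gen, deriv_ι, hf _ rfl, map_zero, zero_mul, zero_add]
      · rw [zero_mul, zero_mul, map_zero]
    obtain ⟨p', q', h1, h2, rfl | rfl⟩ := hg
    · refine this _ fun a ha => ?_
      rw [rowMap_single]
      split_ifs with h3 h4
      · have := h4.1
        simp only at this
        omega
      · rfl
      · rfl
    · rw [colOp_eq]
      refine this _ fun a ha => ?_
      rw [colMap_single, if_neg]
      simp only
      omega
  | one => rfl
  | mul x y _ _ h1 h2 => rw [Module.End.mul_apply, Module.End.mul_apply, h2, h1]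

end Commutation

end KP
end

noncomputable section
namespace KP

/-! ### Sums over permutations of products in an exterior algebra -/

section PermSum

variable {K V : Type*} [Field K] [AddCommGroup V] [Module K V]

/-- The product `v_{d-1} ⋯ v_0`. -/
def revProd {A : Type*} [Monoid A] : {d : ℕ} → (Fin d → A) → A
  | 0, _ => 1
  | _ + 1, v => revProd (Fin.tail v) * v 0

theorem revProd_eq {A : Type*} [Monoid A] {d : ℕ} (v : Fin d → A) :
    revProd v = (List.ofFn fun j : Fin d => v (Fin.rev j)).prod := by
  induction d with
  | zero => simp [revProd]
  | succ d ih =>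
    rw [revProd, ih, List.ofFn_succ', List.concat_eq_append, List.prod_append]
    simp [Fin.rev_castSucc, Fin.tail]

theorem revProd_ι_comp_perm {d : ℕ} (v : Fin d → V) (σ : Equiv.Perm (Fin d)) :
    revProd (fun j => ExteriorAlgebra.ι K (v (σ j))) =
      ((Equiv.Perm.sign σ : ℤ) : K) • revProd fun j => ExteriorAlgebra.ι K (v j) := by
  have h : ∀ u : Fin d → V, revProd (fun j => ExteriorAlgebra.ι K (u j)) =
      ExteriorAlgebra.ιMulti K d fun j => u (Fin.rev j) := fun u => by
    rw [revProd_eq, ExteriorAlgebra.ιMulti_apply]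
  rw [h, h]
  have := AlternatingMap.map_perm (ExteriorAlgebra.ιMulti K d (M := V)) (fun j => v (Fin.rev j))
    (Fin.revPerm.trans (σ.trans Fin.revPerm))
  have e : (fun j => v (Fin.rev j)) ∘ (Fin.revPerm.trans (σ.trans Fin.revPerm)) =
      fun j => v (σ (Fin.rev j)) := by
    funext j
    simp
  have e2 : Equiv.Perm.sign (Fin.revPerm.trans (σ.trans Fin.revPerm)) = Equiv.Perm.sign σ := by
    have : Fin.revPerm.trans (σ.trans (Fin.revPerm (n := d))) =
      Fin.revPerm.symm.trans (σ.trans Fin.revPerm) := rfl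
    rw [this]
    exact Equiv.Perm.sign_symm_trans_trans σ Fin.revPerm
  rw [e, e2] at this
  rw [this, Units.smul_def, Int.cast_smul_eq_zsmul]

/-- The sum over all permutations `σ` of the products of the `g_j(B_{σ j})`, applied to `y`. -/
def permSum {A α : Type*} [Semiring A] {d : ℕ} (g : Fin d → α → A) (B : Fin d → α) (y : A) : A :=
  ∑ σ : Equiv.Perm (Fin d), revProd (fun j => g j (B (σ j))) * y

theorem permSum_smul {A α : Type*} [Semiring A] [Algebra K A] {d : ℕ} (g : Fin d → α → A)
    (B : Fin d → α) (r : K) (y : A) : permSum g B (r • y) = r • permSum g B y := by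
  simp only [permSum, mul_smul_comm, Finset.smul_sum]

theorem permSum_zero {A α : Type*} [Semiring A] {d : ℕ} (g : Fin d → α → A)
    (B : Fin d → α) : permSum g B 0 = 0 := by
  simp only [permSum, mul_zero, Finset.sum_const_zero]

/-- Reordering the factors absorbs the sign and transfers the permutation from the rows `P` to the
columns `Q`. In the exterior case the sum can thus be expanded along the `q_j`, as `Y`-chains
require. -/
theorem sum_sign_smul_revProd {α β : Type*} {d : ℕ} (u : α → β → V) (P : Fin d → α)
    (Q : Fin d → β) (y : ExteriorAlgebra K V) :
    ∑ σ : Equiv.Perm (Fin d), ((Equiv.Perm.sign σ : ℤ) : K) •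
      (revProd (fun j => ExteriorAlgebra.ι K (u (P (σ j)) (Q j))) * y) =
    permSum (fun j q => ExteriorAlgebra.ι K (u (P j) q)) Q y := by
  unfold permSum
  refine Fintype.sum_equiv (Equiv.inv _) _ _ fun σ => ?_
  have := revProd_ι_comp_perm (K := K) (fun j => u (P j) (Q (σ.symm j))) σ
  simp only [Equiv.symm_apply_apply] at this
  rw [this, smul_mul_assoc, smul_smul, ← Int.cast_mul, ← Units.val_mul, Int.units_mul_self,
    Units.val_one, Int.cast_one, one_smul]
  rfl

/-- Expansion of a sum over permutations with respect to the first factor. -/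
theorem permSum_succ {A α : Type*} [Semiring A] {d : ℕ} {g : Fin (d + 1) → α → A}
    {B : Fin (d + 1) → α} {y : A} (h : ∀ k, B k ≠ B 0 → g 0 (B k) * y = 0) :
    ∃ N : ℕ, N ≠ 0 ∧
      permSum g B y = N • permSum (Fin.tail g) (Fin.tail B) (g 0 (B 0) * y) := by
  classical
  refine ⟨(Finset.univ.filter fun k => B k = B 0).card, ?_, ?_⟩
  · exact (Finset.card_pos.mpr ⟨0, by simp⟩).ne'
  · unfold permSum
    rw [← Equiv.sum_comp Equiv.Perm.decomposeFin.symm, Fintype.sum_prod_type,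
      ← Finset.sum_const, Finset.sum_filter]
    refine Finset.sum_congr rfl fun k _ => ?_
    split_ifs with hk
    · refine Finset.sum_congr rfl fun e _ => ?_
      have hswap : ∀ j, B (Equiv.swap 0 k j) = B j := fun j => by
        rw [Equiv.swap_apply_def]
        split_ifs with h1 h2
        · rw [h1, hk]
        · rw [h2, hk]
        · rfl
      rw [revProd, mul_assoc, Equiv.Perm.decomposeFin_symm_apply_zero, hk]
      simp only [Fin.tail_def, Equiv.Perm.decomposeFin_symm_apply_succ, hswap]
    · refine Finset.sum_eq_zero fun e _ => ?_
      rw [revProd, mul_assoc, Equiv.Perm.decomposeFin_symm_apply_zero, h k hk, mul_zero]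

end PermSum

end KP
end

noncomputable section
namespace KP

/-! ### The maps `φ_ζ` on the vectors `v_ζ` -/

section Chains

variable {K : Type*} [Field K] {n : ℕ}

variable (K n) in
/-- The product of the operators `e_{p_j q_j}^{m_{p_j q_j}(w_j)}` on `T`. -/
def rowOpProd (w : Equiv.Perm ℕ) {d : ℕ} (c : Fin d → ℕ × ℕ) : Module.End K (T K n) :=
  (List.ofFn fun j : Fin d =>
    rowOp K n (c j).1 (c j).2 ^ mRight (chainPerm w c j) (c j).1 (c j).2).prod

theorem rowOpProd_succ (w : Equiv.Perm ℕ) {d : ℕ} (c : Fin (d + 1) → ℕ × ℕ) :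
    rowOpProd K n w c = rowOp K n (c 0).1 (c 0).2 ^ mRight w (c 0).1 (c 0).2 *
      rowOpProd K n (w * Equiv.swap (c 0).1 (c 0).2) (Fin.tail c) := by
  rw [rowOpProd, List.ofFn_succ, List.prod_cons, rowOpProd]
  simp only [Fin.val_zero, chainPerm_zero, Fin.val_succ, chainPerm_succ, Fin.tail_def]

theorem colOpProd_succ (w : Equiv.Perm ℕ) {d : ℕ} (c : Fin (d + 1) → ℕ × ℕ) :
    colOpProd K n w c = colOp K n (c 0).2 (c 0).1 ^ mLeft w (c 0).2 (c 0).1 *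
      colOpProd K n (w * Equiv.swap (c 0).1 (c 0).2) (Fin.tail c) := by
  rw [colOpProd, List.ofFn_succ, List.prod_cons, colOpProd]
  simp only [Fin.val_zero, chainPerm_zero, Fin.val_succ, chainPerm_succ, Fin.tail_def]

theorem rowOp_mem {i p q : ℕ} (hp : p < i) (hq : i ≤ q) (m : ℕ) :
    rowOp K n p q ^ m ∈ Submonoid.closure (crossOps K n i) :=
  Submonoid.pow_mem _ (Submonoid.subset_closure (show rowOp K n p q ∈ crossOps K n i from
    ⟨p, q, hp, hq, Or.inl rfl⟩)) m

theorem colOp_mem {i p q : ℕ} (hp : p < i) (hq : i ≤ q) (m : ℕ) :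
    colOp K n q p ^ m ∈ Submonoid.closure (crossOps K n i) :=
  Submonoid.pow_mem _ (Submonoid.subset_closure (show colOp K n q p ∈ crossOps K n i from
    ⟨p, q, hp, hq, Or.inr rfl⟩)) m

theorem rowOpProd_mem {i d : ℕ} {w : Equiv.Perm ℕ} {c : Fin d → ℕ × ℕ} (hc : IsPieriChain w i c) :
    rowOpProd K n w c ∈ Submonoid.closure (crossOps K n i) := by
  refine Submonoid.list_prod_mem _ fun g hg => ?_
  obtain ⟨j, rfl⟩ := (List.mem_ofFn' _ _).mp hg
  exact rowOp_mem (hc j).1 (hc j).2.1 _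

theorem colOpProd_mem {i d : ℕ} {w : Equiv.Perm ℕ} {c : Fin d → ℕ × ℕ} (hc : IsPieriChain w i c) :
    colOpProd K n w c ∈ Submonoid.closure (crossOps K n i) := by
  refine Submonoid.list_prod_mem _ fun g hg => ?_
  obtain ⟨j, rfl⟩ := (List.mem_ofFn' _ _).mp hg
  exact colOp_mem (hc j).1 (hc j).2.1 _

/-- If the operators `a` and `b` commute with `g`, a relation for `a u` survives. -/
theorem box_mul_crossOps_eq_zero {i : ℕ} {a g b : Module.End K (T K n)}
    (ha : a ∈ Submonoid.closure (crossOps K n i)) (hg : g ∈ Submonoid.closure (crossOps K n i))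
    (hb : b ∈ Submonoid.closure (crossOps K n i)) {p q : ℕ} (hp : p < i) (hq : i ≤ q) {u : T K n}
    (h : box K n p q * a u = 0) : box K n p q * (g * a * b) u = 0 := by
  rw [mul_assoc, (crossOps_closure_commute ha hb).eq, ← mul_assoc, Module.End.mul_apply,
    ← crossOps_closure_box_mul (mul_mem hg hb) hp hq, h, map_zero]

theorem box_mul_colOpProd_eq_zero [CharZero K] {i d N : ℕ} (hin : i ≤ n) {w : Equiv.Perm ℕ}
    (hN : Small N w) {c : Fin (d + 1) → ℕ × ℕ} (hc : IsPieriChain w i c)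
    {b : Module.End K (T K n)} (hb : b ∈ Submonoid.closure (crossOps K n i)) {r : ℕ} (hr : r < i)
    (hlt : w (c 0).1 < w r) :
    box K n r (c 0).2 * (colOpProd K n w c) (b (uVec K n w)) = 0 := by
  obtain ⟨⟨h1, h2, h3⟩, h4⟩ := (isPieriChain_succ hN).mp hc
  rw [colOpProd_succ, ← Module.End.mul_apply, mul_assoc,
    ← one_mul (colOp K n (c 0).2 (c 0).1 ^ mLeft w (c 0).2 (c 0).1 * _), ← mul_assoc]
  exact box_mul_crossOps_eq_zero (colOp_mem h1 h2 _) (one_mem _) (mul_mem (colOpProd_mem h4) hb)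
    hr h2 (box_mul_colOp_eq_zero (by omega) h3 (by omega) hlt)

theorem box_mul_rowOpProd_eq_zero [CharZero K] {i d N : ℕ} (hin : i ≤ n) {w : Equiv.Perm ℕ}
    (hw : w ∈ permSet n) (hN : Small N w) {c : Fin (d + 1) → ℕ × ℕ} (hc : IsPieriChain w i c)
    {b : Module.End K (T K n)} (hb : b ∈ Submonoid.closure (crossOps K n i)) {r : ℕ} (hr : i ≤ r)
    (hlt : w r < w (c 0).2) :
    box K n (c 0).1 r * b (rowOpProd K n w c (uVec K n w)) = 0 := by
  obtain ⟨⟨h1, h2, h3⟩, h4⟩ := (isPieriChain_succ hN).mp hc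
  rw [rowOpProd_succ, ← Module.End.mul_apply, ← mul_assoc]
  exact box_mul_crossOps_eq_zero (rowOp_mem h1 h2 _) hb (rowOpProd_mem h4) h1 hr
    (box_mul_rowOp_eq_zero hw (by omega) h3 (by omega) hlt)

/-- The first step of the computation of `φ_ζ(v_ζ)`. -/
theorem box_mul_colOpProd_rowOpProd [CharZero K] {i d N : ℕ} (hin : i ≤ n) {w : Equiv.Perm ℕ}
    (hw : w ∈ permSet n) (hN : Small N w) {c c' : Fin (d + 1) → ℕ × ℕ} (hc : IsPieriChain w i c)
    (hc' : IsPieriChain w i c') (h0 : c' 0 = c 0) : ∃ k : K, k ≠ 0 ∧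
    box K n (c 0).1 (c 0).2 * (colOpProd K n w c) (rowOpProd K n w c' (uVec K n w)) =
      k • (colOpProd K n (w * Equiv.swap (c 0).1 (c 0).2) (Fin.tail c))
        (rowOpProd K n (w * Equiv.swap (c 0).1 (c 0).2) (Fin.tail c')
          (uVec K n (w * Equiv.swap (c 0).1 (c 0).2))) := by
  obtain ⟨⟨h1, h2, h3⟩, h4⟩ := (isPieriChain_succ hN).mp hc
  obtain ⟨-, h4'⟩ := (isPieriChain_succ hN).mp hc'
  rw [h0] at h4'
  obtain ⟨k, hk, e⟩ := box_mul_rowOp_colOp (K := K) hw (show (c 0).1 < n by omega) h3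
  refine ⟨k, hk, ?_⟩
  rw [colOpProd_succ, rowOpProd_succ, h0]
  set w' := w * Equiv.swap (c 0).1 (c 0).2
  have hA := colOp_mem (K := K) (n := n) h1 h2 (mLeft w (c 0).2 (c 0).1)
  have hB := rowOp_mem (K := K) (n := n) h1 h2 (mRight w (c 0).1 (c 0).2)
  have hC := colOpProd_mem (K := K) (n := n) h4
  have hR := rowOpProd_mem (K := K) (n := n) h4'
  rw [← map_smul, ← map_smul, ← e, crossOps_closure_box_mul hR h1 h2,
    crossOps_closure_box_mul hC h1 h2]
  congr 1
  simp only [← Module.End.mul_apply]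
  refine congrArg (fun g : Module.End K (T K n) => g (uVec K n w)) ?_
  set A := colOp K n (c 0).2 (c 0).1 ^ mLeft w (c 0).2 (c 0).1
  set B := rowOp K n (c 0).1 (c 0).2 ^ mRight w (c 0).1 (c 0).2
  rw [(crossOps_closure_commute hA hC).eq, mul_assoc, ← mul_assoc A,
    (crossOps_closure_commute (mul_mem hA hB) hR).eq, (crossOps_closure_commute hA hB).eq]

/-- The labels of a chain are read in the intermediate permutations. This compares the positions in
`w` itself: a position `p_k` other than `p_0` is not touched by the first step, since `p_k < i ≤
q_0`. -/
theorem isXChain_first_le {i d N : ℕ} {w : Equiv.Perm ℕ} (hN : Small N w)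
    {c : Fin (d + 1) → ℕ × ℕ} (hc : IsXChain w i c) (k : Fin (d + 1)) :
    (c k).1 = (c 0).1 ∨ w (c 0).1 < w (c k).1 := by
  induction d generalizing w N with
  | zero =>
    rw [Fin.fin_one_eq_zero k]
    exact Or.inl rfl
  | succ d ih =>
    obtain ⟨h1, h2, h3⟩ := (isXChain_succ hN).mp hc
    have hs := FirstStep.small (hN.mono (le_max_left N i)) (le_max_right N i) h1
    induction k using Fin.cases with
    | zero => exact Or.inl rfl
    | succ k =>
      have h4 := h3 0
      rw [Fin.val_zero, chainPerm_zero] at h4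
      have h5 := ih hs h2 k
      have h6 := (hc.1 k.succ).1
      have h7 := h1.2.1
      simp only [Fin.tail] at h4 h5
      by_cases h : (c k.succ).1 = (c 0).1
      · exact Or.inl h
      · refine Or.inr ?_
        have h8 : (w * Equiv.swap (c 0).1 (c 0).2) (c k.succ).1 = w (c k.succ).1 := by
          rw [Equiv.Perm.mul_apply, Equiv.swap_apply_of_ne_of_ne h (by omega)]
        rw [← h8]
        rcases h5 with h5 | h5
        · rw [h5]
          exact h4
        · exact h4.trans h5

theorem isYChain_first_le {i d N : ℕ} {w : Equiv.Perm ℕ} (hN : Small N w)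
    {c : Fin (d + 1) → ℕ × ℕ} (hc : IsYChain w i c) (k : Fin (d + 1)) :
    (c k).2 = (c 0).2 ∨ w (c k).2 < w (c 0).2 := by
  induction d generalizing w N with
  | zero =>
    rw [Fin.fin_one_eq_zero k]
    exact Or.inl rfl
  | succ d ih =>
    obtain ⟨h1, h2, h3⟩ := (isYChain_succ hN).mp hc
    have hs := FirstStep.small (hN.mono (le_max_left N i)) (le_max_right N i) h1
    induction k using Fin.cases with
    | zero => exact Or.inl rfl
    | succ k =>
      have h4 := h3 0
      rw [Fin.val_zero, chainPerm_zero] at h4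
      have h5 := ih hs h2 k
      have h6 := (hc.1 k.succ).2.1
      have h7 := h1.1
      simp only [Fin.tail] at h4 h5
      by_cases h : (c k.succ).2 = (c 0).2
      · exact Or.inl h
      · refine Or.inr ?_
        have h8 : (w * Equiv.swap (c 0).1 (c 0).2) (c k.succ).2 = w (c k.succ).2 := by
          rw [Equiv.Perm.mul_apply, Equiv.swap_apply_of_ne_of_ne (by omega) h]
        rw [← h8]
        rcases h5 with h5 | h5
        · rw [h5]
          exact h4
        · exact h5.trans h4

variable (K n) in
/-- The value of `φ_c` on the vector attached to `c'`, in the symmetric case. -/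
def symValue (w : Equiv.Perm ℕ) {d : ℕ} (c c' : Fin d → ℕ × ℕ) : T K n :=
  permSum (fun j p => box K n p (c j).2) (fun j => (c' j).1)
    (colOpProd K n w c (rowOpProd K n w c' (uVec K n w)))

variable (K n) in
/-- The value of `φ_c` on the vector attached to `c'`, in the exterior case. -/
def altValue (w : Equiv.Perm ℕ) {d : ℕ} (c c' : Fin d → ℕ × ℕ) : T K n :=
  permSum (fun j q => box K n (c' j).1 q) (fun j => (c j).2)
    (colOpProd K n w c (rowOpProd K n w c' (uVec K n w)))

/-- Only the first steps matter, by `isXChain_first_of_lexLt`. If the first label of `c` is smaller,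
the column move of `c` has filled every box that could be added in column `q_0`. If the labels agree
and `c'` has the smaller target, the row move of `c'` has filled the box `(p_0, q_0)`. If the first
steps agree, only indices with `p'_k = p_0` survive, and the problem reduces to the tails over `w
t_{p_0 q_0}`. -/
theorem symValue_eq [CharZero K] {i d N : ℕ} (hin : i ≤ n) {w : Equiv.Perm ℕ}
    (hw : w ∈ permSet n) (hN : Small N w) {c c' : Fin d → ℕ × ℕ} (hc : IsXChain w i c)
    (hc' : IsXChain w i c') (h : ¬ LexLt (w * chainProd c)⁻¹ (w * chainProd c')⁻¹) :
    (c = c' → ∃ k : K, k ≠ 0 ∧ symValue K n w c c' = k • uVec K n (w * chainProd c)) ∧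
      (c ≠ c' → symValue K n w c c' = 0) := by
  induction d generalizing w N with
  | zero =>
    refine ⟨fun _ => ⟨1, one_ne_zero, ?_⟩, fun h => absurd (Subsingleton.elim _ _) h⟩
    simp [symValue, permSum, revProd, colOpProd, rowOpProd, chainProd_zero]
  | succ d ih =>
    have hfirst := isXChain_first_of_lexLt hN hc hc' h
    obtain ⟨h1, h2, h3⟩ := (isXChain_succ hN).mp hc
    obtain ⟨h1', h2', h3'⟩ := (isXChain_succ hN).mp hc'
    have hcol : ∀ r, r < i → w (c 0).1 < w r → box K n r (c 0).2 *
        (colOpProd K n w c) (rowOpProd K n w c' (uVec K n w)) = 0 := fun r =>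
      box_mul_colOpProd_eq_zero hin hN hc.1 (rowOpProd_mem hc'.1)
    have hle := isXChain_first_le hN hc'
    have hcol' : w (c 0).1 ≤ w (c' 0).1 → ∀ k, (c' k).1 ≠ (c' 0).1 → box K n (c' k).1 (c 0).2 *
        (colOpProd K n w c) (rowOpProd K n w c' (uVec K n w)) = 0 := fun h0 k hk =>
      hcol _ (hc'.1 k).1 (lt_of_le_of_lt h0 ((hle k).resolve_left hk))
    have hexp := fun h0 => permSum_succ (g := fun j p => box K n p (c j).2)
      (B := fun j => (c' j).1) (hcol' h0)
    rcases hfirst with hf | ⟨hf1, hf2⟩ | hf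
    · refine ⟨fun e => by rw [e] at hf; omega, fun _ => ?_⟩
      obtain ⟨M, -, e⟩ := hexp hf.le
      rw [symValue, e, hcol _ h1'.1 hf, permSum_zero, smul_zero]
    · refine ⟨fun e => by rw [e] at hf2; omega, fun _ => ?_⟩
      obtain ⟨M, -, e⟩ := hexp (by rw [hf1])
      -- The target of `c'` lies strictly between `p_0` and `q_0`, so the cover condition for `c`
      -- forbids its value to be below `w q_0`.
      have hlt : w (c 0).2 < w (c' 0).2 := by
        obtain ⟨a1, a2, a3⟩ := h1.2.2
        have b1 := h1'.2.2.2.1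
        have b2 := h1'.2.2.1
        rw [hf1] at b1 b2
        have b3 := a3 _ b2 hf2 b1
        have b4 : w (c' 0).2 ≠ w (c 0).2 := fun e => hf2.ne (w.injective e)
        omega
      rw [symValue, e, box_mul_rowOpProd_eq_zero hin hw hN hc'.1 (colOpProd_mem hc.1) h1.2.1 hlt,
        permSum_zero, smul_zero]
    · obtain ⟨M, hM, e⟩ := hexp (by rw [hf])
      obtain ⟨k, hk, e'⟩ := box_mul_colOpProd_rowOpProd (K := K) hin hw hN hc.1 hc'.1 hf
      rw [hf] at e h2'
      rw [e', permSum_smul, ← Nat.cast_smul_eq_nsmul K, smul_smul] at e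
      have hs := FirstStep.small (hN.mono (le_max_left N i)) (le_max_right N i) h1
      rw [chainProd_succ, chainProd_succ, hf, ← mul_assoc, ← mul_assoc] at h
      obtain ⟨ih1, ih2⟩ := ih (FirstStep.permSet hw hin h1) hs h2 h2' h
      rw [chainProd_succ, ← mul_assoc]
      constructor
      · intro hcc
        obtain ⟨k', hk', e2⟩ := ih1 (by rw [hcc])
        refine ⟨M * k * k', mul_ne_zero (mul_ne_zero (Nat.cast_ne_zero.mpr hM) hk) hk', ?_⟩
        rw [symValue, e, ← smul_smul _ k', ← e2]
        rfl
      · intro hcc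
        have e2 := ih2 fun ht => hcc (by
          rw [← Fin.cons_self_tail c, ← Fin.cons_self_tail c', ht, hf])
        rw [symValue, e]
        exact (congrArg _ e2).trans (smul_zero _)

/-- Same scheme as `symValue_eq` with rows and columns exchanged: a smaller first label of `c` is
killed by the row move of `c'`, and for equal labels a smaller source of `c'` is killed by the
column move of `c`. -/
theorem altValue_eq [CharZero K] {i d N : ℕ} (hin : i ≤ n) {w : Equiv.Perm ℕ}
    (hw : w ∈ permSet n) (hN : Small N w) {c c' : Fin d → ℕ × ℕ} (hc : IsYChain w i c)
    (hc' : IsYChain w i c') (h : ¬ RevLexLt (w * chainProd c)⁻¹ (w * chainProd c')⁻¹) :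
    (c = c' → ∃ k : K, k ≠ 0 ∧ altValue K n w c c' = k • uVec K n (w * chainProd c)) ∧
      (c ≠ c' → altValue K n w c c' = 0) := by
  induction d generalizing w N with
  | zero =>
    refine ⟨fun _ => ⟨1, one_ne_zero, ?_⟩, fun h => absurd (Subsingleton.elim _ _) h⟩
    simp [altValue, permSum, revProd, colOpProd, rowOpProd, chainProd_zero]
  | succ d ih =>
    have hfirst := isYChain_first_of_revLexLt hN hc hc' h
    obtain ⟨h1, h2, h3⟩ := (isYChain_succ hN).mp hc
    obtain ⟨h1', h2', h3'⟩ := (isYChain_succ hN).mp hc'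
    have hrow : ∀ r, i ≤ r → w r < w (c' 0).2 → box K n (c' 0).1 r *
        (colOpProd K n w c) (rowOpProd K n w c' (uVec K n w)) = 0 := fun r =>
      box_mul_rowOpProd_eq_zero hin hw hN hc'.1 (colOpProd_mem hc.1)
    have hle := isYChain_first_le hN hc
    have hrow' : w (c 0).2 ≤ w (c' 0).2 → ∀ k, (c k).2 ≠ (c 0).2 → box K n (c' 0).1 (c k).2 *
        (colOpProd K n w c) (rowOpProd K n w c' (uVec K n w)) = 0 := fun h0 k hk =>
      hrow _ (hc.1 k).2.1 (lt_of_lt_of_le ((hle k).resolve_left hk) h0)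
    have hexp := fun h0 => permSum_succ (g := fun j q => box K n (c' j).1 q)
      (B := fun j => (c j).2) (hrow' h0)
    rcases hfirst with hf | ⟨hf1, hf2⟩ | hf
    · refine ⟨fun e => by rw [e] at hf; omega, fun _ => ?_⟩
      obtain ⟨M, -, e⟩ := hexp hf.le
      rw [altValue, e, hrow _ h1.2.1 hf, permSum_zero, smul_zero]
    · refine ⟨fun e => by rw [e] at hf2; omega, fun _ => ?_⟩
      obtain ⟨M, -, e⟩ := hexp (by rw [hf1])
      have hlt : w (c 0).1 < w (c' 0).1 := by
        obtain ⟨a1, a2, a3⟩ := h1'.2.2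
        rw [hf1] at a2 a3
        have b1 := h1.2.2.2.1
        have b3 := a3 _ hf2 h1.2.2.1
        have b4 : w (c' 0).1 ≠ w (c 0).1 := fun e => hf2.ne (w.injective e)
        omega
      rw [altValue, e, box_mul_colOpProd_eq_zero hin hN hc.1 (rowOpProd_mem hc'.1) h1'.1 hlt,
        permSum_zero, smul_zero]
    · obtain ⟨M, hM, e⟩ := hexp (by rw [hf])
      obtain ⟨k, hk, e'⟩ := box_mul_colOpProd_rowOpProd (K := K) hin hw hN hc.1 hc'.1 hf
      rw [hf] at e h2'
      rw [e', permSum_smul, ← Nat.cast_smul_eq_nsmul K, smul_smul] at e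
      have hs := FirstStep.small (hN.mono (le_max_left N i)) (le_max_right N i) h1
      rw [chainProd_succ, chainProd_succ, hf, ← mul_assoc, ← mul_assoc] at h
      obtain ⟨ih1, ih2⟩ := ih (FirstStep.permSet hw hin h1) hs h2 h2' h
      rw [chainProd_succ, ← mul_assoc]
      constructor
      · intro hcc
        obtain ⟨k', hk', e2⟩ := ih1 (by rw [hcc])
        refine ⟨M * k * k', mul_ne_zero (mul_ne_zero (Nat.cast_ne_zero.mpr hM) hk) hk', ?_⟩
        rw [altValue, e, ← smul_smul _ k', ← e2]
        rfl
      · intro hcc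
        have e2 := ih2 fun ht => hcc (by
          rw [← Fin.cons_self_tail c, ← Fin.cons_self_tail c', ht, hf])
        rw [altValue, e]
        exact (congrArg _ e2).trans (smul_zero _)

end Chains

/-! ### Evaluation and equivariance of `φ_ζ` -/

section Phi

variable {K : Type*} [Field K] {n : ℕ}

theorem ι_iotaMap_colVec {i p : ℕ} (hin : i ≤ n) (hp : p < i) (q : ℕ) :
    ExteriorAlgebra.ι K (iotaMap K n i q (colVec K n i p)) = box K n p q := by
  rw [box_of_lt (by omega), gen]
  congr 1
  change Fintype.linearCombination K (fun a : Fin n => uBasis K a q)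
    (fun k : Fin n => if (k : ℕ) = p ∧ p < i then 1 else 0) = _
  rw [Fintype.linearCombination_apply, Finset.sum_eq_single ⟨p, by omega⟩]
  · rw [if_pos ⟨rfl, hp⟩, one_smul, uBasis]
  · intro a _ ha
    rw [if_neg, zero_smul]
    rintro ⟨h, -⟩
    exact ha (Fin.ext h)
  · simp

theorem muComp_tmul (i : ℕ) {d : ℕ} (q : Fin d → ℕ) (y : T K n) (v : Fin d → colMod K n i) :
    muComp K n i d q (y ⊗ₜ[K] PiTensorProduct.tprod K v) =
      revProd (fun j => ExteriorAlgebra.ι K (iotaMap K n i (q j) (v j))) * y := by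
  induction d generalizing y with
  | zero => simp [muComp, revProd]
  | succ d ih =>
    rw [muComp, LinearMap.comp_apply, mu_tmul, ih, revProd, mul_assoc]
    rfl

theorem phi_tmul (w : Equiv.Perm ℕ) (i : ℕ) {d : ℕ} (c : Fin d → ℕ × ℕ) (y : T K n)
    (v : Fin d → colMod K n i) : phi K n w i c (y ⊗ₜ[K] PiTensorProduct.tprod K v) =
      revProd (fun j => ExteriorAlgebra.ι K (iotaMap K n i (c j).2 (v j))) *
        colOpProd K n w c y := by
  rw [phi, LinearMap.comp_apply, TensorProduct.map_tmul, LinearMap.id_apply, muComp_tmul]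

theorem coe_toEnd_pow (w : Equiv.Perm ℕ) (p q m : ℕ) (y : kpMod K n w) :
    (((LieModule.toEnd K (borel K n) (kpMod K n w) (matUnit K n p q) ^ m) y : kpMod K n w) :
      T K n) = (rowOp K n p q ^ m) (y : T K n) := by
  induction m with
  | zero => rfl
  | succ m ih =>
    rw [pow_succ', pow_succ', Module.End.mul_apply, Module.End.mul_apply, ← ih]
    rfl

theorem coe_rowOpVec (w : Equiv.Perm ℕ) {d : ℕ} (c : Fin d → ℕ × ℕ) :
    (rowOpVec K n w c : T K n) = rowOpProd K n w c (uVec K n w) := by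
  have : ∀ (l : List ((ℕ × ℕ) × ℕ)) (y : kpMod K n w),
      (((l.map fun x => LieModule.toEnd K (borel K n) (kpMod K n w)
        (matUnit K n x.1.1 x.1.2) ^ x.2).prod y : kpMod K n w) : T K n) =
      (l.map fun x => rowOp K n x.1.1 x.1.2 ^ x.2).prod (y : T K n) := by
    intro l
    induction l with
    | nil => exact fun y => rfl
    | cons x l ih =>
      intro y
      rw [List.map_cons, List.map_cons, List.prod_cons, List.prod_cons, Module.End.mul_apply,
        Module.End.mul_apply, coe_toEnd_pow, ih]
  have h := this (List.ofFn fun j : Fin d => (c j, mRight (chainPerm w c j) (c j).1 (c j).2))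
    (kpGen K n w)
  rw [List.map_ofFn, List.map_ofFn] at h
  exact h

theorem symPhi_symVec {w : Equiv.Perm ℕ} {i d : ℕ} (hin : i ≤ n) (c : Fin d → ℕ × ℕ)
    {c' : Fin d → ℕ × ℕ} (hc' : IsPieriChain w i c') :
    symPhi K n w i c (symVec K n w i c') = symValue K n w c c' := by
  change phi K n w i c ((rowOpVec K n w c' : T K n) ⊗ₜ[K]
    (∑ σ : Equiv.Perm (Fin d), PiTensorProduct.tprod K fun k => colVec K n i (c' (σ k)).1)) = _
  rw [TensorProduct.tmul_sum, map_sum, symValue, permSum]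
  refine Finset.sum_congr rfl fun σ _ => ?_
  rw [phi_tmul, coe_rowOpVec]
  congr 2
  funext j
  exact ι_iotaMap_colVec hin (hc' _).1 _

theorem altPhi_altVec {w : Equiv.Perm ℕ} {i d : ℕ} (hin : i ≤ n) (c : Fin d → ℕ × ℕ)
    {c' : Fin d → ℕ × ℕ} (hc' : IsPieriChain w i c') :
    altPhi K n w i c (altVec K n w i c') = altValue K n w c c' := by
  change phi K n w i c ((rowOpVec K n w c' : T K n) ⊗ₜ[K]
    (∑ σ : Equiv.Perm (Fin d), ((Equiv.Perm.sign σ : ℤ) : K) •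
      PiTensorProduct.tprod K fun k => colVec K n i (c' (σ k)).1)) = _
  rw [TensorProduct.tmul_sum, map_sum]
  simp only [TensorProduct.tmul_smul, map_smul, phi_tmul]
  rw [sum_sign_smul_revProd (fun p q => iotaMap K n i q (colVec K n i p)) (fun j => (c' j).1)
    (fun j => (c j).2), altValue, coe_rowOpVec]
  congr 1
  funext j q
  exact ι_iotaMap_colVec hin (hc' _).1 _

theorem deriv_revProd {V : Type*} [AddCommGroup V] [Module K V] (f : Module.End K V) {d : ℕ}
    (u : Fin d → V) : deriv f (revProd fun j => ExteriorAlgebra.ι K (u j)) =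
      ∑ k, revProd fun j => ExteriorAlgebra.ι K (Function.update u k (f (u k)) j) := by
  induction d with
  | zero => simp [revProd, deriv_one]
  | succ d ih =>
    rw [revProd, deriv_mul, deriv_ι, Fin.sum_univ_succ, add_comm]
    refine congrArg₂ (· + ·) ?_ ?_
    · change _ = revProd (fun j : Fin d => ExteriorAlgebra.ι K
        (Function.update u 0 (f (u 0)) j.succ)) *
          ExteriorAlgebra.ι K (Function.update u 0 (f (u 0)) 0)
      simp [Fin.tail_def]
    · have := ih (Fin.tail u)
      simp only [Fin.tail_def] at this ⊢
      rw [this, Finset.sum_mul]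
      refine Finset.sum_congr rfl fun k _ => ?_
      rw [revProd, Function.update_of_ne (Fin.succ_ne_zero k).symm]
      congr 2
      funext j
      rw [Fin.tail_def]
      congr 1
      by_cases h : j = k
      · subst h
        simp
      · rw [Function.update_of_ne h, Function.update_of_ne (fun e => h (Fin.succ_injective _ e))]

theorem iotaMap_lie (i q : ℕ) (x : borel K n) (v : colMod K n i) :
    iotaMap K n i q ⁅x, v⁆ = rowAct K n x.1 (iotaMap K n i q v) := by
  change Fintype.linearCombination K (fun p : Fin n => uBasis K p q) (x.1.mulVec v.1) =
    rowAct K n x.1 (Fintype.linearCombination K (fun p : Fin n => uBasis K p q) v.1)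
  simp only [Fintype.linearCombination_apply, map_sum, map_smul, rowAct_uBasis, Finset.smul_sum,
    smul_smul, Matrix.mulVec, dotProduct, Finset.sum_smul]
  rw [Finset.sum_comm]
  exact Finset.sum_congr rfl fun k _ => Finset.sum_congr rfl fun p _ => by rw [mul_comm]

theorem colOpProd_lie (w : Equiv.Perm ℕ) {d : ℕ} (c : Fin d → ℕ × ℕ) (x : borel K n) (y : T K n) :
    colOpProd K n w c ⁅x, y⁆ = ⁅x, colOpProd K n w c y⁆ := by
  have : Commute (colOpProd K n w c) (deriv (rowAct K n x.1)) := by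
    refine Commute.list_prod_left _ _ fun g hg => ?_
    obtain ⟨j, rfl⟩ := (List.mem_ofFn' _ _).mp hg
    exact Commute.pow_left (commute_deriv (rowAct_comm_colMap _ _ _).symm) _
  exact LinearMap.congr_fun this.eq y

/-- The column operators commute with the row action, each `iotaMap` is `𝔟`-linear, and `𝔟` acts on
the resulting product by derivations. -/
theorem phi_lie (w : Equiv.Perm ℕ) (i : ℕ) {d : ℕ} (c : Fin d → ℕ × ℕ) (x : borel K n)
    (z : T K n ⊗[K] (⨂[K]^d (colMod K n i))) :
    phi K n w i c ⁅x, z⁆ = ⁅x, phi K n w i c z⁆ := by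
  induction z using TensorProduct.induction_on with
  | zero => simp
  | add a b ha hb => rw [lie_add, map_add, ha, hb, map_add, lie_add]
  | tmul y s =>
    induction s using PiTensorProduct.induction_on with
    | smul_tprod r v =>
      rw [TensorProduct.tmul_smul, lie_smul, map_smul, map_smul]
      refine Eq.trans (congrArg _ ?_) (lie_smul r x _).symm
      rw [TensorProduct.LieModule.lie_tmul_right, map_add, phi_tmul, phi_tmul, tensor_lie_def,
        tensorDeriv_tprod, TensorProduct.tmul_sum, map_sum, colOpProd_lie, lie_eq_deriv,
        lie_eq_deriv, deriv_mul, deriv_revProd, Finset.sum_mul, add_comm]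
      congr 1
      refine Finset.sum_congr rfl fun k _ => ?_
      rw [phi_tmul]
      congr 2
      funext j
      congr 1
      by_cases h : j = k
      · subst h
        rw [Function.update_self, Function.update_self]
        exact iotaMap_lie i _ x (v j)
      · rw [Function.update_of_ne h, Function.update_of_ne h]
    | add a b ha hb => rw [TensorProduct.tmul_add, lie_add, map_add, ha, hb, map_add, lie_add]

theorem tensorMap_lie {L M M' N N' : Type*} [LieRing L] [LieAlgebra K L] [AddCommGroup M]
    [Module K M] [LieRingModule L M] [LieModule K L M] [AddCommGroup M'] [Module K M']
    [LieRingModule L M'] [LieModule K L M'] [AddCommGroup N] [Module K N] [LieRingModule L N]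
    [LieModule K L N] [AddCommGroup N'] [Module K N'] [LieRingModule L N'] [LieModule K L N']
    {f : M →ₗ[K] M'} {g : N →ₗ[K] N'} (hf : ∀ (x : L) m, f ⁅x, m⁆ = ⁅x, f m⁆)
    (hg : ∀ (x : L) m, g ⁅x, m⁆ = ⁅x, g m⁆) (x : L) (z : M ⊗[K] N) :
    TensorProduct.map f g ⁅x, z⁆ = ⁅x, TensorProduct.map f g z⁆ := by
  induction z using TensorProduct.induction_on with
  | zero => simp
  | add a b ha hb => rw [lie_add, map_add, ha, hb, map_add, lie_add]
  | tmul y s =>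
    rw [TensorProduct.LieModule.lie_tmul_right, map_add, TensorProduct.map_tmul,
      TensorProduct.map_tmul, TensorProduct.map_tmul, TensorProduct.LieModule.lie_tmul_right, hf, hg]

theorem symPhi_lie (w : Equiv.Perm ℕ) (i : ℕ) {d : ℕ} (c : Fin d → ℕ × ℕ) (x : borel K n)
    (z : SymMod K n w i d) : symPhi K n w i c ⁅x, z⁆ = ⁅x, symPhi K n w i c z⁆ := by
  refine Eq.trans (congrArg (phi K n w i c) ?_) (phi_lie w i c x _)
  exact tensorMap_lie (fun _ _ => rfl) (fun _ _ => rfl) x z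

theorem altPhi_lie (w : Equiv.Perm ℕ) (i : ℕ) {d : ℕ} (c : Fin d → ℕ × ℕ) (x : borel K n)
    (z : AltMod K n w i d) : altPhi K n w i c ⁅x, z⁆ = ⁅x, altPhi K n w i c z⁆ := by
  refine Eq.trans (congrArg (phi K n w i c) ?_) (phi_lie w i c x _)
  exact tensorMap_lie (fun _ _ => rfl) (fun _ _ => rfl) x z

end Phi

end KP
end

noncomputable section
namespace KP

/-! ### Finiteness of the KP modules -/

section Finite

variable {K : Type*} [Field K] {n : ℕ}

variable (K n) in
/-- The span of the products of `k` generators in the first `B` columns. -/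
def colPow (B k : ℕ) : Submodule K (T K n) :=
  (Submodule.span K (Set.range fun x : Fin n × Fin B => gen K (x.1, (x.2 : ℕ)))) ^ k

instance colPow_finite (B k : ℕ) : FiniteDimensional K (colPow K n B k) := by
  rw [FiniteDimensional, Module.Finite.iff_fg]
  exact Submodule.FG.pow (Submodule.fg_span (Set.finite_range _)) k

theorem deriv_mem_colPow (A : Matrix (Fin n) (Fin n) K) (B k : ℕ) {y : T K n}
    (hy : y ∈ colPow K n B k) : deriv (rowAct K n A) y ∈ colPow K n B k := by
  induction k generalizing y with
  | zero =>
    rw [colPow, pow_zero, Submodule.mem_one] at hy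
    obtain ⟨r, rfl⟩ := hy
    rw [deriv_algebraMap]
    exact zero_mem _
  | succ k ih =>
    rw [colPow, pow_succ] at hy ⊢
    induction hy using Submodule.mul_induction_on' with
    | mem_mul_mem a ha b hb =>
      rw [deriv_mul]
      refine add_mem (Submodule.mul_mem_mul (ih ha) hb) (Submodule.mul_mem_mul ha ?_)
      induction hb using Submodule.span_induction with
      | mem b hb =>
        obtain ⟨x, rfl⟩ := hb
        have : deriv (rowAct K n A) (gen K (x.1, (x.2 : ℕ))) =
            ∑ p, A p x.1 • gen K (p, (x.2 : ℕ)) := by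
          rw [gen, deriv_ι]
          change ExteriorAlgebra.ι K (rowAct K n A (uBasis K x.1 (x.2 : ℕ))) = _
          rw [rowAct_uBasis, map_sum]
          simp only [map_smul]
          rfl
        simp only [this]
        exact Submodule.sum_mem _ fun p _ => Submodule.smul_mem _ _
          (Submodule.subset_span ⟨(p, x.2), rfl⟩)
      | zero => rw [map_zero]; exact zero_mem _
      | add a b _ _ ha hb => rw [map_add]; exact add_mem ha hb
      | smul r a _ ha => rw [map_smul]; exact Submodule.smul_mem _ _ ha
    | add a _ b _ ha hb => rw [map_add]; exact add_mem ha hb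

theorem genProd_mem_colPow {B : ℕ} {l : List (Fin n × ℕ)} (h : ∀ x ∈ l, x.2 < B) :
    genProd K l ∈ colPow K n B l.length := by
  induction l with
  | nil => exact Submodule.one_le.mp le_rfl
  | cons x l ih =>
    rw [genProd_cons, List.length_cons, colPow, pow_succ']
    exact Submodule.mul_mem_mul (Submodule.subset_span ⟨(x.1, ⟨x.2, h x (by simp)⟩), rfl⟩)
      (ih fun y hy => h y (by simp [hy]))

/-- The action changes only rows, so it preserves the degree and the set of columns in use.
Dimension counts are legitimate because such a space is finite-dimensional. -/
theorem exists_kpMod_le_colPow (w : Equiv.Perm ℕ) :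
    ∃ B k, (kpMod K n w).toSubmodule ≤ colPow K n B k := by
  obtain ⟨l, hl, -, c, hc, e⟩ := isMon_uVec (K := K) (n := n) w
  obtain ⟨B, hB⟩ := (l.toFinset.image Prod.snd).bddAbove
  refine ⟨B + 1, l.length, ?_⟩
  let L : LieSubmodule K (borel K n) (T K n) :=
    { colPow K n (B + 1) l.length with lie_mem := fun {x} {y} hy => deriv_mem_colPow x.1 _ _ hy }
  change kpMod K n w ≤ L
  rw [kpMod, LieSubmodule.lieSpan_le, Set.singleton_subset_iff]
  change uVec K n w ∈ colPow K n (B + 1) l.length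
  rw [e]
  refine Submodule.smul_mem _ _ (genProd_mem_colPow fun x hx => Nat.lt_succ_of_le (hB ?_))
  simp only [Finset.coe_image, List.coe_toFinset]
  exact ⟨x, hx, rfl⟩

instance kpMod_finite (w : Equiv.Perm ℕ) : FiniteDimensional K (kpMod K n w) := by
  obtain ⟨B, k, h⟩ := exists_kpMod_le_colPow (K := K) (n := n) w
  exact Submodule.finiteDimensional_of_le h

end Finite

/-! ### Chains of submodules and dimensions -/

section ChainDim

variable {K : Type*} [Field K] {n : ℕ} {M : Type*} [AddCommGroup M] [Module K M]
  [LieRingModule (borel K n) M] [LieModule K (borel K n) M]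

theorem inducesIso_of {φ : M →ₗ[K] T K n} (hφ : ∀ (x : borel K n) m, φ ⁅x, m⁆ = ⁅x, φ m⁆)
    {N' N : LieSubmodule K (borel K n) M} {S : LieSubmodule K (borel K n) (T K n)}
    (hmem : ∀ m ∈ N, φ m ∈ S) (hsurj : ∀ y ∈ S, ∃ m ∈ N, φ m = y)
    (hker : ∀ m ∈ N, φ m = 0 ↔ m ∈ N') : InducesIso φ N' N S := by
  let g : N →ₗ[K] S := (φ ∘ₗ N.toSubmodule.subtype).codRestrict S.toSubmodule fun m => hmem m m.2
  have hg : ∀ m : N, (g m : T K n) = φ m := fun m => rfl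
  have hle : (N'.comap N.incl).toSubmodule = LinearMap.ker g := by
    ext m
    rw [LinearMap.mem_ker, ← Subtype.coe_inj, hg]
    exact (hker m m.2).symm
  let q : (N ⧸ (N'.comap N.incl)) →ₗ[K] S := Submodule.liftQ _ g hle.le
  have hq : ∀ m : N, q (LieSubmodule.Quotient.mk (N := N'.comap N.incl) m) = g m := fun m => rfl
  have hbij : Function.Bijective q := by
    constructor
    · rw [← LinearMap.ker_eq_bot]
      exact Submodule.ker_liftQ_eq_bot _ _ _ hle.ge
    · rintro ⟨y, hy⟩
      obtain ⟨m, hm, rfl⟩ := hsurj y hy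
      exact ⟨LieSubmodule.Quotient.mk ⟨m, hm⟩, rfl⟩
  refine ⟨{ LinearEquiv.ofBijective q hbij with map_lie' := ?_ }, fun m => rfl⟩
  intro x m
  obtain ⟨m, rfl⟩ := LieSubmodule.Quotient.surjective_mk' _ m
  exact Subtype.ext (hφ x m)

theorem spanChain_zero {r : ℕ} (v : Fin r → M) : spanChain (K := K) (n := n) v 0 = ⊥ := by
  rw [spanChain, LieSubmodule.lieSpan_eq_bot_iff]
  rintro m ⟨k, hk, -⟩
  exact absurd hk (Nat.not_lt_zero _)

theorem spanChain_mono {r : ℕ} (v : Fin r → M) : Monotone (spanChain (K := K) (n := n) v) := by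
  intro a b hab
  refine LieSubmodule.lieSpan_mono (Set.image_mono fun k hk => ?_)
  have hk' : (k : ℕ) < a := hk
  exact hk'.trans_le hab

theorem spanChain_last {r : ℕ} (v : Fin r → M) :
    spanChain (K := K) (n := n) v (Fin.last r) = LieSubmodule.lieSpan K (borel K n) (Set.range v) := by
  rw [spanChain, ← Set.image_univ]
  congr 2
  ext k
  simp

/-- A lower bound for the dimension of a module, from vectors and maps that are triangular with
respect to each other, and its consequences in the case of equality. -/
theorem chain_dimension [FiniteDimensional K M] {r : ℕ} {v : Fin r → M}
    {φ : Fin r → M →ₗ[K] T K n} {z : Fin r → Equiv.Perm ℕ}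
    (hφ : ∀ j (x : borel K n) m, φ j ⁅x, m⁆ = ⁅x, φ j m⁆)
    (hdiag : ∀ j, ∃ k : K, k ≠ 0 ∧ φ j (v j) = k • uVec K n (z j))
    (htri : ∀ j k, k < j → φ j (v k) = 0) :
    ∑ j, Module.finrank K (kpMod K n (z j)) ≤ Module.finrank K M ∧
      (Module.finrank K M ≤ ∑ j, Module.finrank K (kpMod K n (z j)) →
        spanChain (K := K) (n := n) v (Fin.last r) = ⊤ ∧ ∀ j : Fin r,
          InducesIso (φ j) (spanChain v j.castSucc) (spanChain v j.succ) (kpMod K n (z j))) := by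
  let Φ : ∀ j, M →ₗ⁅K, borel K n⁆ T K n := fun j => { φ j with map_lie' := hφ j _ _ }
  have hkill : ∀ j : Fin r, ∀ m ∈ spanChain (K := K) (n := n) v j.castSucc, φ j m = 0 := by
    intro j
    change spanChain v j.castSucc ≤ (Φ j).ker
    rw [spanChain, LieSubmodule.lieSpan_le]
    rintro m ⟨k, hk, rfl⟩
    exact htri j k hk
  have hmem : ∀ j : Fin r, ∀ m ∈ spanChain (K := K) (n := n) v j.succ, φ j m ∈ kpMod K n (z j) := by
    intro j
    change spanChain v j.succ ≤ (kpMod K n (z j)).comap (Φ j)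
    rw [spanChain, LieSubmodule.lieSpan_le]
    rintro m ⟨k, hk, rfl⟩
    change φ j (v k) ∈ kpMod K n (z j)
    have hk' : (k : ℕ) < j + 1 := hk
    rcases Nat.lt_or_ge k j with h | h
    · rw [htri j k h]
      exact zero_mem _
    · obtain rfl : k = j := Fin.ext (by omega)
      obtain ⟨c, -, e⟩ := hdiag k
      rw [e]
      exact (kpMod K n (z k)).smul_mem _ (LieSubmodule.subset_lieSpan rfl)
  have hsurj : ∀ j : Fin r, ∀ y ∈ kpMod K n (z j), ∃ m ∈ spanChain (K := K) (n := n) v j.succ, φ j m = y := by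
    intro j
    suffices kpMod K n (z j) ≤ (spanChain v j.succ).map (Φ j) from
      fun y hy => (LieSubmodule.mem_map _).mp (this hy)
    rw [kpMod, LieSubmodule.lieSpan_le, Set.singleton_subset_iff, SetLike.mem_coe,
      LieSubmodule.mem_map]
    obtain ⟨c, hc, e⟩ := hdiag j
    refine ⟨c⁻¹ • v j, (spanChain v j.succ).smul_mem _
      (LieSubmodule.subset_lieSpan ⟨j, Nat.lt_succ_self _, rfl⟩), ?_⟩
    change φ j (c⁻¹ • v j) = _
    rw [map_smul, e, smul_smul, inv_mul_cancel₀ hc, one_smul]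
  let D : Fin (r + 1) → ℕ := fun j => Module.finrank K (spanChain (K := K) (n := n) v j)
  have hrank : ∀ j : Fin r, ∃ κ : Submodule K (spanChain (K := K) (n := n) v j.succ),
      (∀ m, m ∈ κ ↔ φ j m = 0) ∧ ((spanChain v j.castSucc).comap
        (spanChain v j.succ).incl).toSubmodule ≤ κ ∧
      Module.finrank K (kpMod K n (z j)) + Module.finrank K κ = D j.succ ∧
      Module.finrank K ((spanChain (K := K) (n := n) v j.castSucc).comap
        (spanChain (K := K) (n := n) v j.succ).incl).toSubmodule = D j.castSucc := by
    intro j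
    let g : spanChain (K := K) (n := n) v j.succ →ₗ[K] kpMod K n (z j) :=
      (φ j ∘ₗ (spanChain (K := K) (n := n) v j.succ).toSubmodule.subtype).codRestrict (kpMod K n (z j)).toSubmodule
        fun m => hmem j m m.2
    have hg : ∀ m, m ∈ LinearMap.ker g ↔ φ j m = 0 := fun m => by
      rw [LinearMap.mem_ker, ← Subtype.coe_inj]
      exact Iff.rfl
    refine ⟨LinearMap.ker g, hg, fun m hm => (hg m).mpr (hkill j m hm), ?_, ?_⟩
    · have h1 := LinearMap.finrank_range_add_finrank_ker g
      have h2 : LinearMap.range g = ⊤ := by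
        rw [LinearMap.range_eq_top]
        rintro ⟨y, hy⟩
        obtain ⟨m, hm, rfl⟩ := hsurj j y hy
        exact ⟨⟨m, hm⟩, rfl⟩
      rwa [h2, finrank_top] at h1
    · exact (Submodule.comapSubtypeEquivOfLe
        (spanChain_mono v (Fin.castSucc_lt_succ (i := j)).le)).finrank_eq
  -- Rank and nullity of `φ j` on the `j`-th member of the chain, whose kernel there contains the
  -- previous member.
  have hstep : ∀ j : Fin r, Module.finrank K (kpMod K n (z j)) + D j.castSucc ≤ D j.succ := by
    intro j
    obtain ⟨κ, -, h1, h2, h3⟩ := hrank j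
    rw [← h2, ← h3]
    exact Nat.add_le_add_left (Submodule.finrank_mono h1) _
  have hsum : ∑ j : Fin r, (D j.succ - D j.castSucc : ℤ) = D (Fin.last r) - D 0 := by
    rw [Finset.sum_sub_distrib]
    have h1 := Fin.sum_univ_succ fun j => (D j : ℤ)
    have h2 := Fin.sum_univ_castSucc fun j => (D j : ℤ)
    linarith
  have hD0 : D 0 = 0 := by
    change Module.finrank K (spanChain (K := K) (n := n) v 0).toSubmodule = 0
    rw [spanChain_zero]
    exact finrank_bot K M
  have hDr : D (Fin.last r) ≤ Module.finrank K M := Submodule.finrank_le _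
  have hle : ∑ j, Module.finrank K (kpMod K n (z j)) ≤ D (Fin.last r) := by
    have : ∑ j, (Module.finrank K (kpMod K n (z j)) : ℤ) ≤
        ∑ j : Fin r, (D j.succ - D j.castSucc : ℤ) :=
      Finset.sum_le_sum fun j _ => by have := hstep j; omega
    rw [hsum, hD0] at this
    rw [← Nat.cast_sum] at this
    omega
  refine ⟨hle.trans hDr, fun h => ⟨?_, fun j => ?_⟩⟩
  · rw [← LieSubmodule.toSubmodule_inj]
    exact Submodule.eq_top_of_finrank_eq (le_antisymm hDr (h.trans hle))
  -- A strict inequality at a single step would make the telescoping sum exceed the dimension of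
  -- `M`. Equality makes the kernel coincide with the previous member.
  · have heq : Module.finrank K (kpMod K n (z j)) + D j.castSucc = D j.succ := by
      refine le_antisymm (hstep j) ?_
      by_contra hc
      have hlt : ∑ j, (Module.finrank K (kpMod K n (z j)) : ℤ) <
          ∑ j : Fin r, (D j.succ - D j.castSucc : ℤ) :=
        Finset.sum_lt_sum (fun j _ => by have := hstep j; omega)
          ⟨j, Finset.mem_univ j, by omega⟩
      rw [hsum, hD0, ← Nat.cast_sum] at hlt
      omega
    obtain ⟨κ, h0, h1, h2, h3⟩ := hrank j
    have hκ := Submodule.eq_of_le_of_finrank_eq h1 (by omega)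
    refine inducesIso_of (hφ j) (hmem j) (hsurj j) fun m hm => ?_
    have := h0 ⟨m, hm⟩
    rw [← hκ] at this
    exact this.symm

end ChainDim

/-! ### Dimensions of symmetric and exterior powers -/

section Powers

variable {K : Type*} [Field K] {n : ℕ}

theorem finrank_colMod_le {i : ℕ} (hin : i ≤ n) : Module.finrank K (colMod K n i) ≤ i := by
  let g : colMod K n i →ₗ[K] (Fin i → K) :=
    LinearMap.funLeft K K (Fin.castLE hin) ∘ₗ (colMod K n i).toSubmodule.subtype
  have hg : Function.Injective g := by
    intro v v' h
    refine Subtype.ext (funext fun k => ?_)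
    rcases Nat.lt_or_ge k i with hk | hk
    · exact congrFun h ⟨k, hk⟩
    · rw [v.2 k hk, v'.2 k hk]
  have := LinearMap.finrank_le_finrank_of_injective hg
  rwa [Module.finrank_fin_fun] at this

theorem exists_perm_of_map_eq {ι α : Type*} [Fintype ι] [DecidableEq α] {f g : ι → α}
    (h : Finset.univ.val.map f = Finset.univ.val.map g) :
    ∃ σ : Equiv.Perm ι, ∀ j, f j = g (σ j) := by
  classical
  have hcard : ∀ a, Fintype.card {j // f j = a} = Fintype.card {j // g j = a} := by
    intro a
    have h1 := congrArg (Multiset.count a) h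
    rw [Multiset.count_map, Multiset.count_map] at h1
    rw [Fintype.card_subtype, Fintype.card_subtype]
    simpa only [eq_comm, Finset.card_def, Finset.filter_val] using h1
  refine ⟨(Equiv.sigmaFiberEquiv f).symm.trans ((Equiv.sigmaCongrRight fun a =>
    Fintype.equivOfCardEq (hcard a)).trans (Equiv.sigmaFiberEquiv g)), fun j => ?_⟩
  exact (Subtype.prop (Fintype.equivOfCardEq (hcard (f j)) ⟨j, rfl⟩)).symm

variable {V : Type*} [AddCommGroup V] [Module K V]

/-- Antisymmetrization multiplies an antisymmetric tensor by `d!`, so in characteristic zero such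
tensors lie in the image of the exterior power. An upper bound is enough, because the chain provides
the lower one. -/
theorem finrank_altPow_le [CharZero K] {L : Type*} [LieRing L] [LieAlgebra K L] [LieRingModule L V]
    [LieModule K L V] [FiniteDimensional K V] (d : ℕ) :
    Module.finrank K (altPow K V L d) ≤ (Module.finrank K V).choose d := by
  let A : V [⋀^Fin d]→ₗ[K] (⨂[K]^d V) := MultilinearMap.alternatization (PiTensorProduct.tprod K)
  let g : (⋀[K]^d V) →ₗ[K] (⨂[K]^d V) := exteriorPower.alternatingMapLinearEquiv A
  have hA : ∀ v, A v ∈ LinearMap.range g := fun v =>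
    ⟨exteriorPower.ιMulti K d v, exteriorPower.alternatingMapLinearEquiv_apply_ιMulti A v⟩
  let P : (⨂[K]^d V) →ₗ[K] (⨂[K]^d V) :=
    ∑ σ : Equiv.Perm (Fin d), ((Equiv.Perm.sign σ : ℤ) : K) • permute σ
  have hP : ∀ t, P t ∈ LinearMap.range g := by
    intro t
    induction t using PiTensorProduct.induction_on with
    | smul_tprod r v =>
      rw [map_smul]
      refine Submodule.smul_mem _ _ ?_
      have : P (PiTensorProduct.tprod K v) = A v := by
        simp only [P, A, LinearMap.sum_apply, LinearMap.smul_apply, permute_tprod,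
          MultilinearMap.alternatization_apply, MultilinearMap.domDomCongr_apply]
        refine Fintype.sum_equiv (Equiv.inv _) _ _ fun σ => ?_
        rw [Equiv.inv_apply, Equiv.Perm.sign_inv, Units.smul_def, Int.cast_smul_eq_zsmul]
        rfl
      rw [this]
      exact hA v
    | add a b ha hb => rw [map_add]; exact add_mem ha hb
  have hle : (altPow K V L d).toSubmodule ≤ LinearMap.range g := by
    intro t ht
    have : P t = (Fintype.card (Equiv.Perm (Fin d)) : K) • t := by
      simp only [P, LinearMap.sum_apply, LinearMap.smul_apply]
      rw [Finset.sum_congr rfl fun σ _ => by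
        rw [show permute σ t = _ from ht σ, smul_smul, ← Int.cast_mul, ← Units.val_mul,
          Int.units_mul_self, Units.val_one, Int.cast_one, one_smul]]
      rw [Finset.sum_const, Finset.card_univ, Nat.cast_smul_eq_nsmul]
    have hne : (Fintype.card (Equiv.Perm (Fin d)) : K) ≠ 0 := Nat.cast_ne_zero.mpr Fintype.card_ne_zero
    have h2 := Submodule.smul_mem _ (Fintype.card (Equiv.Perm (Fin d)) : K)⁻¹ (hP t)
    rwa [this, smul_smul, inv_mul_cancel₀ hne, one_smul] at h2
  calc Module.finrank K (altPow K V L d) ≤ Module.finrank K (LinearMap.range g) :=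
        Submodule.finrank_mono hle
    _ ≤ Module.finrank K (⋀[K]^d V) := LinearMap.finrank_range_le g
    _ = _ := exteriorPower.finrank_eq K d

/-- A symmetric tensor is `1 / d!` times its symmetrization, and the symmetrization of a basis
tensor depends only on the multiset of its indices. -/
theorem finrank_symPow_le [CharZero K] {L : Type*} [LieRing L] [LieAlgebra K L] [LieRingModule L V]
    [LieModule K L V] [FiniteDimensional K V] (d : ℕ) :
    Module.finrank K (symPow K V L d) ≤ (Module.finrank K V).multichoose d := by
  classical
  let b := Module.finBasis K V
  let P : (⨂[K]^d V) →ₗ[K] (⨂[K]^d V) := ∑ σ : Equiv.Perm (Fin d), permute σ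
  have hperm : ∀ (f : Fin d → Fin (Module.finrank K V)) (τ : Equiv.Perm (Fin d)),
      P (PiTensorProduct.tprod K fun j => b (f (τ j))) =
        P (PiTensorProduct.tprod K fun j => b (f j)) := by
    intro f τ
    simp only [P, LinearMap.sum_apply, permute_tprod]
    refine Fintype.sum_equiv (Equiv.mulRight τ⁻¹) _ _ fun σ => rfl
  have hrep : ∀ s : Sym (Fin (Module.finrank K V)) d, ∃ f : Fin d → Fin (Module.finrank K V),
      Finset.univ.val.map f = (s : Multiset _) := by
    intro s
    obtain ⟨l, hl⟩ := Quot.exists_rep (s : Multiset (Fin (Module.finrank K V)))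
    have hl' : (l : Multiset (Fin (Module.finrank K V))) = s := hl
    have hlen : l.length = d := by
      rw [← Multiset.coe_card, hl']
      exact s.2
    subst hlen
    refine ⟨l.get, ?_⟩
    rw [← hl', Fin.univ_val_map, List.ofFn_get]
  choose rep hrep using hrep
  let W : Submodule K (⨂[K]^d V) := Submodule.span K (Set.range fun s =>
    P (PiTensorProduct.tprod K fun j => b (rep s j)))
  have hbasis : ∀ f : Fin d → Fin (Module.finrank K V),
      P (PiTensorProduct.tprod K fun j => b (f j)) ∈ W := by
    intro f
    let s : Sym (Fin (Module.finrank K V)) d := ⟨Finset.univ.val.map f, by simp⟩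
    obtain ⟨τ, hτ⟩ := exists_perm_of_map_eq (f := f) (g := rep s) (hrep s).symm
    simp only [hτ]
    change P (PiTensorProduct.tprod K fun j => b (rep s (τ j))) ∈ W
    rw [hperm]
    exact Submodule.subset_span ⟨s, rfl⟩
  have hP : ∀ t, P t ∈ W := by
    intro t
    have ht : t ∈ Submodule.span K (Set.range fun f : Fin d → Fin (Module.finrank K V) =>
        PiTensorProduct.tprod K fun j => b (f j)) := by
      have := (Basis.piTensorProduct fun _ : Fin d => b).span_eq
      have h2 : t ∈ (⊤ : Submodule K (⨂[K]^d V)) := trivial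
      rw [← this] at h2
      refine Submodule.span_mono ?_ h2
      rintro _ ⟨f, rfl⟩
      exact ⟨f, by simp⟩
    induction ht using Submodule.span_induction with
    | mem x hx =>
      obtain ⟨f, rfl⟩ := hx
      exact hbasis f
    | zero => rw [map_zero]; exact zero_mem _
    | add a b _ _ ha hb => rw [map_add]; exact add_mem ha hb
    | smul r a _ ha => rw [map_smul]; exact Submodule.smul_mem _ _ ha
  have hle : (symPow K V L d).toSubmodule ≤ W := by
    intro t ht
    have : P t = (Fintype.card (Equiv.Perm (Fin d)) : K) • t := by
      simp only [P, LinearMap.sum_apply]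
      rw [Finset.sum_congr rfl fun σ _ => show permute σ t = _ from ht σ]
      rw [Finset.sum_const, Finset.card_univ, Nat.cast_smul_eq_nsmul]
    have hne : (Fintype.card (Equiv.Perm (Fin d)) : K) ≠ 0 := Nat.cast_ne_zero.mpr Fintype.card_ne_zero
    have h2 := Submodule.smul_mem _ (Fintype.card (Equiv.Perm (Fin d)) : K)⁻¹ (hP t)
    rwa [this, smul_smul, inv_mul_cancel₀ hne, one_smul] at h2
  calc Module.finrank K (symPow K V L d) ≤ Module.finrank K W := Submodule.finrank_mono hle
    _ ≤ Fintype.card (Sym (Fin (Module.finrank K V)) d) := finrank_range_le_card _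
    _ = _ := by rw [Sym.card_sym_eq_multichoose, Fintype.card_fin]

end Powers

end KP
end

noncomputable section
namespace KP

/-! ### Contractions and permutations of columns -/

section Contraction

variable {K X : Type*} [Field K]

/-- The contraction with a coordinate function. -/
def contr (x : X) : Module.End K (ExteriorAlgebra K (X →₀ K)) :=
  CliffordAlgebra.contractLeft (Finsupp.lapply x)

theorem contr_gen_mul (x y : X) (b : ExteriorAlgebra K (X →₀ K)) :
    contr x (gen K y * b) = (Finsupp.single y (1 : K) x) • b - gen K y * contr x b :=
  CliffordAlgebra.contractLeft_ι_mul _ _ _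

theorem contr_genProd_of_notMem {x : X} {l : List X} (h : x ∉ l) : contr x (genProd K l) = 0 := by
  induction l with
  | nil => exact CliffordAlgebra.contractLeft_one _ _
  | cons y l ih =>
    rw [List.mem_cons, not_or] at h
    rw [genProd_cons, contr_gen_mul, ih h.2, mul_zero, sub_zero,
      Finsupp.single_eq_of_ne h.1, zero_smul]

theorem IsMon.contr_of_notMem {D : Set X} {y : ExteriorAlgebra K (X →₀ K)} (h : IsMon D y) {x : X}
    (hx : x ∉ D) : contr x y = 0 := by
  obtain ⟨l, -, hD, c, -, rfl⟩ := h
  rw [map_smul, contr_genProd_of_notMem fun h => hx ((hD x).mp h), smul_zero]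

theorem IsMon.contr_of_mem {D : Set X} {y : ExteriorAlgebra K (X →₀ K)} (h : IsMon D y) {x : X}
    (hx : x ∈ D) : IsMon (D \ {x}) (contr x y) := by
  classical
  have h' := h
  obtain ⟨l, hl, hD, -⟩ := h'
  have hmem : x ∈ l := (hD x).mpr hx
  have hl' := List.perm_cons_erase hmem
  obtain ⟨c, hc, rfl⟩ := h.of_list (hl'.nodup_iff.mp hl) fun z =>
    (hl'.mem_iff (a := z)).symm.trans (hD z)
  refine ⟨l.erase x, hl.erase x, fun z => ?_, c, hc, ?_⟩
  · rw [hl.mem_erase_iff, hD, Set.mem_sdiff, Set.mem_singleton_iff, and_comm]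
  · rw [map_smul, genProd_cons, contr_gen_mul, contr_genProd_of_notMem, Finsupp.single_eq_same,
      one_smul, mul_zero, sub_zero]
    exact fun h => (hl.mem_erase_iff.mp h).1 rfl

/-- The commutator of a contraction with the derivation of `f` is the contraction with the transpose
of `f` applied to `δ`. -/
theorem contractLeft_deriv (f : Module.End K (X →₀ K)) (δ : Module.Dual K (X →₀ K))
    (y : ExteriorAlgebra K (X →₀ K)) :
    CliffordAlgebra.contractLeft δ (deriv f y) = deriv f (CliffordAlgebra.contractLeft δ y) +
      CliffordAlgebra.contractLeft (δ ∘ₗ f) y := by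
  induction y using CliffordAlgebra.left_induction with
  | algebraMap r =>
    have h := deriv_algebraMap (V := X →₀ K) f r
    rw [CliffordAlgebra.contractLeft_algebraMap, CliffordAlgebra.contractLeft_algebraMap]
    erw [h]
    simp
  | add a b ha hb => simp only [map_add, ha, hb]; abel
  | ι_mul b a hb =>
    have h1 : deriv f (CliffordAlgebra.ι 0 a * b) = CliffordAlgebra.ι 0 (f a) * b +
        CliffordAlgebra.ι 0 a * deriv f b := by
      have := deriv_mul f (ExteriorAlgebra.ι K a) b
      rwa [deriv_ι] at this
    have h2 : deriv f (CliffordAlgebra.ι 0 a * CliffordAlgebra.contractLeft δ b) =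
        CliffordAlgebra.ι 0 (f a) * CliffordAlgebra.contractLeft δ b +
        CliffordAlgebra.ι 0 a * deriv f (CliffordAlgebra.contractLeft δ b) := by
      have := deriv_mul f (ExteriorAlgebra.ι K a) (CliffordAlgebra.contractLeft δ b)
      rwa [deriv_ι] at this
    rw [h1, map_add, CliffordAlgebra.contractLeft_ι_mul, CliffordAlgebra.contractLeft_ι_mul,
      CliffordAlgebra.contractLeft_ι_mul, CliffordAlgebra.contractLeft_ι_mul, map_sub, map_smul,
      h2, hb, mul_add]
    simp only [LinearMap.comp_apply]
    abel

/-- The algebra automorphism induced by a permutation of the basis. -/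
def relabel (e : Equiv.Perm X) : ExteriorAlgebra K (X →₀ K) →ₐ[K] ExteriorAlgebra K (X →₀ K) :=
  ExteriorAlgebra.map (Finsupp.lmapDomain K K e)

theorem relabel_gen (e : Equiv.Perm X) (x : X) : relabel e (gen K x) = gen K (e x) := by
  rw [relabel, gen, ExteriorAlgebra.map_apply_ι, Finsupp.lmapDomain_apply,
    Finsupp.mapDomain_single, gen]

theorem relabel_genProd (e : Equiv.Perm X) (l : List X) :
    relabel e (genProd K l) = genProd K (l.map e) := by
  induction l with
  | nil => exact map_one _
  | cons x l ih => rw [genProd_cons, map_mul, relabel_gen, ih, List.map_cons, genProd_cons]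

theorem IsMon.relabel {D : Set X} {y : ExteriorAlgebra K (X →₀ K)} (h : IsMon D y)
    (e : Equiv.Perm X) : IsMon {x | e.symm x ∈ D} (relabel e y) := by
  obtain ⟨l, hl, hD, c, hc, rfl⟩ := h
  refine ⟨l.map e, hl.map e.injective, fun x => ?_, c, hc, by rw [map_smul, relabel_genProd]⟩
  rw [Set.mem_ofPred_eq, ← hD, List.mem_map]
  constructor
  · rintro ⟨z, hz, rfl⟩
    rwa [Equiv.symm_apply_apply]
  · exact fun h => ⟨_, h, Equiv.apply_symm_apply _ _⟩

theorem relabel_deriv {f : Module.End K (X →₀ K)} {e : Equiv.Perm X}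
    (h : ∀ v, f (Finsupp.lmapDomain K K e v) = Finsupp.lmapDomain K K e (f v))
    (y : ExteriorAlgebra K (X →₀ K)) : relabel e (deriv f y) = deriv f (relabel e y) := by
  induction y using ExteriorAlgebra.induction with
  | algebraMap r => rw [deriv_algebraMap, map_zero, AlgHom.commutes, deriv_algebraMap]
  | ι v =>
    rw [deriv_ι, relabel, ExteriorAlgebra.map_apply_ι, ExteriorAlgebra.map_apply_ι, deriv_ι, h]
  | mul a b ha hb => rw [deriv_mul, map_add, map_mul, map_mul, ha, hb, map_mul, deriv_mul]
  | add a b ha hb => rw [map_add, map_add, ha, hb, map_add, map_add]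

end Contraction

/-! ### Column exchanges and contractions as maps of `𝔟`-modules -/

section Columns

variable {K : Type*} [Field K] {n : ℕ}

variable (n) in
/-- The exchange of two columns. -/
def colSwap (r s : ℕ) : Equiv.Perm (Fin n × ℕ) := Equiv.prodCongr (Equiv.refl _) (Equiv.swap r s)

theorem isMon_colSwap {P : ℕ → ℕ → Prop} {y : T K n} (h : IsMon (boxes n P) y) (r s : ℕ) :
    IsMon (boxes n fun a b => P a (Equiv.swap r s b)) (relabel (colSwap n r s) y) := by
  have := h.relabel (colSwap n r s)
  convert this using 2
  ext ⟨a, b⟩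
  change P a (Equiv.swap r s b) ↔ P a ((Equiv.swap r s).symm b)
  rw [Equiv.symm_swap]

theorem colSwap_lie (r s : ℕ) (x : borel K n) (y : T K n) :
    relabel (colSwap n r s) ⁅x, y⁆ = ⁅x, relabel (colSwap n r s) y⁆ := by
  refine relabel_deriv (fun v => ?_) y
  change (rowAct K n x.1 ∘ₗ Finsupp.lmapDomain K K (colSwap n r s)) v =
    (Finsupp.lmapDomain K K (colSwap n r s) ∘ₗ rowAct K n x.1) v
  refine LinearMap.congr_fun (Finsupp.lhom_ext' fun z => LinearMap.ext_ring ?_) v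
  change rowAct K n x.1 (Finsupp.lmapDomain K K (colSwap n r s) (Finsupp.single z 1)) =
    Finsupp.lmapDomain K K (colSwap n r s) (rowAct K n x.1 (uBasis K z.1 z.2))
  rw [Finsupp.lmapDomain_apply, Finsupp.mapDomain_single, rowAct_uBasis, map_sum]
  refine (rowAct_uBasis K n x.1 z.1 (Equiv.swap r s z.2)).trans ?_
  refine Finset.sum_congr rfl fun p _ => ?_
  rw [map_smul, uBasis, uBasis, Finsupp.lmapDomain_apply, Finsupp.mapDomain_single]
  rfl

theorem contr_lie (x : borel K n) (z : Fin n × ℕ) (y : T K n) :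
    contr z ⁅x, y⁆ = ⁅x, contr z y⁆ + ∑ a, x.1 z.1 a • contr (a, z.2) y := by
  have e : (Finsupp.lapply z : U K n →ₗ[K] K) ∘ₗ rowAct K n x.1 =
      ∑ a, x.1 z.1 a • (Finsupp.lapply (a, z.2) : U K n →ₗ[K] K) := by
    refine Finsupp.lhom_ext' fun t => LinearMap.ext_ring ?_
    change (Finsupp.lapply z : U K n →ₗ[K] K) (rowAct K n x.1 (uBasis K t.1 t.2)) =
      (∑ a, x.1 z.1 a • (Finsupp.lapply (a, z.2) : U K n →ₗ[K] K)) (uBasis K t.1 t.2)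
    rw [rowAct_uBasis, map_sum, LinearMap.sum_apply]
    simp only [map_smul, LinearMap.smul_apply, Finsupp.lapply_apply, uBasis, Finsupp.single_apply,
      Prod.mk.injEq, smul_eq_mul, mul_ite, mul_one, mul_zero]
    obtain ⟨z1, z2⟩ := z
    simp only [Prod.mk.injEq]
    by_cases h : t.2 = z2
    · simp [h]
    · simp [h]
  rw [lie_eq_deriv, contr, contractLeft_deriv, e, map_sum, LinearMap.sum_apply]
  congr 1
  refine Finset.sum_congr rfl fun a _ => ?_
  rw [map_smul]
  rfl

variable (K n) in
/-- The elements of `T` that involve only the rows `≤ r`. -/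
def lowRows (r : ℕ) : LieSubmodule K (borel K n) (T K n) where
  carrier := {y | ∀ z : Fin n × ℕ, r < z.1 → contr z y = 0}
  add_mem' := by
    intro a b ha hb z hz
    rw [map_add, ha z hz, hb z hz, add_zero]
  zero_mem' := fun z _ => map_zero _
  smul_mem' := by
    intro c a ha z hz
    rw [map_smul, ha z hz, smul_zero]
  lie_mem := by
    intro x y hy z hz
    rw [contr_lie, hy z hz, lie_zero, zero_add]
    refine Finset.sum_eq_zero fun a _ => ?_
    rcases Nat.lt_or_ge a z.1 with h | h
    · rw [x.2 (show id a < id z.1 from h), zero_smul]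
    · rw [hy (a, z.2) (lt_of_lt_of_le hz h), smul_zero]

/-- Of the sum in `contr_lie`, rows above `r` drop out because `x` is upper triangular and rows
below `r` because `y` does not involve them. What is left is equivariance twisted by the character
`x ↦ x_{rr}`. -/
theorem contr_lie_of_lowRows {r : Fin n} {s : ℕ} (x : borel K n) {y : T K n}
    (hy : y ∈ lowRows K n r) : contr (r, s) ⁅x, y⁆ = ⁅x, contr (r, s) y⁆ +
      x.1 r r • contr (r, s) y := by
  rw [contr_lie, Finset.sum_eq_single r]
  · intro a _ ha
    rcases lt_or_gt_of_ne ha with h | h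
    · rw [x.2 (show id a < id r from h), zero_smul]
    · rw [hy (a, s) h, smul_zero]
  · simp

end Columns

end KP
end

noncomputable section
namespace KP

/-! ### A transition inequality for the dimensions of the KP modules -/

section LastDescents

theorem permSet_mono {m n : ℕ} (h : m ≤ n) {w : Equiv.Perm ℕ} (hw : w ∈ permSet m) :
    w ∈ permSet n :=
  ⟨hw.1, hw.2.mono (Set.Ici_subset_Ici.mpr h)⟩

/-- The data of the last descent `r` of `w` and of the last position `s` with `w s < w r`. -/
structure LastDescent (w : Equiv.Perm ℕ) (r s : ℕ) : Prop where
  mem : w ∈ permSet (r + 1)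
  lt : r < s
  apply_lt : w s < w r
  apply_gt : ∀ j, s < j → w r < w j

theorem exists_lastDescent {w : Equiv.Perm ℕ} {r : ℕ} (hw : w ∈ permSet (r + 1))
    (h : w (r + 1) < w r) : ∃ s, LastDescent w r s := by
  have hfin : {j | w j < w r}.Finite :=
    ((Set.finite_Iio (w r)).preimage w.injective.injOn).subset fun j hj => hj
  obtain ⟨s, hs, hmax⟩ := Set.exists_max_image _ id hfin ⟨r + 1, h⟩
  have hrs : r + 1 ≤ s := hmax (r + 1) h
  refine ⟨s, hw, by omega, hs, fun j hj => ?_⟩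
  by_contra hc
  have hne : w j ≠ w r := fun e => by
    have := w.injective e
    omega
  have := hmax j (show w j < w r by omega)
  simp only [id] at this
  omega

variable {w : Equiv.Perm ℕ} {r s : ℕ}

theorem LastDescent.lt_iff (h : LastDescent w r s) {j : ℕ} (hj : r < j) : w j < w s ↔ j < s :=
  h.mem.2.lt_iff_lt (show j ∈ Set.Ici (r + 1) from hj) (show s ∈ Set.Ici (r + 1) from h.lt)

theorem LastDescent.apply_lt_iff (h : LastDescent w r s) {j : ℕ} (hj : r < j) :
    w j < w r ↔ j ≤ s := by
  have h1 := h.lt_iff hj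
  have h2 := h.apply_lt
  constructor
  · intro hlt
    by_contra hc
    have := h.apply_gt j (by omega)
    omega
  · intro hle
    rcases Nat.lt_or_ge j s with h3 | h3
    · omega
    · rw [show j = s by omega]
      exact h2

theorem LastDescent.lt_of_lt (h : LastDescent w r s) {a b : ℕ} (ha : r < a) (hb : a < b) :
    w a < w b :=
  h.mem.2 (show a ∈ Set.Ici (r + 1) from ha) (show b ∈ Set.Ici (r + 1) from ha.trans hb) hb

theorem LastDescent.lower_mem (h : LastDescent w r s) :
    w * Equiv.swap r s ∈ permSet (r + 1) := by
  obtain ⟨N, hN⟩ := exists_small h.mem.1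
  refine ⟨((hN.mono (show N ≤ N + r + s + 1 by omega)).mul
    (small_swap (by omega) (by omega))).finite, fun a ha b hb hab => ?_⟩
  rw [Set.mem_Ici] at ha hb
  have h1 := h.lt_of_lt (show r < a by omega) hab
  have h2 := h.apply_lt
  have h3 := h.apply_lt_iff (show r < a by omega)
  have h4 := h.apply_gt b
  rw [Equiv.Perm.mul_apply, Equiv.Perm.mul_apply, Equiv.swap_apply_def, Equiv.swap_apply_def,
    if_neg (show a ≠ r by omega), if_neg (show b ≠ r by omega)]
  split_ifs <;> grind

theorem LastDescent.lower_apply (w : Equiv.Perm ℕ) (r s j : ℕ) :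
    (w * Equiv.swap r s) j = if j = r then w s else if j = s then w r else w j := by
  rw [Equiv.Perm.mul_apply, Equiv.swap_apply_def]
  split_ifs <;> rfl

/-- To the right of `r`, positions before `s` carry values below `w s`, and positions after `s`
carry values above `w r`, which now sits at `s` and blocks them. -/
theorem LastDescent.cov_lower (h : LastDescent w r s) {q : ℕ} (hq : r < q) :
    Cov (w * Equiv.swap r s) r q ↔ q = s := by
  have h1 := h.apply_lt
  have h2 := h.lt
  constructor
  · rintro ⟨-, e1, e2⟩
    have e3 := e2 s h2
    have e4 := h.apply_gt q
    have e5 := h.lt_iff hq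
    simp only [LastDescent.lower_apply] at e1 e3
    grind
  · rintro rfl
    refine ⟨h2, ?_, fun j j1 j2 j3 => ?_⟩
    · simp only [LastDescent.lower_apply]
      grind
    · have e5 := h.lt_iff j1
      simp only [LastDescent.lower_apply] at j3 ⊢
      grind

theorem LastDescent.invBox_lower (h : LastDescent w r s) (a b : ℕ) :
    InvBox (w * Equiv.swap r s) a b ↔
      InvBox w a (Equiv.swap r s b) ∧ ¬ (a = r ∧ Equiv.swap r s b = s) := by
  have h1 := h.apply_lt
  have h2 := h.lt
  have a1 : r < a → _ := fun e => h.apply_lt_iff e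
  have a2 : r < a → _ := fun e => h.lt_iff e
  have b1 : r < b → _ := fun e => h.apply_lt_iff e
  have b2 : r < b → _ := fun e => h.lt_iff e
  have ab : r < a → a < b → w a < w b := h.lt_of_lt
  have i1 : w a = w r → a = r := fun e => w.injective e
  have i2 : w a = w s → a = s := fun e => w.injective e
  simp only [InvBox, LastDescent.lower_apply, Equiv.swap_apply_def]
  clear h
  grind

/-- The right side is the effect on the diagram of `w` of the maximal powers of `e_{pr}` and
`e'_{sp}`, followed by the exchange of columns `r` and `s`: the maps used in
`LastDescent.finrank_le`. -/
theorem LastDescent.invBox_cross (h : LastDescent w r s) {p : ℕ}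
    (hc : Cov (w * Equiv.swap r s) p r) (a b : ℕ) :
    InvBox (w * Equiv.swap r s * Equiv.swap p r) a b ↔
      colMoved (rowMoved (InvBox w) p r) s p a (Equiv.swap r s b) := by
  have h1 := h.apply_lt
  have h2 := h.lt
  obtain ⟨hp, c2, c3⟩ := hc
  have ca := c3 a
  have cb := c3 b
  have a1 : r < a → _ := fun e => h.apply_lt_iff e
  have a2 : r < a → _ := fun e => h.lt_iff e
  have b1 : r < b → _ := fun e => h.apply_lt_iff e
  have b2 : r < b → _ := fun e => h.lt_iff e
  have ab : r < a → a < b → w a < w b := h.lt_of_lt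
  have i1 : w a = w r → a = r := fun e => w.injective e
  have i2 : w a = w s → a = s := fun e => w.injective e
  have i3 : w a = w p → a = p := fun e => w.injective e
  have j1 : w b = w r → b = r := fun e => w.injective e
  have j2 : w b = w s → b = s := fun e => w.injective e
  have j3 : w b = w p → b = p := fun e => w.injective e
  rw [InvBox, Equiv.Perm.mul_apply, Equiv.Perm.mul_apply (w * _)]
  simp only [LastDescent.lower_apply] at c2 ca cb ⊢
  simp only [colMoved, rowMoved, InvBox, Equiv.swap_apply_def]
  clear h c3
  by_cases e1 : a = p
  · grind
  · by_cases e2 : a = r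
    · grind
    · grind

/-- The row `p'` is counted by `mLeft w s p`, since the cover `(p', r)` forces `w p < w p' < w s`.
It is not counted on the left, because the row move has brought the box `(r, s)` to `(p', s)`. This
makes the maps and vectors for different `p` triangular. -/
theorem LastDescent.ncard_lt (h : LastDescent w r s) {n p p' : ℕ}
    (hc : Cov (w * Equiv.swap r s) p r) (hc' : Cov (w * Equiv.swap r s) p' r) (hlt : p' < p) :
    Set.ncard {a | a < n ∧ rowMoved (InvBox w) p' r a p ∧ ¬ rowMoved (InvBox w) p' r a s} <
      mLeft w s p := by
  have h1 := h.apply_lt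
  have h2 := h.lt
  obtain ⟨hp, c2, -⟩ := hc
  obtain ⟨hp', c2', c3'⟩ := hc'
  have c4 := c3' p hlt hp
  simp only [LastDescent.lower_apply] at c2 c2' c4
  have i1 : w p = w p' → p = p' := fun e => w.injective e
  unfold mLeft
  refine Set.ncard_lt_ncard ?_ ((Set.finite_Iio p).subset fun a ha => ha.1)
  rw [Set.ssubset_iff_of_subset]
  · refine ⟨p', ⟨hlt, by grind, by grind⟩, ?_⟩
    rintro ⟨-, -, h3⟩
    refine h3 (Or.inr ⟨rfl, ⟨h2, h1⟩, ?_⟩)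
    rintro ⟨-, h4⟩
    grind
  · rintro a ⟨-, h3, h4⟩
    have i2 : w a = w s → a = s := fun e => w.injective e
    simp only [rowMoved, InvBox] at h3 h4
    simp only [Set.mem_ofPred_eq]
    grind

theorem LastDescent.ncard_eq (h : LastDescent w r s) {n p : ℕ} (hr : r < n)
    (hc : Cov (w * Equiv.swap r s) p r) :
    Set.ncard {a | a < n ∧ rowMoved (InvBox w) p r a p ∧ ¬ rowMoved (InvBox w) p r a s} =
      mLeft w s p := by
  have h1 := h.apply_lt
  have h2 := h.lt
  obtain ⟨hp, c2, -⟩ := hc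
  simp only [LastDescent.lower_apply] at c2
  unfold mLeft
  congr 1
  ext a
  have i2 : w a = w s → a = s := fun e => w.injective e
  simp only [rowMoved, InvBox, Set.mem_ofPred_eq]
  grind

end LastDescents

/-! ### The transition inequality for dimensions -/

section Transition

variable {K : Type*} [Field K] {n : ℕ} {w : Equiv.Perm ℕ} {r s : ℕ}

theorem IsMon.congr_boxes {P Q : ℕ → ℕ → Prop} {y : T K n} (h : IsMon (boxes n P) y)
    (hPQ : ∀ a b, Q a b ↔ P a b) : IsMon (boxes n Q) y := by
  rwa [show Q = P from funext fun a => funext fun b => propext (hPQ a b)]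

theorem rowOp_pow_mem_kpMod (p q m : ℕ) : (rowOp K n p q ^ m) (uVec K n w) ∈ kpMod K n w := by
  rw [← show ((kpGen K n w : kpMod K n w) : T K n) = uVec K n w from rfl, ← coe_toEnd_pow]
  exact Subtype.prop _

theorem uVec_mem_lowRows (hw : w ∈ permSet (r + 1)) : uVec K n w ∈ lowRows K n r := fun _ hz =>
  (isMon_uVec w).contr_of_notMem fun hz' => not_invBox_of_permSet hw (show r + 1 ≤ _ from hz) hz'

theorem kpMod_le_lowRows (hw : w ∈ permSet (r + 1)) : kpMod K n w ≤ lowRows K n r := by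
  rw [kpMod, LieSubmodule.lieSpan_le, Set.singleton_subset_iff]
  exact uVec_mem_lowRows hw

/-- Contraction with `u_{rs}` followed by the exchange of columns `r` and `s` sends `u_w` to a
multiple of `u_v`, `v = w t_{rs}`, so its image has at least the dimension of `𝒮_v`. Its kernel
contains the vectors `e_{pr}^m u_w`, which have lost the box `(r, s)`; `chain_dimension` applied to
them gives the contribution of the `v t_{pr}`. -/
theorem LastDescent.finrank_le [CharZero K] (h : LastDescent w r s) (hr : r < n) {P : Finset ℕ}
    (hP : ∀ p ∈ P, Cov (w * Equiv.swap r s) p r) :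
    Module.finrank K (kpMod K n (w * Equiv.swap r s)) +
      ∑ p ∈ P, Module.finrank K (kpMod K n (w * Equiv.swap r s * Equiv.swap p r)) ≤
      Module.finrank K (kpMod K n w) := by
  have hwn := permSet_mono (show r + 1 ≤ n from hr) h.mem
  set κ : Module.End K (T K n) := contr (⟨r, hr⟩, s) with hκ
  have hlow := kpMod_le_lowRows (K := K) (n := n) h.mem
  have hκlie : ∀ (x : borel K n) (y : T K n), y ∈ kpMod K n w →
      κ ⁅x, y⁆ = ⁅x, κ y⁆ + x.1 ⟨r, hr⟩ ⟨r, hr⟩ • κ y := fun x y hy =>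
    contr_lie_of_lowRows (r := ⟨r, hr⟩) x (hlow hy)
  let N : LieSubmodule K (borel K n) (T K n) :=
    { carrier := {y | y ∈ kpMod K n w ∧ κ y = 0}
      add_mem' := fun {a b} ha hb =>
        ⟨add_mem ha.1 hb.1, by rw [map_add, ha.2, hb.2, add_zero]⟩
      zero_mem' := ⟨zero_mem _, map_zero _⟩
      smul_mem' := fun c y hy =>
        ⟨(kpMod K n w).smul_mem c hy.1, by rw [map_smul, hy.2, smul_zero]⟩
      lie_mem := fun {x y} hy =>
        ⟨(kpMod K n w).lie_mem hy.1, by rw [hκlie x y hy.1, hy.2, lie_zero, smul_zero, add_zero]⟩ }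
  have hN : ∀ y, y ∈ N ↔ y ∈ kpMod K n w ∧ κ y = 0 := fun y => Iff.rfl
  have hNle : N.toSubmodule ≤ (kpMod K n w).toSubmodule := fun y hy => hy.1
  have : FiniteDimensional K (kpMod K n w).toSubmodule := kpMod_finite w
  have hNfin : FiniteDimensional K N := Submodule.finiteDimensional_of_le hNle
  have hcov : ∀ p ∈ P, p < r ∧ w p < w s := fun p hp => by
    obtain ⟨h1, h2, -⟩ := hP p hp
    have := h.lt
    simp only [LastDescent.lower_apply] at h2
    rw [if_neg (by omega), if_neg (by omega), if_pos trivial] at h2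
    exact ⟨h1, h2⟩
  have hmon : ∀ p ∈ P, IsMon (boxes n (rowMoved (InvBox w) p r))
      ((rowOp K n p r ^ mRight w p r) (uVec K n w)) := fun p hp =>
    (rowOp_mRight hwn (by have := hcov p hp; omega) (hcov p hp).1 (isMon_uVec w)
      (fun _ _ _ _ => Iff.rfl) fun b hb => hb.1).1
  have hxN : ∀ p ∈ P, (rowOp K n p r ^ mRight w p r) (uVec K n w) ∈ N := by
    intro p hp
    refine (hN _).mpr ⟨rowOp_pow_mem_kpMod p r _, (hmon p hp).contr_of_notMem ?_⟩
    have h1 := hcov p hp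
    have h2 := h.lt
    have h3 := h.apply_lt
    change ¬ rowMoved (InvBox w) p r r s
    unfold rowMoved InvBox
    omega
  -- The crossings are taken in increasing order, as `LastDescent.ncard_lt` requires.
  let e := P.orderEmbOfFin rfl
  have he : ∀ j, e j ∈ P := fun j => P.orderEmbOfFin_mem rfl j
  let v : Fin P.card → N := fun j => ⟨_, hxN (e j) (he j)⟩
  let φ : Fin P.card → N →ₗ[K] T K n := fun j =>
    (relabel (colSwap n r s)).toLinearMap ∘ₗ (colOp K n s (e j) ^ mLeft w s (e j)) ∘ₗ
      N.toSubmodule.subtype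
  have hφlie : ∀ j (x : borel K n) m, φ j ⁅x, m⁆ = ⁅x, φ j m⁆ := by
    intro j x m
    have h1 : Commute (colOp K n s (e j) ^ mLeft w s (e j)) (deriv (rowAct K n x.1)) :=
      Commute.pow_left (commute_deriv (rowAct_comm_colMap _ _ _).symm) _
    change relabel (colSwap n r s) ((colOp K n s (e j) ^ mLeft w s (e j)) ⁅x, (m : T K n)⁆) = _
    rw [show (colOp K n s (e j) ^ mLeft w s (e j)) ⁅x, (m : T K n)⁆ =
      ⁅x, (colOp K n s (e j) ^ mLeft w s (e j)) (m : T K n)⁆ from LinearMap.congr_fun h1.eq m,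
      colSwap_lie]
    rfl
  have hsum := (chain_dimension (v := v) (φ := φ)
    (z := fun j => w * Equiv.swap r s * Equiv.swap (e j) r) hφlie (fun j => ?_)
    (fun j k hkj => ?_)).1
  · have hsum' : ∑ p ∈ P, Module.finrank K (kpMod K n (w * Equiv.swap r s * Equiv.swap p r)) ≤
        Module.finrank K N := by
      refine le_of_eq_of_le ?_ hsum
      rw [← Finset.sum_coe_sort P]
      exact (Equiv.sum_comp (P.orderIsoOfFin rfl).toEquiv fun p : P =>
        Module.finrank K (kpMod K n (w * Equiv.swap r s * Equiv.swap (p : ℕ) r))).symm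
    let g : kpMod K n w →ₗ[K] T K n :=
      (relabel (colSwap n r s)).toLinearMap ∘ₗ κ ∘ₗ (kpMod K n w).toSubmodule.subtype
    have hg : ∀ y : kpMod K n w, g y = relabel (colSwap n r s) (κ y) := fun y => rfl
    have h1 := LinearMap.finrank_range_add_finrank_ker g
    have h2 : Module.finrank K N ≤ Module.finrank K (LinearMap.ker g) := by
      refine le_of_eq_of_le (Submodule.comapSubtypeEquivOfLe hNle).finrank_eq.symm ?_
      refine Submodule.finrank_mono fun y hy => ?_
      rw [LinearMap.mem_ker, hg, ((hN y).mp hy).2, map_zero]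
    have h3 : Module.finrank K (kpMod K n (w * Equiv.swap r s)) ≤
        Module.finrank K (LinearMap.range g) := by
      let L : LieSubmodule K (borel K n) (T K n) :=
        { LinearMap.range g with
          lie_mem := by
            rintro x _ ⟨y, rfl⟩
            -- The subtracted term compensates the character by which the contraction fails to be
            -- equivariant.
            refine ⟨⁅x, y⁆ - x.1 ⟨r, hr⟩ ⟨r, hr⟩ • y, ?_⟩
            rw [map_sub, map_smul, hg, hg, LieSubmodule.coe_bracket, hκlie x _ y.2, map_add,
              map_smul, add_sub_cancel_right, colSwap_lie] }
      have hle : kpMod K n (w * Equiv.swap r s) ≤ L := by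
        rw [kpMod, LieSubmodule.lieSpan_le, Set.singleton_subset_iff]
        have hm : IsMon (boxes n (InvBox (w * Equiv.swap r s))) (g (kpGen K n w)) := by
          have h4 : IsMon (boxes n fun a b => InvBox w a b ∧ ¬ (a = r ∧ b = s))
              (κ (uVec K n w)) := by
            have := (isMon_uVec (K := K) (n := n) w).contr_of_mem (x := (⟨r, hr⟩, s))
              ⟨h.lt, h.apply_lt⟩
            convert this using 1
            ext ⟨a, b⟩
            simp [boxes, Fin.ext_iff]
          have h5 := isMon_colSwap h4 r s
          exact h5.congr_boxes h.invBox_lower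
        obtain ⟨c, -, e⟩ := (isMon_uVec (K := K) (n := n) (w * Equiv.swap r s)).smul_eq hm
        rw [SetLike.mem_coe, e]
        exact L.smul_mem c ⟨_, rfl⟩
      exact Submodule.finrank_mono (s := (kpMod K n (w * Equiv.swap r s)).toSubmodule)
        (t := LinearMap.range g) hle
    change Module.finrank K _ + Module.finrank K _ = Module.finrank K (kpMod K n w) at h1
    omega
  · have hp := he j
    have h1 := (colOp_pow (hmon _ hp) (p := e j) (q := s)
      (by have := hcov _ hp; have := h.lt; omega)).1
    rw [h.ncard_eq hr (hP _ hp)] at h1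
    have h2 := isMon_colSwap h1 r s
    refine IsMon.smul_eq (D := boxes n (InvBox (w * Equiv.swap r s * Equiv.swap (e j) r))) ?_
      (isMon_uVec _)
    exact h2.congr_boxes (h.invBox_cross (hP _ hp))
  · have hlt : e k < e j := (P.orderEmbOfFin rfl).strictMono hkj
    have h1 := (colOp_pow (hmon _ (he k)) (p := e j) (q := s)
      (by have := hcov _ (he j); have := h.lt; omega)).2 _
        (h.ncard_lt (hP _ (he j)) (hP _ (he k)) hlt)
    change relabel (colSwap n r s) ((colOp K n s (e j) ^ mLeft w s (e j))
      ((rowOp K n (e k) r ^ mRight w (e k) r) (uVec K n w))) = 0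
    rw [h1, map_zero]

end Transition

end KP
end

noncomputable section
namespace KP

/-! ### Enumerations of the two sets of permutations -/

section Enumeration

theorem exists_enum {α β : Type*} [LinearOrder β] {S : Set α} (hS : S.Finite) {key : α → β}
    (hkey : Set.InjOn key S) :
    ∃ (r : ℕ) (ζ : Fin r → α), Set.range ζ = S ∧ ∀ a b, a < b → key (ζ a) < key (ζ b) := by
  classical
  let T := hS.toFinset.image key
  have hT : ∀ j, ∃ a ∈ S, key a = T.orderEmbOfFin rfl j := fun j => by
    obtain ⟨a, ha, h⟩ := Finset.mem_image.mp (T.orderEmbOfFin_mem rfl j)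
    exact ⟨a, hS.mem_toFinset.mp ha, h⟩
  choose ζ hζS hζ using hT
  refine ⟨T.card, ζ, Set.Subset.antisymm (Set.range_subset_iff.mpr hζS) fun a ha => ?_,
    fun a b hab => ?_⟩
  · have h1 : key a ∈ Set.range (T.orderEmbOfFin rfl) := by
      rw [Finset.range_orderEmbOfFin]
      exact Finset.mem_coe.mpr (Finset.mem_image_of_mem _ (hS.mem_toFinset.mpr ha))
    obtain ⟨j, hj⟩ := h1
    exact ⟨j, hkey (hζS j) ha ((hζ j).trans hj)⟩
  · rw [hζ, hζ]
    exact (T.orderEmbOfFin rfl).strictMono hab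

theorem exists_lexLt_enum {S : Set (Equiv.Perm ℕ)} (hS : S.Finite) (w : Equiv.Perm ℕ) :
    ∃ (r : ℕ) (ζ : Fin r → Equiv.Perm ℕ), Set.range ζ = S ∧
      ∀ a b, a < b → LexLt (w * ζ a)⁻¹ (w * ζ b)⁻¹ := by
  refine exists_enum hS (key := fun ζ => toLex fun k => (w * ζ)⁻¹ k) fun ζ _ ζ' _ h => ?_
  exact mul_left_cancel (inv_injective (Equiv.ext fun k => congrFun (toLex.injective h) k))

theorem exists_revLexLt_enum {S : Set (Equiv.Perm ℕ)} (hS : S.Finite) {w : Equiv.Perm ℕ} {N : ℕ}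
    (hN : ∀ ζ ∈ S, Small (N + 1) (w * ζ)) :
    ∃ (r : ℕ) (ζ : Fin r → Equiv.Perm ℕ), Set.range ζ = S ∧
      ∀ a b, a < b → RevLexLt (w * ζ a)⁻¹ (w * ζ b)⁻¹ := by
  -- All these permutations fix the points beyond `N`, so reading the values from `N` downwards
  -- turns the reverse lexicographic order into the lexicographic one.
  obtain ⟨r, ζ, hζ, h⟩ := exists_enum hS (key := fun ζ => toLex fun k => (w * ζ)⁻¹ (N - k))
    fun ζ h1 ζ' h2 h => by
      refine mul_left_cancel (inv_injective (Equiv.ext fun k => ?_) : w * ζ = w * ζ')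
      rcases Nat.lt_or_ge N k with hk | hk
      · rw [(hN ζ h1).inv k hk, (hN ζ' h2).inv k hk]
      · have := congrFun (toLex.injective h) (N - k)
        simpa only [Nat.sub_sub_self hk] using this
  refine ⟨r, ζ, hζ, fun a b hab => ?_⟩
  obtain ⟨k, hk, hlt⟩ := h a b hab
  refine ⟨N - k, fun j hj => ?_, hlt⟩
  rcases Nat.lt_or_ge N j with hj' | hj'
  · rw [(hN _ (hζ ▸ Set.mem_range_self a)).inv j hj', (hN _ (hζ ▸ Set.mem_range_self b)).inv j hj']
  · have h1 : (w * ζ a)⁻¹ (N - (N - j)) = (w * ζ b)⁻¹ (N - (N - j)) := hk (N - j) (by omega)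
    rwa [Nat.sub_sub_self hj'] at h1

theorem sum_eq_sum_enum {R : Type*} [AddCommMonoid R] (F : Equiv.Perm ℕ → R) {r : ℕ}
    {ζ : Fin r → Equiv.Perm ℕ} (hζ : Function.Injective ζ) {w : Equiv.Perm ℕ}
    {Z : Finset (Equiv.Perm ℕ)} (hZ : (Z : Set (Equiv.Perm ℕ)) = (w * ·) '' Set.range ζ) :
    ∑ z ∈ Z, F z = ∑ j, F (w * ζ j) := by
  classical
  rw [show Z = Finset.univ.image fun j => w * ζ j from Finset.coe_injective (by
      rw [hZ, Finset.coe_image, Finset.coe_univ, Set.image_univ, ← Set.range_comp]; rfl),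
    Finset.sum_image fun a _ b _ h => hζ (mul_left_cancel h)]

theorem upSet_zero_eq_image (i d : ℕ) (w : Equiv.Perm ℕ) :
    upSet i 0 d w = (w * ·) '' setX w i d := by
  ext z
  constructor
  · rintro ⟨c, hc, -, rfl⟩
    exact ⟨_, ⟨c, hc, rfl⟩, rfl⟩
  · rintro ⟨_, ⟨c, hc, rfl⟩, rfl⟩
    exact ⟨c, hc, fun _ => Nat.zero_le _, rfl⟩

theorem downSet_eq_image {i M N d : ℕ} (hi : i ≤ M) (hMN : M ≤ N) {w : Equiv.Perm ℕ}
    (hw : Small M w) : downSet i (N + 1) d w = (w * ·) '' setY w i d := by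
  ext z
  constructor
  · rintro ⟨c, hc, -, rfl⟩
    exact ⟨_, ⟨c, hc, rfl⟩, rfl⟩
  · rintro ⟨_, ⟨c, hc, rfl⟩, rfl⟩
    refine ⟨c, hc, fun j => ?_, rfl⟩
    cases d with
    | zero => exact j.elim0
    | succ d =>
      have h1 := hc.2.antitone (Fin.zero_le j)
      obtain ⟨h2, -, h3⟩ := ((isYChain_succ hw).mp hc).1
      have h4 := h3.lt_of_small hw (by omega)
      have h5 : w (c 0).2 ≤ M := by
        rcases h4.lt_or_eq with h5 | h5
        · exact (hw.lt h5).le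
        · rw [h5, hw M le_rfl]
      simp only [Fin.val_zero, chainPerm_zero] at h1
      omega

theorem mem_downSet_one {i M N : ℕ} (hi : i ≤ M) (hMN : M ≤ N) {w z : Equiv.Perm ℕ}
    (hw : Small M w) : z ∈ downSet i (N + 1) 1 w ↔
      ∃ p q, p < i ∧ i ≤ q ∧ Cov w p q ∧ w * Equiv.swap p q = z := by
  rw [downSet_eq_image hi hMN hw]
  constructor
  · rintro ⟨_, ⟨c, hc, rfl⟩, rfl⟩
    obtain ⟨h1, h2, h3⟩ := ((isYChain_succ hw).mp hc).1
    exact ⟨_, _, h1, h2, h3, by rw [chainProd_succ, chainProd_zero, mul_one]⟩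
  · rintro ⟨p, q, h1, h2, h3, rfl⟩
    refine ⟨_, ⟨fun _ => (p, q), (isYChain_succ hw).mpr ⟨⟨h1, h2, h3⟩, ?_, fun j => j.elim0⟩, rfl⟩,
      by rw [chainProd_succ, chainProd_zero, mul_one]⟩
    exact ⟨fun j => j.elim0, fun j => j.elim0⟩

end Enumeration

/-! ### The transition formula for the Macdonald numbers -/

section MacTransition

theorem swap_eq_swap {p q p' q' : ℕ} (h : p < q) (h' : p' < q')
    (e : Equiv.swap p q = Equiv.swap p' q') : p = p' ∧ q = q' := by
  have h1 := DFunLike.congr_fun e p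
  have h2 := DFunLike.congr_fun e q
  rw [Equiv.swap_apply_left, Equiv.swap_apply_def] at h1
  rw [Equiv.swap_apply_right, Equiv.swap_apply_def] at h2
  split_ifs at h1 h2 <;> omega

variable {w : Equiv.Perm ℕ} {r s : ℕ}

theorem LastDescent.lt_of_small (h : LastDescent w r s) {M : ℕ} (hM : Small M w) : s < M := by
  by_contra hc
  have h1 := h.lt
  have h2 := h.apply_lt
  rw [hM s (by omega)] at h2
  rcases Nat.lt_or_ge r M with hr | hr
  · have := hM.lt hr
    omega
  · rw [hM r hr] at h2
    omega

theorem LastDescent.lower_small (h : LastDescent w r s) {M : ℕ} (hM : Small M w) :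
    Small M (w * Equiv.swap r s) :=
  hM.mul (small_swap (h.lt.trans (h.lt_of_small hM)) (h.lt_of_small hM))

theorem LastDescent.cross_small (h : LastDescent w r s) {M p : ℕ} (hM : Small M w)
    (hc : Cov (w * Equiv.swap r s) p r) : Small M (w * Equiv.swap r s * Equiv.swap p r) :=
  (h.lower_small hM).mul (small_swap (hc.1.trans (h.lt.trans (h.lt_of_small hM)))
    (h.lt.trans (h.lt_of_small hM)))

/-- The positions `p` for which `t_{pr}` covers `w t_{rs}`. -/
theorem LastDescent.exists_crossings (w : Equiv.Perm ℕ) (r s : ℕ) :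
    ∃ P : Finset ℕ, ∀ p, p ∈ P ↔ Cov (w * Equiv.swap r s) p r := by
  classical
  refine ⟨(Finset.range r).filter fun p => Cov (w * Equiv.swap r s) p r, fun p => ?_⟩
  rw [Finset.mem_filter, Finset.mem_range]
  exact ⟨And.right, fun h => ⟨h.1, h⟩⟩

/-- Difference of the dual Pieri rules with `d = 1` for `i = r + 1` and `i = r`, applied to `v = w
t_{rs}`: the right sides differ by `mac v`. Covers occurring only in the former have `p = r`, hence
yield `w`; those occurring only in the latter have `q = r`, hence yield the `v t_{pr}`. -/
theorem LastDescent.mac_eq (h : LastDescent w r s) {M N : ℕ} (hMN : M ≤ N) (hM : Small M w)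
    {P : Finset ℕ} (hP : ∀ p, p ∈ P ↔ Cov (w * Equiv.swap r s) p r) :
    mac N w = mac N (w * Equiv.swap r s) +
      ∑ p ∈ P, mac N (w * Equiv.swap r s * Equiv.swap p r) := by
  classical
  have hs := h.lt_of_small hM
  have hrs := h.lt
  set v := w * Equiv.swap r s with hv
  have hvM : Small M v := h.lower_small hM
  have hvw : v * Equiv.swap r s = w := by rw [hv, mul_assoc, Equiv.swap_mul_self, mul_one]
  obtain ⟨Z, hZ, hZ'⟩ := sum_mac_downSet (i := r + 1) (d := 1) (by omega) hMN hvM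
  obtain ⟨Y, hY, hY'⟩ := sum_mac_downSet (i := r) (d := 1) (by omega) hMN hvM
  have hZm := fun z => (Set.ext_iff.mp hZ z).trans (mem_downSet_one (by omega) hMN hvM)
  have hYm := fun z => (Set.ext_iff.mp hY z).trans (mem_downSet_one (by omega) hMN hvM)
  simp only [Finset.mem_coe] at hZm hYm
  have hwZ : w ∈ Z := (hZm w).mpr ⟨r, s, by omega, hrs, (h.cov_lower hrs).mpr rfl, hvw⟩
  have hdisj : Disjoint (Z.erase w) (P.image fun p => v * Equiv.swap p r) := by
    rw [Finset.disjoint_left]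
    intro z hz hz'
    obtain ⟨p, q, h1, h2, h3, rfl⟩ := (hZm z).mp (Finset.mem_of_mem_erase hz)
    obtain ⟨p', hp', e⟩ := Finset.mem_image.mp hz'
    have := swap_eq_swap ((hP p').mp hp').1 h3.1 (mul_left_cancel e)
    omega
  have hYeq : Y = Z.erase w ∪ P.image fun p => v * Equiv.swap p r := by
    ext z
    rw [Finset.mem_union, Finset.mem_erase, Finset.mem_image, hYm, hZm]
    constructor
    · rintro ⟨p, q, h1, h2, h3, rfl⟩
      rcases h2.lt_or_eq with h4 | rfl
      · refine Or.inl ⟨fun e => ?_, p, q, by omega, h4, h3, rfl⟩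
        have := swap_eq_swap h3.1 hrs (mul_left_cancel (e.trans hvw.symm))
        omega
      · exact Or.inr ⟨p, (hP p).mpr h3, rfl⟩
    · rintro (⟨hne, p, q, h1, h2, h3, rfl⟩ | ⟨p, hp, rfl⟩)
      · rcases (Nat.lt_succ_iff.mp h1).lt_or_eq with h4 | rfl
        · exact ⟨p, q, h4, by omega, h3, rfl⟩
        · rw [(h.cov_lower h2).mp h3] at hne
          exact absurd hvw hne
      · exact ⟨p, r, ((hP p).mp hp).1, le_rfl, (hP p).mp hp, rfl⟩
  have hsum : ∑ y ∈ Y, mac N y =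
      ∑ z ∈ Z.erase w, mac N z + ∑ p ∈ P, mac N (v * Equiv.swap p r) := by
    rw [hYeq, Finset.sum_union hdisj, Finset.sum_image]
    intro p hp p' hp' e
    exact (swap_eq_swap ((hP p).mp hp).1 ((hP p').mp hp').1 (mul_left_cancel e)).1
  have hsum' := Finset.add_sum_erase Z (mac N) hwZ
  rw [Nat.choose_one_right] at hZ' hY'
  push_cast at hZ'
  linarith

/-- Induction on the permutations in `permSet n` along the transition formula. -/
theorem permSet_induction {motive : Equiv.Perm ℕ → Prop} {n M : ℕ} (one : motive 1)
    (step : ∀ w r s, r < n → LastDescent w r s → Small M w → motive (w * Equiv.swap r s) →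
      (∀ p, Cov (w * Equiv.swap r s) p r → motive (w * Equiv.swap r s * Equiv.swap p r)) →
      motive w) {w : Equiv.Perm ℕ} (hw : w ∈ permSet n) (hM : Small M w) : motive w := by
  suffices H : ∀ r ≤ n, ∀ w ∈ permSet r, Small M w → motive w from H n le_rfl w hw hM
  intro r
  induction r with
  | zero =>
    intro _ w hw hM
    have hmono : StrictMono w := fun a b hab => hw.2 (Nat.zero_le a) (Nat.zero_le b) hab
    have hmono' : StrictMono ⇑w⁻¹ := fun a b hab =>
      hmono.lt_iff_lt.mp (by simpa using hab)
    have hid : ∀ k, w k = k := fun k => by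
      refine le_antisymm ?_ hmono.le_apply
      simpa using hmono.monotone (hmono'.le_apply (x := k))
    rwa [show w = 1 from Equiv.ext hid]
  | succ r ih =>
    intro hr
    -- Inner induction on the value at `r`: it drops to `w s` in `w t_{rs}` and further in the
    -- permutations `w t_{rs} t_{pr}`. When there is no descent at `r`, the outer induction takes
    -- over.
    suffices H : ∀ m, ∀ w ∈ permSet (r + 1), Small M w → w r = m → motive w from
      fun w hw hM => H _ w hw hM rfl
    intro m
    induction m using Nat.strong_induction_on with
    | _ m ih' =>
      intro w hw hM hm
      rcases Nat.lt_or_ge (w (r + 1)) (w r) with hlt | hge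
      · obtain ⟨s, h⟩ := exists_lastDescent hw hlt
        have h1 : (w * Equiv.swap r s) r = w s := by
          rw [Equiv.Perm.mul_apply, Equiv.swap_apply_left]
        refine step w r s hr h hM (ih' _ (hm ▸ h.apply_lt) _ h.lower_mem (h.lower_small hM) h1)
          fun p hp => ?_
        have h2 := hp.2.1
        rw [h1] at h2
        refine ih' _ (hm ▸ h2.trans h.apply_lt) _
          (hp.permSet h.lower_mem (hp.1.trans (Nat.lt_succ_self r))) (h.cross_small hM hp) ?_
        rw [Equiv.Perm.mul_apply, Equiv.swap_apply_right]
      · refine ih (by omega) w ⟨hw.1, fun a ha b hb hab => ?_⟩ hM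
        have hne : w (r + 1) ≠ w r := fun e => by
          have := w.injective e
          omega
        rw [Set.mem_Ici] at ha hb
        rcases ha.lt_or_eq with ha | rfl
        · exact hw.2 ha (show r + 1 ≤ b by omega) hab
        · refine (lt_of_le_of_ne hge hne.symm).trans_le ?_
          exact hw.2.monotoneOn (Set.mem_Ici.mpr le_rfl) (show r + 1 ≤ b by omega) hab

end MacTransition

end KP
end

noncomputable section
namespace KP

/-! ### Dimensions of the KP modules and the two filtrations -/

theorem isKPFiltration_spanChain {K : Type*} [Field K] {n : ℕ} {A : Type*} [AddCommGroup A] [Module K A]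
    [LieRingModule (borel K n) A] [LieModule K (borel K n) A] {r : ℕ} {v : Fin r → A}
    {φ : Fin r → A →ₗ[K] T K n} {z : Fin r → Equiv.Perm ℕ} (hz : ∀ j, z j ∈ permSet n)
    (h : spanChain (K := K) (n := n) v (Fin.last r) = ⊤ ∧ ∀ j : Fin r,
      InducesIso (φ j) (spanChain v j.castSucc) (spanChain v j.succ) (kpMod K n (z j))) :
    LieSubmodule.lieSpan K (borel K n) (Set.range v) = ⊤ ∧ IsKPFiltration K n (spanChain v) ∧
      ∀ j : Fin r, z j ∈ permSet n ∧
        InducesIso (φ j) (spanChain v j.castSucc) (spanChain v j.succ) (kpMod K n (z j)) := by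
  refine ⟨(spanChain_last v).symm.trans h.1, ⟨spanChain_zero v, h.1, spanChain_mono v, fun j => ?_⟩,
    fun j => ⟨hz j, h.2 j⟩⟩
  obtain ⟨e, -⟩ := h.2 j
  exact ⟨z j, hz j, ⟨e⟩⟩

/-- The empty diagram gives a nonzero scalar, which derivations kill. -/
theorem finrank_kpMod_one {K : Type*} [Field K] {n : ℕ} : Module.finrank K (kpMod K n 1) = 1 := by
  obtain ⟨a, ha, h1⟩ : ∃ a : K, a ≠ 0 ∧ uVec K n 1 = algebraMap K (T K n) a := by
    obtain ⟨l, -, hl, a, ha, e⟩ := isMon_uVec (K := K) (n := n) 1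
    have : l = [] := List.eq_nil_iff_forall_not_mem.mpr fun x hx => by
      have h := (hl x).mp hx
      exact h.1.asymm h.2
    rw [this] at e
    exact ⟨a, ha, e.trans (Algebra.algebraMap_eq_smul_one a).symm⟩
  have h2 : (kpMod K n 1).toSubmodule = Submodule.span K {uVec K n 1} := by
    refine le_antisymm ?_ (Submodule.span_le.mpr (Set.singleton_subset_iff.mpr
      (LieSubmodule.subset_lieSpan (Set.mem_singleton _))))
    let L : LieSubmodule K (borel K n) (T K n) :=
      { Submodule.span K {uVec K n 1} with
        lie_mem := by
          intro x m hm
          obtain ⟨b, rfl⟩ := Submodule.mem_span_singleton.mp hm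
          rw [show ⁅x, b • uVec K n 1⁆ = 0 by
            rw [ext_lie_def, map_smul, h1, deriv_algebraMap, smul_zero]]
          exact (Submodule.span K {uVec K n 1}).zero_mem }
    change kpMod K n 1 ≤ L
    rw [kpMod, LieSubmodule.lieSpan_le]
    exact Submodule.subset_span
  change Module.finrank K (kpMod K n 1).toSubmodule = 1
  rw [h2]
  exact finrank_span_singleton (by
    rw [h1, Ne, ExteriorAlgebra.algebraMap_eq_zero_iff]
    exact ha)

/-! ### Dimension equals Macdonald number, and the filtrations -/

section Dimension

variable {K : Type*} [Field K] [CharZero K] {n : ℕ} {w : Equiv.Perm ℕ}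

instance colMod_finite (i : ℕ) : FiniteDimensional K (colMod K n i) :=
  inferInstanceAs (FiniteDimensional K (colMod K n i).toSubmodule)

instance symPow_finite (i d : ℕ) : FiniteDimensional K (symPow K (colMod K n i) (borel K n) d) :=
  inferInstanceAs (FiniteDimensional K (symPow K (colMod K n i) (borel K n) d).toSubmodule)

instance altPow_finite (i d : ℕ) : FiniteDimensional K (altPow K (colMod K n i) (borel K n) d) :=
  inferInstanceAs (FiniteDimensional K (altPow K (colMod K n i) (borel K n) d).toSubmodule)

theorem finrank_symMod_le {i : ℕ} (hin : i ≤ n) (d : ℕ) : Module.finrank K (SymMod K n w i d) ≤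
    i.multichoose d * Module.finrank K (kpMod K n w) := by
  rw [Module.finrank_tensorProduct, mul_comm]
  refine Nat.mul_le_mul_right _ ((finrank_symPow_le d).trans ?_)
  rw [Nat.multichoose_eq, Nat.multichoose_eq]
  have := finrank_colMod_le (K := K) hin
  exact Nat.choose_le_choose d (by omega)

theorem finrank_altMod_le {i : ℕ} (hin : i ≤ n) (d : ℕ) : Module.finrank K (AltMod K n w i d) ≤
    i.choose d * Module.finrank K (kpMod K n w) := by
  rw [Module.finrank_tensorProduct, mul_comm]
  exact Nat.mul_le_mul_right _ ((finrank_altPow_le d).trans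
    (Nat.choose_le_choose d (finrank_colMod_le hin)))

theorem sym_chain_dimension {i d N r : ℕ} (hin : i ≤ n) (hw : w ∈ permSet n) (hN : Small N w)
    {ζ : Fin r → Equiv.Perm ℕ} (hζ : ∀ a b, a < b → LexLt (w * ζ a)⁻¹ (w * ζ b)⁻¹)
    {c : Fin r → Fin d → ℕ × ℕ} (hc : ∀ j, IsXChain w i (c j) ∧ chainProd (c j) = ζ j) :
    ∑ j, Module.finrank K (kpMod K n (w * ζ j)) ≤ Module.finrank K (SymMod K n w i d) ∧
      (Module.finrank K (SymMod K n w i d) ≤ ∑ j, Module.finrank K (kpMod K n (w * ζ j)) →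
        spanChain (K := K) (n := n) (fun j => symVec K n w i (c j)) (Fin.last r) = ⊤ ∧
        ∀ j : Fin r, InducesIso (symPhi K n w i (c j))
          (spanChain (fun k => symVec K n w i (c k)) j.castSucc)
          (spanChain (fun k => symVec K n w i (c k)) j.succ) (kpMod K n (w * ζ j))) := by
  have hirr : ∀ u, ¬ LexLt u u := fun u h => h.asymm h
  refine chain_dimension (fun j => symPhi_lie w i (c j)) (fun j => ?_) fun j k hkj => ?_
  · rw [symPhi_symVec hin _ (hc j).1.1, ← (hc j).2]
    exact (symValue_eq hin hw hN (hc j).1 (hc j).1 (hirr _)).1 rfl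
  · rw [symPhi_symVec hin _ (hc k).1.1]
    have h := hζ k j hkj
    refine (symValue_eq hin hw hN (hc j).1 (hc k).1 ?_).2 fun e => ?_
    · rw [(hc j).2, (hc k).2]
      exact h.asymm
    · rw [← (hc j).2, ← (hc k).2, e] at h
      exact hirr _ h

theorem alt_chain_dimension {i d N r : ℕ} (hin : i ≤ n) (hw : w ∈ permSet n) (hN : Small N w)
    {ζ : Fin r → Equiv.Perm ℕ} (hζ : ∀ a b, a < b → RevLexLt (w * ζ a)⁻¹ (w * ζ b)⁻¹)
    {c : Fin r → Fin d → ℕ × ℕ} (hc : ∀ j, IsYChain w i (c j) ∧ chainProd (c j) = ζ j) :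
    ∑ j, Module.finrank K (kpMod K n (w * ζ j)) ≤ Module.finrank K (AltMod K n w i d) ∧
      (Module.finrank K (AltMod K n w i d) ≤ ∑ j, Module.finrank K (kpMod K n (w * ζ j)) →
        spanChain (K := K) (n := n) (fun j => altVec K n w i (c j)) (Fin.last r) = ⊤ ∧
        ∀ j : Fin r, InducesIso (altPhi K n w i (c j))
          (spanChain (fun k => altVec K n w i (c k)) j.castSucc)
          (spanChain (fun k => altVec K n w i (c k)) j.succ) (kpMod K n (w * ζ j))) := by
  have hirr : ∀ u, ¬ RevLexLt u u := fun u h => h.asymm h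
  refine chain_dimension (fun j => altPhi_lie w i (c j)) (fun j => ?_) fun j k hkj => ?_
  · rw [altPhi_altVec hin _ (hc j).1.1, ← (hc j).2]
    exact (altValue_eq hin hw hN (hc j).1 (hc j).1 (hirr _)).1 rfl
  · rw [altPhi_altVec hin _ (hc k).1.1]
    have h := hζ k j hkj
    refine (altValue_eq hin hw hN (hc j).1 (hc k).1 ?_).2 fun e => ?_
    · rw [(hc j).2, (hc k).2]
      exact h.asymm
    · rw [← (hc j).2, ← (hc k).2, e] at h
      exact hirr _ h

theorem injective_of_strict {r : ℕ} {R : Equiv.Perm ℕ → Equiv.Perm ℕ → Prop}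
    (hR : ∀ u, ¬ R u u) {ζ : Fin r → Equiv.Perm ℕ}
    (hζ : ∀ a b, a < b → R (w * ζ a)⁻¹ (w * ζ b)⁻¹) : Function.Injective ζ := by
  intro a b hab
  rcases lt_trichotomy a b with h | h | h
  · exact absurd (hab ▸ hζ a b h) (hR _)
  · exact h
  · exact absurd (hab ▸ hζ b a h) (hR _)

/-- This half of the filtration theorem rests on the triangularity alone. It does not presuppose the
dimensions of the KP modules, hence may be used to determine them. -/
theorem sum_finrank_downSet_le {i d M N : ℕ} (hin : i ≤ n) (hi : i ≤ M) (hMN : M ≤ N)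
    (hw : w ∈ permSet n) (hM : Small M w) {Z : Finset (Equiv.Perm ℕ)}
    (hZ : (Z : Set (Equiv.Perm ℕ)) = downSet i (N + 1) d w) :
    ∑ z ∈ Z, Module.finrank K (kpMod K n z) ≤
      i.choose d * Module.finrank K (kpMod K n w) := by
  rw [downSet_eq_image hi hMN hM] at hZ
  have hfin : (setY w i d).Finite :=
    Set.Finite.of_finite_image (hZ ▸ Z.finite_toSet) (mul_right_injective w).injOn
  obtain ⟨r, ζ, hζ, hlt⟩ := exists_revLexLt_enum hfin (w := w) (N := M + d) fun ζ h => by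
    obtain ⟨c, hc, rfl⟩ := h
    exact (isPieriChain_small hi hM hc.1).mono (by omega)
  have hex : ∀ j, ∃ c : Fin d → ℕ × ℕ, IsYChain w i c ∧ chainProd c = ζ j := fun j =>
    hζ.le (Set.mem_range_self j)
  choose c hc using hex
  rw [sum_eq_sum_enum _ (injective_of_strict (fun u h => h.asymm h) hlt) (hζ ▸ hZ)]
  exact (alt_chain_dimension hin hw hM hlt hc).1.trans (finrank_altMod_le hin d)

/-- Along transitions the dimension satisfies an inequality where `mac` satisfies an equality. -/
theorem mac_le_finrank {M N : ℕ} (hMN : M ≤ N) (hw : w ∈ permSet n) (hM : Small M w) :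
    mac N w ≤ Module.finrank K (kpMod K n w) := by
  refine permSet_induction (n := n) (M := M)
    (motive := fun w => mac N w ≤ Module.finrank K (kpMod K n w)) ?_ ?_ hw hM
  · rw [mac_of_length_eq_zero N length_one, finrank_kpMod_one, Nat.cast_one]
  · intro w r s hr h hM h1 h2
    obtain ⟨P, hP⟩ := LastDescent.exists_crossings w r s
    have h3 := h.finrank_le (K := K) hr fun p hp => (hP p).mp hp
    rw [h.mac_eq hMN hM hP]
    refine (add_le_add h1 (Finset.sum_le_sum fun p hp => h2 p ((hP p).mp hp))).trans ?_
    exact_mod_cast h3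

/-- For `v = w t_{rs}` the equality is known by induction. Over the covers `z` of `v` with `p ≤ r <
q`, `∑ dim 𝒮_z ≤ (r + 1) dim 𝒮_v = (r + 1) mac v = ∑ mac z`, while `mac z ≤ dim 𝒮_z` termwise. So
equality holds for each `z`, in particular for `w`. The bound `M + 1 ≤ N` accommodates the supports
of the covers. -/
theorem finrank_kpMod_eq_mac {M N : ℕ} (hMN : M + 1 ≤ N) (hw : w ∈ permSet n) (hM : Small M w) :
    (Module.finrank K (kpMod K n w) : ℚ) = mac N w := by
  refine permSet_induction (n := n) (M := M)
    (motive := fun w => (Module.finrank K (kpMod K n w) : ℚ) = mac N w) ?_ ?_ hw hM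
  · rw [mac_of_length_eq_zero N length_one, finrank_kpMod_one, Nat.cast_one]
  · intro w r s hr h hM h1 _
    have hrs := h.lt
    have hs := h.lt_of_small hM
    have hv := permSet_mono (show r + 1 ≤ n from hr) h.lower_mem
    have hvM := h.lower_small hM
    set v := w * Equiv.swap r s with hv'
    obtain ⟨Z, hZ, hZ'⟩ := sum_mac_downSet (i := r + 1) (N := N) (d := 1) (by omega) (by omega) hvM
    have hle := sum_finrank_downSet_le (K := K) hr (by omega) (by omega) hv hvM hZ
    have hZm := fun z => (Set.ext_iff.mp hZ z).trans (mem_downSet_one (by omega) (by omega) hvM)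
    have hge : ∀ z ∈ Z, mac N z ≤ Module.finrank K (kpMod K n z) := fun z hz => by
      obtain ⟨p, q, h2, h3, h4, rfl⟩ := (hZm z).mp hz
      have := h4.lt_of_small hvM (by omega)
      exact mac_le_finrank hMN (h4.permSet hv (by omega))
        ((hvM.mono (Nat.le_succ M)).mul (small_swap (by omega) (by omega)))
    have hwZ : w ∈ Z := (hZm w).mpr ⟨r, s, by omega, hrs, (h.cov_lower hrs).mpr rfl,
      by rw [hv', mul_assoc, Equiv.swap_mul_self, mul_one]⟩
    refine le_antisymm ?_ (hge w hwZ)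
    by_contra hc
    have h5 := Finset.sum_lt_sum hge ⟨w, hwZ, not_le.mp hc⟩
    have h6 : ∑ z ∈ Z, (Module.finrank K (kpMod K n z) : ℚ) ≤
        ((r + 1).choose 1 : ℕ) * (Module.finrank K (kpMod K n v) : ℚ) := by
      exact_mod_cast hle
    rw [hZ', ← h1] at h5
    exact h5.not_ge h6

variable (K) in
theorem sum_finrank_eq {Z : Finset (Equiv.Perm ℕ)} {M N d k : ℕ} (hMN : M + d + 1 ≤ N)
    (hw : w ∈ permSet n) (hM : Small M w) (hZn : ∀ z ∈ Z, z ∈ permSet n)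
    (hZM : ∀ z ∈ Z, Small (M + d) z) (h : ∑ z ∈ Z, mac N z = (k : ℚ) * mac N w) :
    ∑ z ∈ Z, Module.finrank K (kpMod K n z) = k * Module.finrank K (kpMod K n w) := by
  rw [← finrank_kpMod_eq_mac (K := K) (by omega) hw hM, Finset.sum_congr rfl fun z hz =>
    (finrank_kpMod_eq_mac (K := K) hMN (hZn z hz) (hZM z hz)).symm] at h
  exact_mod_cast h

variable (K) in
set_option maxHeartbeats 800000 in
theorem exists_sym_filtration {i : ℕ} (hi : 1 ≤ i) (hin : i ≤ n) (d : ℕ) (hw : w ∈ permSet n) :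
    ∃ (r : ℕ) (ζ : Fin r → Equiv.Perm ℕ),
      Set.range ζ = setX w i d ∧
      (∀ a b : Fin r, a < b → LexLt (w * ζ a)⁻¹ (w * ζ b)⁻¹) ∧
      ∀ c : Fin r → Fin d → ℕ × ℕ,
        (∀ j, IsXChain w i (c j) ∧ chainProd (c j) = ζ j) →
        LieSubmodule.lieSpan K (borel K n)
          (Set.range fun j => symVec K n w i (c j)) = ⊤ ∧
        IsKPFiltration K n (spanChain fun j => symVec K n w i (c j)) ∧
        ∀ j : Fin r, w * ζ j ∈ permSet n ∧
          InducesIso (symPhi K n w i (c j))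
            (spanChain (fun k => symVec K n w i (c k)) j.castSucc)
            (spanChain (fun k => symVec K n w i (c k)) j.succ)
            (kpMod K n (w * ζ j)) := by
  obtain ⟨M, hM, hnM⟩ : ∃ M, Small M w ∧ n ≤ M := by
    obtain ⟨M, hM⟩ := exists_small hw.1
    exact ⟨max M n, hM.mono (le_max_left M n), le_max_right M n⟩
  have hiM : i ≤ M := hin.trans hnM
  obtain ⟨Z, hZ, hsum⟩ := sum_mac_upSet (N := M + d + 1) (d := d) hi hiM (by omega) hM
  rw [upSet_zero_eq_image] at hZ
  have hfin : (setX w i d).Finite :=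
    Set.Finite.of_finite_image (hZ ▸ Z.finite_toSet) (mul_right_injective w).injOn
  obtain ⟨r, ζ, hζ, hlt⟩ := exists_lexLt_enum hfin w
  refine ⟨r, ζ, hζ, hlt, fun c hc => ?_⟩
  have hmem : ∀ z ∈ Z, z ∈ permSet n ∧ Small (M + d) z := fun z hz => by
    obtain ⟨_, ⟨c, hc, rfl⟩, rfl⟩ := hZ.le hz
    exact ⟨isPieriChain_permSet hin hw hc.1, isPieriChain_small hiM hM hc.1⟩
  have hdim := sum_finrank_eq K le_rfl hw hM (fun z hz => (hmem z hz).1)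
    (fun z hz => (hmem z hz).2) hsum
  rw [sum_eq_sum_enum _ (injective_of_strict (fun u h => h.asymm h) hlt) (hζ ▸ hZ)] at hdim
  -- The Pieri rule, now for dimensions, supplies the upper bound on `dim M` that forces equality
  -- throughout.
  have hchain := (sym_chain_dimension hin hw hM hlt hc).2
    ((finrank_symMod_le hin d).trans hdim.ge)
  have hz : ∀ j, w * ζ j ∈ permSet n := fun j =>
    (hmem _ (hZ.ge ⟨_, hζ.le (Set.mem_range_self j), rfl⟩)).1
  have := isKPFiltration_spanChain (v := fun j => symVec K n w i (c j))
    (φ := fun j => symPhi K n w i (c j)) (z := fun j => w * ζ j) hz hchain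
  exact this

variable (K) in
set_option maxHeartbeats 800000 in
theorem exists_alt_filtration {i : ℕ} (hin : i ≤ n) (d : ℕ) (hw : w ∈ permSet n) :
    ∃ (r : ℕ) (ζ : Fin r → Equiv.Perm ℕ),
      Set.range ζ = setY w i d ∧
      (∀ a b : Fin r, a < b → RevLexLt (w * ζ a)⁻¹ (w * ζ b)⁻¹) ∧
      ∀ c : Fin r → Fin d → ℕ × ℕ,
        (∀ j, IsYChain w i (c j) ∧ chainProd (c j) = ζ j) →
        LieSubmodule.lieSpan K (borel K n)
          (Set.range fun j => altVec K n w i (c j)) = ⊤ ∧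
        IsKPFiltration K n (spanChain fun j => altVec K n w i (c j)) ∧
        ∀ j : Fin r, w * ζ j ∈ permSet n ∧
          InducesIso (altPhi K n w i (c j))
            (spanChain (fun k => altVec K n w i (c k)) j.castSucc)
            (spanChain (fun k => altVec K n w i (c k)) j.succ)
            (kpMod K n (w * ζ j)) := by
  obtain ⟨M, hM, hnM⟩ : ∃ M, Small M w ∧ n ≤ M := by
    obtain ⟨M, hM⟩ := exists_small hw.1
    exact ⟨max M n, hM.mono (le_max_left M n), le_max_right M n⟩
  have hiM : i ≤ M := hin.trans hnM
  obtain ⟨Z, hZ, hsum⟩ := sum_mac_downSet (N := M + d + 1) (d := d) hiM (by omega) hM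
  rw [downSet_eq_image hiM (by omega) hM] at hZ
  have hfin : (setY w i d).Finite :=
    Set.Finite.of_finite_image (hZ ▸ Z.finite_toSet) (mul_right_injective w).injOn
  have hmem : ∀ z ∈ Z, z ∈ permSet n ∧ Small (M + d) z := fun z hz => by
    obtain ⟨_, ⟨c, hc, rfl⟩, rfl⟩ := hZ.le hz
    exact ⟨isPieriChain_permSet hin hw hc.1, isPieriChain_small hiM hM hc.1⟩
  obtain ⟨r, ζ, hζ, hlt⟩ := exists_revLexLt_enum hfin (w := w) (N := M + d) fun ζ h =>
    ((hmem _ (hZ.ge ⟨ζ, h, rfl⟩)).2.mono (Nat.le_succ _))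
  refine ⟨r, ζ, hζ, hlt, fun c hc => ?_⟩
  have hdim := sum_finrank_eq K le_rfl hw hM (fun z hz => (hmem z hz).1)
    (fun z hz => (hmem z hz).2) hsum
  rw [sum_eq_sum_enum _ (injective_of_strict (fun u h => h.asymm h) hlt) (hζ ▸ hZ)] at hdim
  -- As in the symmetric case, with the dual Pieri rule and `C(i, d)` as the bound for the exterior
  -- power.
  have hchain := (alt_chain_dimension hin hw hM hlt hc).2
    ((finrank_altMod_le hin d).trans hdim.ge)
  have hz : ∀ j, w * ζ j ∈ permSet n := fun j =>
    (hmem _ (hZ.ge ⟨_, hζ.le (Set.mem_range_self j), rfl⟩)).1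
  have := isKPFiltration_spanChain (v := fun j => altVec K n w i (c j))
    (φ := fun j => altPhi K n w i (c j)) (z := fun j => w * ζ j) hz hchain
  exact this

end Dimension

end KP
end

theorem theorem4p3 {K : Type*} [Field K] [CharZero K] (n i d : ℕ) (hi : 1 ≤ i) (hin : i ≤ n)
    (w : Equiv.Perm ℕ) (hw : w ∈ KP.permSet n) :
    -- the module `𝒮_w ⊗ S^d(K^i)`
    (∃ (r : ℕ) (ζ : Fin r → Equiv.Perm ℕ),
      Set.range ζ = KP.setX w i d ∧
      (∀ a b : Fin r, a < b → KP.LexLt (w * ζ a)⁻¹ (w * ζ b)⁻¹) ∧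
      ∀ c : Fin r → Fin d → ℕ × ℕ,
        (∀ j, KP.IsXChain w i (c j) ∧ KP.chainProd (c j) = ζ j) →
        LieSubmodule.lieSpan K (KP.borel K n)
          (Set.range fun j => KP.symVec K n w i (c j)) = ⊤ ∧
        KP.IsKPFiltration K n (KP.spanChain fun j => KP.symVec K n w i (c j)) ∧
        ∀ j : Fin r, w * ζ j ∈ KP.permSet n ∧
          KP.InducesIso (KP.symPhi K n w i (c j))
            (KP.spanChain (fun k => KP.symVec K n w i (c k)) j.castSucc)
            (KP.spanChain (fun k => KP.symVec K n w i (c k)) j.succ)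
            (KP.kpMod K n (w * ζ j))) ∧
    -- the module `𝒮_w ⊗ ⋀^d(K^i)`
    (∃ (r : ℕ) (ζ : Fin r → Equiv.Perm ℕ),
      Set.range ζ = KP.setY w i d ∧
      (∀ a b : Fin r, a < b → KP.RevLexLt (w * ζ a)⁻¹ (w * ζ b)⁻¹) ∧
      ∀ c : Fin r → Fin d → ℕ × ℕ,
        (∀ j, KP.IsYChain w i (c j) ∧ KP.chainProd (c j) = ζ j) →
        LieSubmodule.lieSpan K (KP.borel K n)
          (Set.range fun j => KP.altVec K n w i (c j)) = ⊤ ∧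
        KP.IsKPFiltration K n (KP.spanChain fun j => KP.altVec K n w i (c j)) ∧
        ∀ j : Fin r, w * ζ j ∈ KP.permSet n ∧
          KP.InducesIso (KP.altPhi K n w i (c j))
            (KP.spanChain (fun k => KP.altVec K n w i (c k)) j.castSucc)
            (KP.spanChain (fun k => KP.altVec K n w i (c k)) j.succ)
            (KP.kpMod K n (w * ζ j))) :=
  ⟨KP.exists_sym_filtration K hi hin d hw, KP.exists_alt_filtration K hin d hw⟩
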